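/- **Theorem 2.6.** *Setting.* Let $\mathscr H_+$ (resp. $\mathscr H_-$) be the set of continuous functions $F:(0,\infty)^2\to(0,\infty)$ that are nondecreasing in each coordinate, satisfy $F(ax,ay)=aF(x,y)$ for all $a,x,y>0$, and are such that $F\ge\max$ and $\lim_{x\to0}F(x,y)=\lim_{x\to0}F(y,x)=y$ for all $y>0$ (resp. $F\le\min$ and $\lim_{x\to\infty}F(x,y)=\lim_{x\to\infty}F(y,x)=y$ for all $y>0$). Put $\mathscr H=\mathscr H_+\cup\mathscr H_-$ and $\varepsilon(F)=1$ if $F\in\mathscr H_+$, $\varepsilon(F)=-1$ if $F\in\mathscr H_-$. Let $F^*=F$ if $F\in\mathscr H_+$ and $F^*(x,y)=1/F(1/x,1/y)$ if $F\in\mathscr H_-$, and for $t>0$, $a\ge0$, $b>0$ let $$T_F(t)=\sup\{z\in\mathbb R: F^*(e^{-t},e^{-z})\ge1\}\in[0,\infty),\qquad \Gamma_F^{(a,b)}=\int_0^\infty t^a\,T_F(t)^b\,dt\in[0,\infty].$$ For a probability density $\psi$ on $\mathbb R$ with distribution function $\Psi$, let $$\Lambda_{\psi,F}(v)=\int_0^\infty\psi(v-\varepsilon(F)t)\,\big[\Psi(v)-\Psi(v-\varepsilon(F)T_F(t))\big]\,dt,\qquad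 v\in\mathbb R.$$ *The Lambda condition.* A random function $\mathbf F$ with values in $\mathscr H$ satisfies the Lambda condition with $(\psi_n)$, $(\sigma_n)$, $(\beta_n)$ if for every $\delta\in(0,1)$ there are an integer $n_0\ge1$ and numbers $q_n\in(0,1)$, $n\ge n_0$, such that, for all $n\ge n_0$: $\sigma_n\ge0$, $\beta_n\ge0$, $\psi_n$ is a probability density supported in $(-\infty,\sigma_n]$, with distribution function $\Psi_n$, and for all $v<\sigma_{n+1}-\delta\beta_n$ the expectation below exists and $$\mathbb E\big[\Lambda_{\psi_n,\mathbf F}(v)\big]+\frac{1-q_{n+1}}{(1-q_n)^2}\big[\Psi_{n+1}(v+\delta\beta_n)-\Psi_n(v)\big]+\frac{q_{n+1}-q_n}{(1-q_n)^2}\,\big(1-\Psi_n(v)\big)\ \ge\ 0.$$ *Assumptions.* Let $\mathbf F$ be a random function with $\mathbb P(\mathbf F\in\mathscr H)=1$, $\mathbb P(\mathbf F\notin\{\max,\min\})>0$, $\mathbb E[\Gamma_{\mathbf F}^{(0,1)}\varepsilon(\mathbf F)]=0=\mathbb E[\varepsilon(\mathbf F)]$, and, for some $\eta>0$, $\mathbb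 E[\Gamma_{\mathbf F}^{(1+\eta,1)}]<\infty$ and $\mathbb E[\Gamma_{\mathbf F}^{(0,2+\eta)}]<\infty$. Let $c_*=\frac94\,\mathbb E[\Gamma_{\mathbf F}^{(0,2)}+2\Gamma_{\mathbf F}^{(1,1)}]$ and let $$\varrho\in\Big(\frac1{1+\eta\wedge1},1\Big),\qquad \kappa\in\Big(0,\frac{(2-2\varrho)\wedge\eta\wedge1}{3}\Big),\qquad \widetilde\varrho\in\Big(0,\frac{1-3\kappa}2\Big).$$ *The sequences.* Let $$\tau_n=(c_*n)^{1/3},\quad \sigma_n=\tau_n-\tau_n^{\varrho},\quad \beta_n=\tau_{n+1}-\tau_n,\quad a_n=\frac1{2(\tau_n^2\sigma_n-\frac13\sigma_n^3)}.$$ For every $n$ with $\tau_n>1$, let $\widetilde\tau_n>1$ be the unique solution of $$\frac{\widetilde\tau_n^2}{\widetilde\tau_n^2\widetilde\sigma_n-\frac13\widetilde\sigma_n^3}=\frac{\tau_n^2}{\tau_n^2\sigma_n-\frac13\sigma_n^3},\qquad \widetilde\sigma_n=\widetilde\tau_n-\widetilde\tau_n^{\,\widetilde\varrho},$$ let $\widetilde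 a_n=a_n\tau_n^2/\widetilde\tau_n^2$, and $$\psi_n(v)=a_n(\tau_n^2-v^2)\,\mathbf 1_{\{0\le v<\sigma_n\}}+\widetilde a_n(\widetilde\tau_n^2-v^2)\,\mathbf 1_{\{-\widetilde\sigma_n<v<0\}}.$$ *Conclusion.* $\mathbf F$ satisfies the Lambda condition with $(\psi_n)$, $(\sigma_n)$, $(\beta_n)$. More precisely, for every $\delta\in(0,1)$ and every $\delta_1\in(0,\frac\delta9)$, there is an integer $n_0\ge1$ such that the requirements of the Lambda condition for this $\delta$ hold for all $n\ge n_0$ with $$q_n=\delta_1\,(1-n^{-\kappa}).$$ -/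

import Mathlib

open MeasureTheory Set Filter Topology
open scoped ENNReal

namespace HomSys

/-! ### The class of homogeneous functions

A function `(0,∞)² → (0,∞)` is represented by a map `F : ℝ → ℝ → ℝ`, of which only the values on
the open positive quadrant are ever used. -/

/-- Positivity, continuity, monotonicity in each coordinate and `1`-homogeneity on `(0,∞)²`. -/
structure IsHomogeneous (F : ℝ → ℝ → ℝ) : Prop where
  pos : ∀ x y, 0 < x → 0 < y → 0 < F x y
  cont : ContinuousOn (fun p : ℝ × ℝ => F p.1 p.2) (Ioi 0 ×ˢ Ioi 0)
  mono_left : ∀ x x' y, 0 < x → x ≤ x' → 0 < y → F x y ≤ F x' y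
  mono_right : ∀ x y y', 0 < x → 0 < y → y ≤ y' → F x y ≤ F x y'
  hom : ∀ a x y, 0 < a → 0 < x → 0 < y → F (a * x) (a * y) = a * F x y

/-- The class `ℋ₊`. -/
structure IsHPlus (F : ℝ → ℝ → ℝ) : Prop extends IsHomogeneous F where
  max_le : ∀ x y, 0 < x → 0 < y → max x y ≤ F x y
  lim_left : ∀ y, 0 < y → Tendsto (fun x => F x y) (𝓝[>] 0) (𝓝 y)
  lim_right : ∀ y, 0 < y → Tendsto (fun x => F y x) (𝓝[>] 0) (𝓝 y)

/-- The class `ℋ₋`. -/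
structure IsHMinus (F : ℝ → ℝ → ℝ) : Prop extends IsHomogeneous F where
  le_min : ∀ x y, 0 < x → 0 < y → F x y ≤ min x y
  lim_left : ∀ y, 0 < y → Tendsto (fun x => F x y) atTop (𝓝 y)
  lim_right : ∀ y, 0 < y → Tendsto (fun x => F y x) atTop (𝓝 y)

/-- The class `ℋ = ℋ₊ ∪ ℋ₋` (a disjoint union). -/
def IsH (F : ℝ → ℝ → ℝ) : Prop := IsHPlus F ∨ IsHMinus F

open Classical in
/-- `ε(F) = 1_{F ∈ ℋ₊} - 1_{F ∈ ℋ₋}`. -/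
noncomputable def eps (F : ℝ → ℝ → ℝ) : ℝ :=
  (if IsHPlus F then 1 else 0) - (if IsHMinus F then 1 else 0)

/-- `F^inv(x,y) = 1 / F(1/x, 1/y)`. -/
noncomputable def invF (F : ℝ → ℝ → ℝ) : ℝ → ℝ → ℝ := fun x y => 1 / F (1 / x) (1 / y)

open Classical in
/-- `F^* = F` if `F ∈ ℋ₊`, and `F^* = F^inv` if `F ∈ ℋ₋`. -/
noncomputable def starF (F : ℝ → ℝ → ℝ) : ℝ → ℝ → ℝ := if IsHPlus F then F else invF F

/-- `T_F(t) = sup {z : F^*(e^{-t}, e^{-z}) ≥ 1}`; for `F ∈ ℋ` and `t > 0` the set contains `0` and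
is bounded above. -/
noncomputable def T (F : ℝ → ℝ → ℝ) (t : ℝ) : ℝ :=
  sSup {z : ℝ | 1 ≤ starF F (Real.exp (-t)) (Real.exp (-z))}

/-- `Γ_F^{(a,b)} = ∫_0^∞ t^a T_F(t)^b dt ∈ [0,∞]`. -/
noncomputable def Gam (a b : ℝ) (F : ℝ → ℝ → ℝ) : ℝ≥0∞ :=
  ∫⁻ t in Ioi (0 : ℝ), ENNReal.ofReal (t ^ a * T F t ^ b)

/-- `F` agrees on `(0,∞)²` with `φ₊ = max` or with `φ₋ = min`. -/
def IsTrivial (F : ℝ → ℝ → ℝ) : Prop :=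
  (∀ x y, 0 < x → 0 < y → F x y = max x y) ∨ (∀ x y, 0 < x → 0 < y → F x y = min x y)

/-! ### The Lambda condition -/

/-- `ψ` is a probability density function on `ℝ`. -/
structure IsProbDensity (ψ : ℝ → ℝ) : Prop where
  meas : Measurable ψ
  nonneg : ∀ x, 0 ≤ ψ x
  integrable : Integrable ψ
  integral_eq_one : ∫ x, ψ x = 1

/-- The distribution function `Ψ(v) = ∫_{-∞}^v ψ(y) dy`. -/
noncomputable def cdfOf (ψ : ℝ → ℝ) (v : ℝ) : ℝ := ∫ y in Iic v, ψ y

/-- `Λ_{ψ,F}(v) = ∫_0^∞ ψ(v - ε(F) t) [Ψ(v) - Ψ(v - ε(F) T_F(t))] dt`. -/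
noncomputable def Lam (ψ : ℝ → ℝ) (F : ℝ → ℝ → ℝ) (v : ℝ) : ℝ :=
  ∫ t in Ioi (0 : ℝ), ψ (v - eps F * t) * (cdfOf ψ v - cdfOf ψ (v - eps F * T F t))

/-- What the Lambda condition asks of `n₀` and `(q_n, n ≥ n₀)` for a given `δ`. The first four
clauses are the standing requirements on `(ψ_n)`, `(σ_n)`, `(β_n)`; the clause on integrability
says that the expectation of `Λ` exists. -/
def LambdaConditionAt {Ω : Type*} [MeasurableSpace Ω] (P : Measure Ω) (F : Ω → ℝ → ℝ → ℝ)
    (ψ : ℕ → ℝ → ℝ) (σ β : ℕ → ℝ) (δ : ℝ) (q : ℕ → ℝ) (n₀ : ℕ) : Prop :=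
  ∀ n, n₀ ≤ n →
    0 ≤ σ n ∧ 0 ≤ β n ∧ IsProbDensity (ψ n) ∧ Function.support (ψ n) ⊆ Iic (σ n) ∧
    0 < q n ∧ q n < 1 ∧
    ∀ v : ℝ, v < σ (n + 1) - δ * β n →
      Integrable (fun ω => Lam (ψ n) (F ω) v) P ∧
      0 ≤ (∫ ω, Lam (ψ n) (F ω) v ∂P)
        + (1 - q (n + 1)) / (1 - q n) ^ 2
            * (cdfOf (ψ (n + 1)) (v + δ * β n) - cdfOf (ψ n) v)
        + (q (n + 1) - q n) / (1 - q n) ^ 2 * (1 - cdfOf (ψ n) v)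

/-- The Lambda condition of the random function `F` with `(ψ_n)`, `(σ_n)` and `(β_n)`. -/
def LambdaCondition {Ω : Type*} [MeasurableSpace Ω] (P : Measure Ω) (F : Ω → ℝ → ℝ → ℝ)
    (ψ : ℕ → ℝ → ℝ) (σ β : ℕ → ℝ) : Prop :=
  ∀ δ : ℝ, 0 < δ → δ < 1 →
    ∃ (n₀ : ℕ) (q : ℕ → ℝ), 1 ≤ n₀ ∧ LambdaConditionAt P F ψ σ β δ q n₀

/-! ### The explicit sequences -/

/-- `c_* = (9/4) E[Γ_F^{(0,2)} + 2 Γ_F^{(1,1)}]`. -/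
noncomputable def cStar {Ω : Type*} [MeasurableSpace Ω] (P : Measure Ω)
    (F : Ω → ℝ → ℝ → ℝ) : ℝ :=
  9 / 4 * (∫⁻ ω, (Gam 0 2 (F ω) + 2 * Gam 1 1 (F ω)) ∂P).toReal

/-- `τ_n = (c n)^{1/3}`. -/
noncomputable def tau (c : ℝ) (n : ℕ) : ℝ := (c * n) ^ (1 / 3 : ℝ)

/-- `σ_n = τ_n - τ_n^ϱ`. -/
noncomputable def sigma (c ϱ : ℝ) (n : ℕ) : ℝ := tau c n - tau c n ^ ϱ

/-- `β_n = τ_{n+1} - τ_n`. -/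
noncomputable def beta (c : ℝ) (n : ℕ) : ℝ := tau c (n + 1) - tau c n

/-- `q_n = δ₁ (1 - n^{-κ})`. -/
noncomputable def qSeq (δ₁ κ : ℝ) (n : ℕ) : ℝ := δ₁ * (1 - (n : ℝ) ^ (-κ))

/-- `a_n = 1 / (2 (τ_n² σ_n - σ_n³ / 3))`. -/
noncomputable def aCoef (c ϱ : ℝ) (n : ℕ) : ℝ :=
  1 / (2 * (tau c n ^ 2 * sigma c ϱ n - sigma c ϱ n ^ 3 / 3))

/-- The relation that defines `τ̃_n = t`: `t > 1` and, with `s = t - t^ϱ̃`,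
`t² / (t² s - s³/3) = τ_n² / (τ_n² σ_n - σ_n³/3)`. -/
def IsTauTilde (c ϱ ϱ' : ℝ) (n : ℕ) (t : ℝ) : Prop :=
  1 < t ∧ t ^ 2 / (t ^ 2 * (t - t ^ ϱ') - (t - t ^ ϱ') ^ 3 / 3)
    = tau c n ^ 2 / (tau c n ^ 2 * sigma c ϱ n - sigma c ϱ n ^ 3 / 3)

open Classical in
/-- `τ̃_n`, the solution of its defining relation (it exists and is unique as soon as `τ_n > 1`,
see `existsUnique_isTauTilde`; otherwise the value is immaterial). -/
noncomputable def tauTilde (c ϱ ϱ' : ℝ) (n : ℕ) : ℝ :=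
  if h : ∃ t, IsTauTilde c ϱ ϱ' n t then h.choose else 0

/-- `σ̃_n = τ̃_n - τ̃_n^ϱ̃`. -/
noncomputable def sigmaTilde (c ϱ ϱ' : ℝ) (n : ℕ) : ℝ :=
  tauTilde c ϱ ϱ' n - tauTilde c ϱ ϱ' n ^ ϱ'

/-- `ã_n = a_n τ_n² / τ̃_n²`. -/
noncomputable def aTilde (c ϱ ϱ' : ℝ) (n : ℕ) : ℝ :=
  aCoef c ϱ n * tau c n ^ 2 / tauTilde c ϱ ϱ' n ^ 2

open Classical in
/-- `φ_n(v) = a_n (τ_n² - v²) 1_{|v| < σ_n}`. -/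
noncomputable def phi (c ϱ : ℝ) (n : ℕ) (v : ℝ) : ℝ :=
  if |v| < sigma c ϱ n then aCoef c ϱ n * (tau c n ^ 2 - v ^ 2) else 0

open Classical in
/-- `φ̃_n(v) = ã_n (τ̃_n² - v²) 1_{|v| < σ̃_n}`. -/
noncomputable def phiTilde (c ϱ ϱ' : ℝ) (n : ℕ) (v : ℝ) : ℝ :=
  if |v| < sigmaTilde c ϱ ϱ' n then aTilde c ϱ ϱ' n * (tauTilde c ϱ ϱ' n ^ 2 - v ^ 2) else 0

open Classical in
/-- `ψ_n(v) = φ_n(v) 1_{v ≥ 0} + φ̃_n(v) 1_{v < 0}`. -/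
noncomputable def psi (c ϱ ϱ' : ℝ) (n : ℕ) (v : ℝ) : ℝ :=
  if 0 ≤ v then phi c ϱ n v else phiTilde c ϱ ϱ' n v

/-- For `τ_n > 1` the relation defining `τ̃_n` has exactly one solution. -/
theorem existsUnique_isTauTilde {c ϱ ϱ' : ℝ} {n : ℕ} (hϱ1 : ϱ < 1)
    (hϱ'1 : ϱ' < 1) (hτ : 1 < tau c n) : ∃! t, IsTauTilde c ϱ ϱ' n t := by
  have hs : ∀ r : ℝ, r < 1 → ∀ t : ℝ, 1 < t → 0 < 1 - t ^ (r - 1) ∧ 1 - t ^ (r - 1) < 1 := by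
    intro r hr t ht
    have h1 := Real.rpow_lt_one_of_one_lt_of_neg ht (by linarith : r - 1 < 0)
    have h2 := Real.rpow_pos_of_pos (by linarith : 0 < t) (r - 1)
    constructor <;> linarith
  have hg : ∀ s : ℝ, 0 < s → s < 1 → 0 < s - s ^ 3 / 3 := by
    intro s h0 h1
    have : s ^ 3 < s := by nlinarith [mul_pos h0 h0, mul_pos h0 (sub_pos.2 h1)]
    linarith
  have key : ∀ r : ℝ, ∀ t : ℝ, 1 < t →
      t ^ 2 / (t ^ 2 * (t - t ^ r) - (t - t ^ r) ^ 3 / 3)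
        = 1 / (t * ((1 - t ^ (r - 1)) - (1 - t ^ (r - 1)) ^ 3 / 3)) := by
    intro r t ht
    have h0 : (0 : ℝ) < t := by linarith
    have e : t - t ^ r = t * (1 - t ^ (r - 1)) := by
      rw [Real.rpow_sub_one h0.ne']; field_simp
    rw [e]
    have e2 : t ^ 2 * (t * (1 - t ^ (r - 1))) - (t * (1 - t ^ (r - 1))) ^ 3 / 3
        = t ^ 2 * (t * ((1 - t ^ (r - 1)) - (1 - t ^ (r - 1)) ^ 3 / 3)) := by ring
    rw [e2, div_mul_eq_div_div, div_self (by positivity)]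
  set h : ℝ → ℝ := fun t => t * ((1 - t ^ (ϱ' - 1)) - (1 - t ^ (ϱ' - 1)) ^ 3 / 3) with hh
  have hpos : ∀ t, 1 < t → 0 < h t := fun t ht =>
    mul_pos (by linarith) (hg _ (hs ϱ' hϱ'1 t ht).1 (hs ϱ' hϱ'1 t ht).2)
  obtain ⟨y, hy, hyR⟩ : ∃ y : ℝ, 0 < y ∧
      tau c n ^ 2 / (tau c n ^ 2 * sigma c ϱ n - sigma c ϱ n ^ 3 / 3) = 1 / y :=
    ⟨_, mul_pos (by linarith) (hg _ (hs ϱ hϱ1 _ hτ).1 (hs ϱ hϱ1 _ hτ).2), key ϱ (tau c n) hτ⟩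
  have hiff : ∀ t, IsTauTilde c ϱ ϱ' n t ↔ 1 < t ∧ h t = y := by
    intro t
    unfold IsTauTilde
    rw [hyR]
    constructor
    · rintro ⟨h1, h2⟩
      rw [key ϱ' t h1] at h2
      rw [one_div, one_div] at h2
      exact ⟨h1, inv_injective h2⟩
    · rintro ⟨h1, h2⟩
      refine ⟨h1, ?_⟩
      rw [key ϱ' t h1]
      exact congrArg (fun z => 1 / z) h2
  have hmono : ∀ t u, 1 < t → t < u → h t < h u := by
    intro t u ht htu
    have hu : 1 < u := ht.trans htu
    have a1 := hs ϱ' hϱ'1 t ht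
    have a2 := hs ϱ' hϱ'1 u hu
    have a3 : u ^ (ϱ' - 1) < t ^ (ϱ' - 1) :=
      Real.rpow_lt_rpow_of_neg (by linarith) htu (by linarith)
    have a4 : (1 - t ^ (ϱ' - 1)) - (1 - t ^ (ϱ' - 1)) ^ 3 / 3
        < (1 - u ^ (ϱ' - 1)) - (1 - u ^ (ϱ' - 1)) ^ 3 / 3 := by
      generalize t ^ (ϱ' - 1) = p at *
      generalize u ^ (ϱ' - 1) = r at *
      have : 0 < p - r := by linarith
      have h3 : (1 - r) ^ 2 + (1 - r) * (1 - p) + (1 - p) ^ 2 < 3 := by nlinarith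
      nlinarith [mul_pos this (sub_pos.2 h3)]
    exact mul_lt_mul htu a4.le (hg _ a1.1 a1.2) (by linarith)
  have hex : ∃ t, 1 < t ∧ h t = y := by
    have hlim : Tendsto (fun t : ℝ => t ^ (ϱ' - 1)) atTop (𝓝 0) := by
      have := tendsto_rpow_neg_atTop (by linarith : 0 < 1 - ϱ')
      simpa using this
    obtain ⟨u, hu1, hu2, hu3⟩ := ((hlim.eventually (gt_mem_nhds (by norm_num : (0 : ℝ) < 1 / 2))).and
      ((eventually_gt_atTop (1 : ℝ)).and (eventually_ge_atTop (3 * y)))).exists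
    have hu4 := hs ϱ' hϱ'1 u hu2
    have hyu : y ≤ h u := by
      have : 1 / 3 ≤ (1 - u ^ (ϱ' - 1)) - (1 - u ^ (ϱ' - 1)) ^ 3 / 3 := by
        generalize u ^ (ϱ' - 1) = p at *
        have b1 : (1 / 2 : ℝ) < 1 - p := by linarith
        generalize 1 - p = s at *
        nlinarith [mul_pos hu4.1 (sub_pos.2 hu4.2), mul_pos (sub_pos.2 b1) (sub_pos.2 hu4.2),
          mul_pos hu4.1 (mul_pos (sub_pos.2 b1) (sub_pos.2 hu4.2))]
      calc y = 3 * y * (1 / 3) := by ring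
        _ ≤ u * _ := mul_le_mul hu3 this (by norm_num) (by linarith)
    have hc : ContinuousOn h (Icc 1 u) := by
      have : ContinuousOn (fun t : ℝ => t ^ (ϱ' - 1)) (Icc 1 u) :=
        ContinuousOn.rpow_const continuousOn_id (fun x hx => Or.inl (by
          exact (lt_of_lt_of_le one_pos hx.1).ne'))
      fun_prop
    have h1 : h 1 = 0 := by simp [hh]
    obtain ⟨t, ht, hty⟩ := intermediate_value_Icc hu2.le hc (show y ∈ Icc (h 1) (h u) from
      ⟨by rw [h1]; exact hy.le, hyu⟩)
    refine ⟨t, lt_of_le_of_ne ht.1 ?_, hty⟩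
    rintro rfl
    rw [h1] at hty
    linarith
  obtain ⟨t, ht, hty⟩ := hex
  refine ⟨t, (hiff t).2 ⟨ht, hty⟩, ?_⟩
  intro u hu
  obtain ⟨hu1, huy⟩ := (hiff u).1 hu
  rcases lt_trichotomy u t with hl | hl | hl
  · have := hmono u t hu1 hl; linarith
  · exact hl
  · have := hmono t u ht hl; linarith

end HomSys

/-!
The random variable enters the Lambda condition only through its sign `ε` and the function `T`, of
which `exists_isModel` chooses jointly measurable versions. For an arbitrary density `ψ`,
`Λ_{ψ,F}(v) = ε ∫∫ ψ(v - ε t) ψ(v - ε z) dz dt` over the region `0 < z < T_F(t)`. Expanding the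
product to first order in `(t, z)` and taking expectations, the term `ε ψ(v)²` disappears because
`E[ε Γ^{(0,1)}] = 0`, and what remains is the drift `-ψ ψ'(v) · 2c_*/9`
(`IsModel.integral_lam_ge`). For `ψ_n` with `y = v/τ_n` the drift is asymptotically
`(c_*/4) y (1 - y²) τ_n^{-3}`, and the increment of the distribution functions at the fixed point
`v` is the opposite of it: this is what the constant in `τ_n` achieves (`tendsto_drift`). The
shift by `δ β_n` and the weight `(1 - q_{n+1})/(1 - q_n)² → 1/(1 - δ₁)` then leave a gain which is
at least a constant times `(1 - y²) τ_n^{-3}`, and it remains to see that all the errors are of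
smaller order. Since `η` may be replaced by `min η 1`, take `η ≤ 1`. There are four ranges of `v`.

* For `0 ≤ v < σ_n` the factor `U = 1 - y²` may be as small as `τ_n^{ϱ-1}`, so the error must be
  measured against `U`. Concavity of the parabola makes this possible: truncating at the right edge
  helps when `ε = -1`, and the remainder is of order `U² ((t + z)/(τ_n U))^{1+η}`
  (`IsProfile.kernel_right`), hence `U τ_n^{-3} (τ_n U)^{-η}` in expectation.
* For `σ_n ≤ v < σ_{n+1} - δ β_n` only `ε = 1` contributes to `Λ`. Nontriviality of `F` and
  `E[ε Γ^{(0,1)}] = 0` give a contribution of order `τ_n^{2ϱ-4}`, while the missing mass is of order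
  `τ_n^{ϱ-4}` (`eventually_nonneg_edge`).
* For `-σ̃_n < v < 0` the jump of `ψ_n` at the left edge causes an error of order `τ_n^{2ϱ̃-4}`, and
  the Taylor remainder one of order `τ_n^{-3-η}`. Both are absorbed by the term with
  `q_{n+1} - q_n`, which is of order `τ_n^{-3-3κ}` (`eventually_error_le`).
* For `v ≤ -σ̃_n` the same errors appear without any drift.
-/

namespace HomSys

/-! ### The class `ℋ` and the functional `T` -/

theorem IsHPlus.two_le {F : ℝ → ℝ → ℝ} (h : IsHPlus F) : 2 ≤ F 1 2 :=
  (le_max_right _ _).trans (h.max_le 1 2 one_pos two_pos)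

theorem IsHMinus.le_one {F : ℝ → ℝ → ℝ} (h : IsHMinus F) : F 1 2 ≤ 1 :=
  (h.le_min 1 2 one_pos two_pos).trans (min_le_left _ _)

/-- The value at `(1, 2)` tells the two halves of `ℋ` apart, so that `ε` is measurable. -/
theorem IsH.isHPlus_iff {F : ℝ → ℝ → ℝ} (h : IsH F) : IsHPlus F ↔ 2 ≤ F 1 2 := by
  refine ⟨fun h => h.two_le, fun h2 => ?_⟩
  rcases h with h | h
  · exact h
  · have := h.le_one
    linarith

theorem IsHPlus.not_isHMinus {F : ℝ → ℝ → ℝ} (h : IsHPlus F) : ¬ IsHMinus F := fun h' => by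
  have := h.two_le
  have := h'.le_one
  linarith

theorem IsH.eps_eq {F : ℝ → ℝ → ℝ} (h : IsH F) : eps F = if 2 ≤ F 1 2 then 1 else -1 := by
  unfold eps
  by_cases hp : IsHPlus F
  · simp [hp, hp.not_isHMinus, hp.two_le]
  · have hm : IsHMinus F := h.resolve_left hp
    have : ¬ 2 ≤ F 1 2 := fun h2 => hp (h.isHPlus_iff.2 h2)
    simp [hp, hm, this]

theorem IsHMinus.isHPlus_invF {F : ℝ → ℝ → ℝ} (h : IsHMinus F) : IsHPlus (invF F) := by
  have hp : ∀ x y : ℝ, 0 < x → 0 < y → 0 < F (1 / x) (1 / y) := fun x y hx hy =>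
    h.pos _ _ (by positivity) (by positivity)
  have hinv : Tendsto (fun x : ℝ => 1 / x) (𝓝[>] 0) atTop := by
    simpa using tendsto_inv_nhdsGT_zero (𝕜 := ℝ)
  refine ⟨⟨?_, ?_, ?_, ?_, ?_⟩, ?_, ?_, ?_⟩
  · intro x y hx hy
    exact one_div_pos.2 (hp x y hx hy)
  · have h1 : ContinuousOn (fun p : ℝ × ℝ => ((1 / p.1, 1 / p.2) : ℝ × ℝ)) (Ioi 0 ×ˢ Ioi 0) := by
      refine ContinuousOn.prodMk ?_ ?_
      · exact continuousOn_const.div continuousOn_fst (fun p hp => (ne_of_gt hp.1))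
      · exact continuousOn_const.div continuousOn_snd (fun p hp => (ne_of_gt hp.2))
    have h2 := h.cont.comp h1 (fun p hp =>
      ⟨mem_Ioi.2 (one_div_pos.2 hp.1), mem_Ioi.2 (one_div_pos.2 hp.2)⟩)
    exact continuousOn_const.div h2 (fun p hq => (hp p.1 p.2 hq.1 hq.2).ne')
  · intro x x' y hx hxx hy
    exact one_div_le_one_div_of_le (hp _ _ (hx.trans_le hxx) hy)
      (h.mono_left _ _ _ (one_div_pos.2 (hx.trans_le hxx)) (one_div_le_one_div_of_le hx hxx)
        (one_div_pos.2 hy))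
  · intro x y y' hx hy hyy
    exact one_div_le_one_div_of_le (hp _ _ hx (hy.trans_le hyy))
      (h.mono_right _ _ _ (one_div_pos.2 hx) (one_div_pos.2 (hy.trans_le hyy))
        (one_div_le_one_div_of_le hy hyy))
  · intro a x y ha hx hy
    have := h.hom (1 / a) (1 / x) (1 / y) (by positivity) (by positivity) (by positivity)
    simp only [invF]
    rw [← one_div_mul_one_div, ← one_div_mul_one_div, this]
    field_simp
  · intro x y hx hy
    have h1 := h.le_min (1 / x) (1 / y) (by positivity) (by positivity)
    have h2 := hp x y hx hy
    simp only [invF]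
    refine max_le ?_ ?_
    · rw [le_one_div hx h2]; exact h1.trans (min_le_left _ _)
    · rw [le_one_div hy h2]; exact h1.trans (min_le_right _ _)
  · intro y hy
    have := ((h.lim_left (1 / y) (by positivity)).comp hinv).inv₀ (by positivity)
    simpa [invF, Function.comp_def] using this
  · intro y hy
    have := ((h.lim_right (1 / y) (by positivity)).comp hinv).inv₀ (by positivity)
    simpa [invF, Function.comp_def] using this

theorem IsH.isHPlus_starF {F : ℝ → ℝ → ℝ} (h : IsH F) : IsHPlus (starF F) := by
  unfold starF
  split_ifs with hp
  · exact hp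
  · exact (h.resolve_left hp).isHPlus_invF

/-- The supremum defining `T` is attained. -/
theorem IsH.le_T_iff {F : ℝ → ℝ → ℝ} (h : IsH F) {t : ℝ} (ht : 0 < t) (z : ℝ) :
    z ≤ T F t ↔ 1 ≤ starF F (Real.exp (-t)) (Real.exp (-z)) := by
  have hG := h.isHPlus_starF
  set G := starF F with hGdef
  set s : Set ℝ := {z : ℝ | 1 ≤ G (Real.exp (-t)) (Real.exp (-z))} with hs
  have hT : T F t = sSup s := rfl
  have hanti : ∀ z z', z ≤ z' → z' ∈ s → z ∈ s := by
    intro z z' hz hz'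
    exact le_trans hz' (hG.mono_right _ _ _ (Real.exp_pos _) (Real.exp_pos _)
      (Real.exp_le_exp.2 (by linarith)))
  have h0 : (0 : ℝ) ∈ s := by
    have := hG.max_le (Real.exp (-t)) (Real.exp (-0)) (Real.exp_pos _) (Real.exp_pos _)
    exact le_trans (by simp) ((le_max_right _ _).trans this)
  have hcont : Continuous (fun z : ℝ => G (Real.exp (-t)) (Real.exp (-z))) := by
    have : Continuous (fun z : ℝ => ((Real.exp (-t), Real.exp (-z)) : ℝ × ℝ)) := by fun_prop
    exact hG.cont.comp_continuous this (fun z => ⟨Real.exp_pos _, Real.exp_pos _⟩)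
  have hclosed : IsClosed s := isClosed_le continuous_const hcont
  have hbdd : BddAbove s := by
    have h1 : Tendsto (fun z : ℝ => Real.exp (-z)) atTop (𝓝[>] 0) :=
      tendsto_nhdsWithin_iff.2 ⟨Real.tendsto_exp_neg_atTop_nhds_zero,
        Eventually.of_forall fun z => Real.exp_pos _⟩
    have h2 := (hG.lim_right (Real.exp (-t)) (Real.exp_pos _)).comp h1
    have h3 : Real.exp (-t) < 1 := by simpa using ht
    obtain ⟨b, hb⟩ := (h2.eventually (gt_mem_nhds h3)).exists
    refine ⟨b, fun z hz => ?_⟩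
    by_contra! hlt
    have := hanti b z hlt.le hz
    simp only [Function.comp_apply] at hb
    exact absurd this (not_le.2 hb)
  constructor
  · intro hz
    exact hanti z _ hz (hclosed.csSup_mem ⟨0, h0⟩ hbdd)
  · intro hz
    exact le_csSup hbdd hz

theorem IsH.T_nonneg {F : ℝ → ℝ → ℝ} (h : IsH F) {t : ℝ} (ht : 0 < t) : 0 ≤ T F t := by
  rw [h.le_T_iff ht]
  refine le_trans ?_ ((le_max_right _ _).trans
    (h.isHPlus_starF.max_le _ _ (Real.exp_pos _) (Real.exp_pos _)))
  simp

theorem IsH.T_antitone {F : ℝ → ℝ → ℝ} (h : IsH F) {t t' : ℝ} (ht : 0 < t) (htt : t ≤ t') :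
    T F t' ≤ T F t := by
  rw [h.le_T_iff ht]
  refine ((h.le_T_iff (ht.trans_le htt) _).1 le_rfl).trans ?_
  exact h.isHPlus_starF.mono_left _ _ _ (Real.exp_pos _) (Real.exp_le_exp.2 (by linarith))
    (Real.exp_pos _)

/-- If `T` vanishes then `F` is `max` or `min`. -/
theorem IsH.isTrivial {F : ℝ → ℝ → ℝ} (h : IsH F) (hT : ∀ t, 0 < t → T F t ≤ 0) :
    IsTrivial F := by
  have hG := h.isHPlus_starF
  have key : ∀ x y, 0 < x → 0 < y → starF F x y = max x y := by
    intro x y hx hy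
    refine le_antisymm ?_ (hG.max_le x y hx hy)
    by_contra! hlt
    obtain ⟨hlx, hly⟩ := max_lt_iff.1 hlt
    set k := starF F x y with hk
    have hk0 : 0 < k := hx.trans hlx
    -- rescaling by `k` moves the point into the open unit square, where `T = 0` forces `F^* < 1`
    have hx1 : Real.exp (-(-Real.log (x / k))) = x / k := by
      rw [neg_neg, Real.exp_log (by positivity)]
    have hy1 : Real.exp (-(-Real.log (y / k))) = y / k := by
      rw [neg_neg, Real.exp_log (by positivity)]
    have ht : 0 < -Real.log (x / k) := by
      have := Real.log_neg (by positivity : 0 < x / k) ((div_lt_one hk0).2 hlx)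
      linarith
    have hz : 0 < -Real.log (y / k) := by
      have := Real.log_neg (by positivity : 0 < y / k) ((div_lt_one hk0).2 hly)
      linarith
    have h1 : -Real.log (y / k) ≤ T F (-Real.log (x / k)) := by
      rw [h.le_T_iff ht, hx1, hy1]
      have := hG.hom (1 / k) x y (by positivity) hx hy
      rw [one_div_mul_eq_div, one_div_mul_eq_div, ← hk, one_div_mul_cancel hk0.ne'] at this
      exact this.ge
    linarith [hT _ ht]
  by_cases hp : IsHPlus F
  · left
    simpa [starF, hp] using key
  · right
    intro x y hx hy
    have hF := h.resolve_left hp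
    have h1 := key (1 / x) (1 / y) (by positivity) (by positivity)
    simp only [starF, hp, if_false, invF, one_div_one_div] at h1
    have h2 := hF.pos x y hx hy
    rcases le_total x y with hxy | hxy
    · rw [min_eq_left hxy]
      rw [max_eq_left (one_div_le_one_div_of_le hx hxy)] at h1
      rw [one_div, one_div] at h1
      exact inv_injective h1
    · rw [min_eq_right hxy]
      rw [max_eq_right (one_div_le_one_div_of_le hy hxy)] at h1
      rw [one_div, one_div] at h1
      exact inv_injective h1

theorem isHPlus_max : IsHPlus (fun x y => max x y) where
  pos x y hx _ := lt_max_of_lt_left hx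
  cont := by fun_prop
  mono_left x x' y _ h _ := max_le_max_right y h
  mono_right x y y' _ _ h := max_le_max_left x h
  hom a x y ha _ _ := (mul_max_of_nonneg x y ha.le).symm
  max_le x y _ _ := le_rfl
  lim_left y hy := by
    have : Tendsto (fun x : ℝ => max x y) (𝓝 0) (𝓝 (max 0 y)) :=
      (continuous_id.max continuous_const).tendsto 0
    rw [max_eq_right hy.le] at this
    exact this.mono_left nhdsWithin_le_nhds
  lim_right y hy := by
    have : Tendsto (fun x : ℝ => max y x) (𝓝 0) (𝓝 (max y 0)) :=
      (continuous_const.max continuous_id).tendsto 0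
    rw [max_eq_left hy.le] at this
    exact this.mono_left nhdsWithin_le_nhds

/-! ### Measurability of the sign and of `T` -/

section Measurability

variable {Ω : Type*} [MeasurableSpace Ω]

theorem measurable_T {F : Ω → ℝ → ℝ → ℝ}
    (hm : ∀ x y : ℝ, 0 < x → 0 < y → Measurable (fun ω => F ω x y)) (hF : ∀ ω, IsH (F ω)) :
    Measurable (fun p : Ω × ℝ => if 0 < p.2 then T (F p.1) p.2 else 0) := by
  have hstar : ∀ x y : ℝ, 0 < x → 0 < y → Measurable (fun ω => starF (F ω) x y) := by
    intro x y hx hy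
    have : (fun ω => starF (F ω) x y) =
        fun ω => if 2 ≤ F ω 1 2 then F ω x y else 1 / F ω (1 / x) (1 / y) := by
      funext ω
      unfold starF
      simp only [(hF ω).isHPlus_iff]
      split_ifs <;> rfl
    rw [this]
    refine Measurable.ite (measurableSet_le measurable_const (hm 1 2 one_pos two_pos))
      (hm x y hx hy) ?_
    exact (hm _ _ (by positivity) (by positivity)).const_div 1
  refine measurable_of_Ici fun z => ?_
  have hset : (fun p : Ω × ℝ => if 0 < p.2 then T (F p.1) p.2 else 0) ⁻¹' Ici z =
      ({p | 0 < p.2} ∩ ⋂ q : ℚ, ({p | p.2 ≤ (q : ℝ)} ∪ {p | (q : ℝ) ≤ 0} ∪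
        {p | 1 ≤ starF (F p.1) (Real.exp (-q)) (Real.exp (-z))})) ∪
      {p : Ω × ℝ | ¬ 0 < p.2 ∧ z ≤ 0} := by
    ext ⟨ω, t⟩
    simp only [mem_preimage, mem_Ici, mem_union, mem_inter_iff, mem_ofPred_eq, mem_iInter]
    by_cases ht : 0 < t
    · simp only [ht, if_true, true_and, not_true, false_and, or_false]
      rw [(hF ω).le_T_iff ht]
      have hG := (hF ω).isHPlus_starF
      constructor
      · intro h1 q
        by_cases hq : (t ≤ q ∨ (q : ℝ) ≤ 0)
        · exact Or.inl hq
        · push Not at hq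
          exact Or.inr (h1.trans (hG.mono_left _ _ _ (Real.exp_pos _)
            (Real.exp_le_exp.2 (by linarith)) (Real.exp_pos _)))
      · intro hq
        by_contra! hlt
        have hcont : Continuous (fun r : ℝ => starF (F ω) (Real.exp (-r)) (Real.exp (-z))) := by
          have : Continuous (fun r : ℝ => ((Real.exp (-r), Real.exp (-z)) : ℝ × ℝ)) := by fun_prop
          exact hG.cont.comp_continuous this (fun z => ⟨Real.exp_pos _, Real.exp_pos _⟩)
        have hev := (hcont.tendsto t).eventually (gt_mem_nhds hlt)
        obtain ⟨l, hl, hl2⟩ := exists_Ioc_subset_of_mem_nhds hev ⟨0, ht⟩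
        obtain ⟨q, hq1, hq2⟩ := exists_rat_btwn (max_lt hl ht)
        have h3 := hl2 ⟨(le_max_left _ _).trans_lt hq1, hq2.le⟩
        have h4 := (le_max_right _ _).trans_lt hq1
        rcases hq q with (h | h) | h
        · linarith
        · linarith
        · exact absurd h (not_le.2 h3)
    · simp [ht]
  rw [hset]
  refine MeasurableSet.union (MeasurableSet.inter (measurableSet_lt measurable_const measurable_snd)
    (MeasurableSet.iInter fun q => ?_)) ?_
  · refine MeasurableSet.union (MeasurableSet.union
      (measurableSet_le measurable_snd measurable_const) (MeasurableSet.const _)) ?_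
    exact measurableSet_le measurable_const
      ((hstar _ _ (Real.exp_pos _) (Real.exp_pos _)).comp measurable_fst)
  · by_cases hz : z ≤ 0
    · simp only [hz, and_true]
      exact (measurableSet_lt measurable_const measurable_snd).compl
    · simp [hz]

/-- A random element of `ℋ` has, up to a null set, a measurable sign and a jointly measurable
`(ω, t) ↦ T_F(t)`. -/
theorem exists_measurable_model (P : Measure Ω) {F : Ω → ℝ → ℝ → ℝ}
    (hm : ∀ x y : ℝ, 0 < x → 0 < y → Measurable (fun ω => F ω x y))
    (hF : ∀ᵐ ω ∂P, IsH (F ω)) :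
    ∃ (e : Ω → ℝ) (S : Ω × ℝ → ℝ), Measurable e ∧ Measurable S ∧ (∀ ω, e ω = 1 ∨ e ω = -1) ∧
      (∀ p, 0 ≤ S p) ∧
      ∀ᵐ ω ∂P, eps (F ω) = e ω ∧ ∀ t, 0 < t → T (F ω) t = S (ω, t) := by
  classical
  obtain ⟨s, hs1, hs2, hs3⟩ : ∃ s : Set Ω,
      (∀ ω ∈ s, IsH (F ω)) ∧ MeasurableSet s ∧ ∀ᵐ ω ∂P, ω ∈ s := by
    refine ⟨(toMeasurable P {ω | ¬ IsH (F ω)})ᶜ, fun ω hω => ?_,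
      (measurableSet_toMeasurable _ _).compl, ?_⟩
    · by_contra hn
      exact hω (subset_toMeasurable P _ hn)
    · exact compl_mem_ae_iff.2 ((measure_toMeasurable _).trans hF)
  set F' : Ω → ℝ → ℝ → ℝ := fun ω => if ω ∈ s then F ω else fun x y => max x y with hF'
  have hH : ∀ ω, IsH (F' ω) := by
    intro ω
    by_cases h : ω ∈ s
    · simp only [hF', h, if_true]; exact hs1 ω h
    · simp only [hF', h, if_false]; exact Or.inl isHPlus_max
  have hm' : ∀ x y : ℝ, 0 < x → 0 < y → Measurable (fun ω => F' ω x y) := by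
    intro x y hx hy
    have : (fun ω => F' ω x y) = fun ω => if ω ∈ s then F ω x y else max x y := by
      funext ω
      simp only [hF']
      split_ifs <;> rfl
    rw [this]
    exact Measurable.ite hs2 (hm x y hx hy) measurable_const
  refine ⟨fun ω => if 2 ≤ F' ω 1 2 then 1 else -1,
    fun p : Ω × ℝ => if 0 < p.2 then T (F' p.1) p.2 else 0, ?_, measurable_T hm' hH, ?_, ?_, ?_⟩
  · exact Measurable.ite (measurableSet_le measurable_const (hm' 1 2 one_pos two_pos))
      measurable_const measurable_const
  · intro ω
    dsimp only
    split_ifs <;> simp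
  · intro p
    dsimp only
    split_ifs with h
    · exact (hH p.1).T_nonneg h
    · exact le_rfl
  · filter_upwards [hs3] with ω hω
    have : F ω = F' ω := by simp [hF', hω]
    rw [this]
    exact ⟨(hH ω).eps_eq, fun t ht => by simp [ht]⟩

end Measurability

/-! ### Moments -/

section Moments

variable {Ω : Type*}

/-- The part of the region below `S` with sign `+1` and both coordinates between `1/k` and `k`,
integrated over the second coordinate. -/
noncomputable def coreWidth (e : Ω → ℝ) (S : Ω × ℝ → ℝ) (k : ℕ) (p : Ω × ℝ) : ℝ :=
  if e p.1 = 1 ∧ 1 / (k : ℝ) ≤ p.2 ∧ p.2 ≤ k then max (min (S p) k - 1 / k) 0 else 0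

theorem coreWidth_nonneg (e : Ω → ℝ) (S : Ω × ℝ → ℝ) (k : ℕ) (p : Ω × ℝ) :
    0 ≤ coreWidth e S k p := by
  unfold coreWidth
  split_ifs
  · exact le_max_right _ _
  · exact le_rfl

theorem coreWidth_le {e : Ω → ℝ} {S : Ω × ℝ → ℝ} (hS : ∀ p, 0 ≤ S p) (k : ℕ) (p : Ω × ℝ) :
    coreWidth e S k p ≤ S p := by
  unfold coreWidth
  split_ifs
  · refine max_le ?_ (hS p)
    have : (0 : ℝ) ≤ 1 / k := by positivity
    linarith [min_le_left (S p) (k : ℝ)]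
  · exact hS p

variable [MeasurableSpace Ω]

/-- The product of `P` and Lebesgue measure on `(0, ∞)`: expectations of integrals `∫_0^∞ dt` are
integrals against it. -/
noncomputable def prodIoi (P : Measure Ω) : Measure (Ω × ℝ) := P.prod (volume.restrict (Ioi 0))

theorem ae_snd_pos (P : Measure Ω) [SFinite P] : ∀ᵐ p ∂(prodIoi P), 0 < p.2 := by
  have h : ∀ᵐ t ∂(volume.restrict (Ioi (0 : ℝ))), 0 < t := ae_restrict_mem measurableSet_Ioi
  exact Measure.quasiMeasurePreserving_snd.ae h

theorem le_one_add_rpow {s b : ℝ} (hs : 0 ≤ s) (hb : 1 ≤ b) : s ≤ 1 + s ^ b := by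
  rcases le_total s 1 with h | h
  · linarith [Real.rpow_nonneg hs b]
  · have := Real.rpow_le_rpow_of_exponent_le h hb
    rw [Real.rpow_one] at this
    linarith

theorem rpow_mul_le_dominating {t s η a : ℝ} (ht : 0 < t) (hs : 0 ≤ s) (hη : 0 < η) (ha : 0 ≤ a)
    (ha1 : a ≤ 1 + η) :
    t ^ a * s ≤ (Ioc (0 : ℝ) 1).indicator 1 t + s ^ (2 + η) + t ^ (1 + η) * s := by
  have h1 := Real.rpow_nonneg hs (2 + η)
  have h2 := mul_nonneg (Real.rpow_nonneg ht.le (1 + η)) hs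
  rcases le_or_gt t 1 with h | h
  · rw [indicator_of_mem (show t ∈ Ioc (0 : ℝ) 1 from ⟨ht, h⟩)]
    have h3 := le_one_add_rpow hs (by linarith : 1 ≤ 2 + η)
    have h4 : t ^ a * s ≤ 1 * s := by
      gcongr
      exact Real.rpow_le_one ht.le h ha
    simp only [Pi.one_apply]
    linarith
  · have h3 : 0 ≤ (Ioc (0 : ℝ) 1).indicator (1 : ℝ → ℝ) t :=
      indicator_nonneg (fun _ _ => zero_le_one) t
    have h4 : t ^ a * s ≤ t ^ (1 + η) * s := by
      gcongr
      exact h.le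
    linarith

theorem rpow_le_dominating {t s η b : ℝ} (ht : 0 < t) (hs : 0 ≤ s) (hη : 0 < η) (hb : 1 ≤ b)
    (hb1 : b ≤ 2 + η) :
    s ^ b ≤ (Ioc (0 : ℝ) 1).indicator 1 t + s ^ (2 + η) + t ^ (1 + η) * s := by
  rcases le_or_gt s 1 with h | h
  · have h1 : s ^ b ≤ s := by
      rcases hs.eq_or_lt with h0 | h0
      · rw [← h0, Real.zero_rpow (by linarith)]
      · simpa using Real.rpow_le_rpow_of_exponent_ge h0 h hb
    have h2 := rpow_mul_le_dominating ht hs hη le_rfl (by linarith)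
    rw [Real.rpow_zero, one_mul] at h2
    exact h1.trans h2
  · have h1 := Real.rpow_le_rpow_of_exponent_le h.le hb1
    have h2 := mul_nonneg (Real.rpow_nonneg ht.le (1 + η)) hs
    have h3 : 0 ≤ (Ioc (0 : ℝ) 1).indicator (1 : ℝ → ℝ) t :=
      indicator_nonneg (fun _ _ => zero_le_one) t
    linarith

theorem lintegral_Gam (P : Measure Ω) [IsProbabilityMeasure P] {F : Ω → ℝ → ℝ → ℝ}
    {S : Ω × ℝ → ℝ} (hS : Measurable S) (hT : ∀ᵐ ω ∂P, ∀ t, 0 < t → T (F ω) t = S (ω, t))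
    (a b : ℝ) :
    AEMeasurable (fun ω => Gam a b (F ω)) P ∧
    ∫⁻ ω, Gam a b (F ω) ∂P = ∫⁻ p, ENNReal.ofReal (p.2 ^ a * S p ^ b) ∂(prodIoi P) := by
  have hm : Measurable (fun p : Ω × ℝ => ENNReal.ofReal (p.2 ^ a * S p ^ b)) := by fun_prop
  have h1 : (fun ω => Gam a b (F ω)) =ᵐ[P]
      fun ω => ∫⁻ t in Ioi (0 : ℝ), ENNReal.ofReal (t ^ a * S (ω, t) ^ b) := by
    filter_upwards [hT] with ω hω
    unfold Gam
    refine setLIntegral_congr_fun measurableSet_Ioi fun t ht => ?_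
    simp only [hω t ht]
  refine ⟨⟨_, hm.lintegral_prod_right', h1⟩, ?_⟩
  rw [lintegral_congr_ae h1, prodIoi, lintegral_prod _ hm.aemeasurable]

/-- All that the expectation of `Λ` retains of the law of `F`: a measurable sign `e`, a jointly
measurable version `S` of `(ω, t) ↦ T_F(t)`, their moments, and the nontriviality of the positive
part. -/
structure IsModel (P : Measure Ω) (F : Ω → ℝ → ℝ → ℝ) (η c : ℝ) (e : Ω → ℝ)
    (S : Ω × ℝ → ℝ) : Prop where
  meas_sign : Measurable e
  meas : Measurable S
  sign : ∀ ω, e ω = 1 ∨ e ω = -1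
  nonneg : ∀ p, 0 ≤ S p
  ae_eq : ∀ᵐ ω ∂P, eps (F ω) = e ω ∧ ∀ t, 0 < t → T (F ω) t = S (ω, t)
  int_one : Integrable S (prodIoi P)
  int_two : Integrable (fun p => p.2 * S p + S p ^ 2 / 2) (prodIoi P)
  int_eta : Integrable (fun p => p.2 ^ (1 + η) * S p + S p ^ (2 + η)) (prodIoi P)
  integral_sign : ∫ p, e p.1 * S p ∂(prodIoi P) = 0
  integral_two : ∫ p, (p.2 * S p + S p ^ 2 / 2) ∂(prodIoi P) = 2 / 9 * c
  pos : 0 < c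
  core_pos : ∃ k : ℕ, 0 < k ∧ 0 < ∫ p, coreWidth e S k p ∂(prodIoi P)

theorem measurable_coreWidth {e : Ω → ℝ} {S : Ω × ℝ → ℝ} (he : Measurable e) (hS : Measurable S)
    (k : ℕ) : Measurable (coreWidth e S k) := by
  unfold coreWidth
  refine Measurable.ite ?_ (by fun_prop) measurable_const
  refine MeasurableSet.inter ?_ (MeasurableSet.inter ?_ ?_)
  · exact measurableSet_eq_fun (he.comp measurable_fst) measurable_const
  · exact measurableSet_le measurable_const measurable_snd
  · exact measurableSet_le measurable_snd measurable_const

/-- The two moment assumptions bound all moments in between, as `t^a s^b` with `a = 0` or `b = 1` is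
at most `1_{t ≤ 1} + s^{2+η} + t^{1+η} s`. Nontriviality makes `E[Γ^{(0,1)}]` positive, and
`E[ε Γ^{(0,1)}] = 0` assigns half of it to each sign. -/
theorem exists_isModel (P : Measure Ω) [IsProbabilityMeasure P]
    (F : Ω → ℝ → ℝ → ℝ)
    (hF_meas : ∀ x y : ℝ, 0 < x → 0 < y → Measurable (fun ω => F ω x y))
    (hF_H : ∀ᵐ ω ∂P, IsH (F ω))
    (hF_nontrivial : 0 < P {ω | ¬ IsTrivial (F ω)})
    (hF_Gam : ∫ ω, (Gam 0 1 (F ω)).toReal * eps (F ω) ∂P = 0)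
    {η : ℝ} (hη : 0 < η)
    (hF_mom₁ : ∫⁻ ω, Gam (1 + η) 1 (F ω) ∂P < ∞)
    (hF_mom₂ : ∫⁻ ω, Gam 0 (2 + η) (F ω) ∂P < ∞)
    {η' : ℝ} (hη' : 0 < η') (hηη : η' ≤ η) :
    ∃ (e : Ω → ℝ) (S : Ω × ℝ → ℝ), IsModel P F η' (cStar P F) e S := by
  obtain ⟨e, S, he, hS, he1, hS0, hae⟩ := exists_measurable_model P hF_meas hF_H
  have hT : ∀ᵐ ω ∂P, ∀ t, 0 < t → T (F ω) t = S (ω, t) := hae.mono fun ω h => h.2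
  have hpos := ae_snd_pos P
  have hfin : ∀ a b : ℝ, ∫⁻ ω, Gam a b (F ω) ∂P < ∞ →
      Integrable (fun p : Ω × ℝ => p.2 ^ a * S p ^ b) (prodIoi P) := by
    intro a b h
    rw [(lintegral_Gam P hS hT a b).2] at h
    refine (lintegral_ofReal_ne_top_iff_integrable (by fun_prop) ?_).1 h.ne
    filter_upwards [hpos] with p hp
    exact mul_nonneg (Real.rpow_nonneg hp.le _) (Real.rpow_nonneg (hS0 p) _)
  have hD : Integrable (fun p : Ω × ℝ =>
      (Ioc (0 : ℝ) 1).indicator 1 p.2 + S p ^ (2 + η) + p.2 ^ (1 + η) * S p) (prodIoi P) := by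
    refine Integrable.add (Integrable.add ?_ ?_) ?_
    · have h1 : Integrable ((Ioc (0 : ℝ) 1).indicator (1 : ℝ → ℝ)) (volume.restrict (Ioi 0)) := by
        refine Integrable.restrict ?_
        rw [integrable_indicator_iff measurableSet_Ioc]
        exact integrableOn_const (by simp)
      exact h1.comp_snd P
    · simpa using hfin _ _ hF_mom₂
    · simpa using hfin _ _ hF_mom₁
  have hint1 : ∀ a, 0 ≤ a → a ≤ 1 + η →
      Integrable (fun p : Ω × ℝ => p.2 ^ a * S p) (prodIoi P) := by
    intro a ha ha1
    refine hD.mono' (by fun_prop) ?_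
    filter_upwards [hpos] with p hp
    rw [Real.norm_of_nonneg (mul_nonneg (Real.rpow_nonneg hp.le _) (hS0 p))]
    exact rpow_mul_le_dominating hp (hS0 p) hη ha ha1
  have hint2 : ∀ b, 1 ≤ b → b ≤ 2 + η → Integrable (fun p : Ω × ℝ => S p ^ b) (prodIoi P) := by
    intro b hb hb1
    refine hD.mono' (hS.pow_const b).aestronglyMeasurable ?_
    filter_upwards [hpos] with p hp
    rw [Real.norm_of_nonneg (Real.rpow_nonneg (hS0 p) _)]
    exact rpow_le_dominating hp (hS0 p) hη hb hb1
  have iS : Integrable S (prodIoi P) := by simpa using hint1 0 le_rfl (by linarith)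
  have itS : Integrable (fun p : Ω × ℝ => p.2 * S p) (prodIoi P) := by
    simpa using hint1 1 zero_le_one (by linarith)
  have iS2 : Integrable (fun p : Ω × ℝ => S p ^ 2) (prodIoi P) := by
    have := hint2 2 one_le_two (by linarith)
    simpa using this
  have i2 : Integrable (fun p => p.2 * S p + S p ^ 2 / 2) (prodIoi P) := itS.add (iS2.div_const 2)
  have ieS : Integrable (fun p : Ω × ℝ => e p.1 * S p) (prodIoi P) := by
    refine iS.mono' (by fun_prop) (Eventually.of_forall fun p => ?_)
    rw [norm_mul, Real.norm_of_nonneg (hS0 p)]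
    rcases he1 p.1 with h | h <;> simp [h]
  have hSpos : 0 < ∫ p, S p ∂(prodIoi P) := by
    refine lt_of_le_of_ne (integral_nonneg hS0) fun h0 => ?_
    have h1 := (integral_eq_zero_iff_of_nonneg hS0 iS).1 h0.symm
    have h2 := Measure.ae_ae_of_ae_prod h1
    refine hF_nontrivial.ne' ?_
    change ∀ᵐ ω ∂P, IsTrivial (F ω)
    filter_upwards [h2, hT, hF_H] with ω hω hTω hH
    refine hH.isTrivial fun t ht => ?_
    have h3 : ∀ᵐ s ∂(volume : Measure ℝ), s ∈ Ioi (0 : ℝ) → S (ω, s) = 0 :=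
      (ae_restrict_iff' measurableSet_Ioi).1 hω
    have h4 : (volume : Measure ℝ) (Ioo 0 t) ≠ 0 := by simp [ht]
    obtain ⟨s, hs, hs2⟩ := (frequently_ae_mem_iff.2 h4).and_eventually h3 |>.exists
    calc T (F ω) t ≤ T (F ω) s := hH.T_antitone hs.1 hs.2.le
      _ = 0 := by rw [hTω s hs.1, hs2 hs.1]
      _ ≤ 0 := le_rfl
  have hsign : ∫ p, e p.1 * S p ∂(prodIoi P) = 0 := by
    rw [← hF_Gam, prodIoi, integral_prod _ ieS]
    refine integral_congr_ae ?_
    filter_upwards [hae] with ω hω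
    rw [integral_const_mul, hω.1, mul_comm]
    congr 1
    rw [integral_eq_lintegral_of_nonneg_ae (Eventually.of_forall fun t => hS0 _)
      (hS.comp measurable_prodMk_left).aestronglyMeasurable]
    congr 1
    unfold Gam
    refine setLIntegral_congr_fun measurableSet_Ioi fun t ht => ?_
    simp only [hω.2 t ht, Real.rpow_zero, one_mul, Real.rpow_one]
  have htwo : ∫ p, (p.2 * S p + S p ^ 2 / 2) ∂(prodIoi P) = 2 / 9 * cStar P F := by
    have hL : ∀ a b : ℝ, Integrable (fun p : Ω × ℝ => p.2 ^ a * S p ^ b) (prodIoi P) →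
        ∫⁻ ω, Gam a b (F ω) ∂P = ENNReal.ofReal (∫ p, p.2 ^ a * S p ^ b ∂(prodIoi P)) := by
      intro a b h
      rw [(lintegral_Gam P hS hT a b).2, ofReal_integral_eq_lintegral_ofReal h]
      filter_upwards [hpos] with p hp
      exact mul_nonneg (Real.rpow_nonneg hp.le _) (Real.rpow_nonneg (hS0 p) _)
    have hn1 : 0 ≤ ∫ p, p.2 * S p ∂(prodIoi P) := by
      refine integral_nonneg_of_ae ?_
      filter_upwards [hpos] with p hp
      exact mul_nonneg hp.le (hS0 p)
    have hn2 : 0 ≤ ∫ p, S p ^ 2 ∂(prodIoi P) := integral_nonneg fun p => sq_nonneg _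
    have e1 := hL 0 2 (by simpa using iS2)
    have e2 := hL 1 1 (by simpa using itS)
    simp only [Real.rpow_zero, one_mul, Real.rpow_one, Real.rpow_two] at e1 e2
    unfold cStar
    rw [lintegral_add_left' (lintegral_Gam P hS hT 0 2).1,
      lintegral_const_mul'' _ (lintegral_Gam P hS hT 1 1).1, e1, e2,
      ENNReal.toReal_add (by simp) (by simp [ENNReal.mul_eq_top]), ENNReal.toReal_mul,
      ENNReal.toReal_ofReal hn2, ENNReal.toReal_ofReal hn1, integral_add itS (iS2.div_const 2),
      integral_div]
    simp only [ENNReal.toReal_ofNat]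
    ring
  have hc : 0 < cStar P F := by
    have h0 : 0 ≤ᵐ[prodIoi P] fun p => p.2 * S p + S p ^ 2 / 2 := by
      filter_upwards [hpos] with p hp
      exact add_nonneg (mul_nonneg hp.le (hS0 p)) (by positivity)
    have h1 : 0 ≤ ∫ p, (p.2 * S p + S p ^ 2 / 2) ∂(prodIoi P) := integral_nonneg_of_ae h0
    have h2 : ∫ p, (p.2 * S p + S p ^ 2 / 2) ∂(prodIoi P) ≠ 0 := by
      intro h
      have h3 := (integral_eq_zero_iff_of_nonneg_ae h0 i2).1 h
      refine hSpos.ne' (integral_eq_zero_of_ae ?_)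
      filter_upwards [h3, hpos] with p h3 hp
      have h4 : p.2 * S p + S p ^ 2 / 2 = 0 := h3
      have h5 := mul_nonneg hp.le (hS0 p)
      have h6 : S p ^ 2 = 0 := le_antisymm (by linarith) (sq_nonneg _)
      simpa using h6
    have h3 := lt_of_le_of_ne h1 h2.symm
    rw [htwo] at h3
    linarith
  refine ⟨e, S, he, hS, he1, hS0, hae, iS, i2, ?_, hsign, htwo, hc, ?_⟩
  · exact (hint1 _ (by linarith) (by linarith)).add (hint2 _ (by linarith) (by linarith))
  · by_contra! hk
    have icore : ∀ k, Integrable (coreWidth e S k) (prodIoi P) := fun k => by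
      refine iS.mono' (measurable_coreWidth he hS k).aestronglyMeasurable
        (Eventually.of_forall fun p => ?_)
      rw [Real.norm_of_nonneg (coreWidth_nonneg e S k p)]
      exact coreWidth_le hS0 k p
    have hzero : ∀ᵐ p ∂(prodIoi P), ∀ k : ℕ, 0 < k → coreWidth e S k p = 0 := by
      rw [ae_all_iff]
      intro k
      by_cases h : 0 < k
      · have := (integral_eq_zero_iff_of_nonneg (coreWidth_nonneg e S k) (icore k)).1
          (le_antisymm (hk k h) (integral_nonneg (coreWidth_nonneg e S k)))
        filter_upwards [this] with p hp _
        exact hp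
      · exact Eventually.of_forall fun p h' => absurd h' h
    have h1 : ∫ p, (S p + e p.1 * S p) ∂(prodIoi P) = 0 := by
      refine integral_eq_zero_of_ae ?_
      filter_upwards [hzero, hpos] with p hz hp
      rcases he1 p.1 with h | h
      · rcases (hS0 p).eq_or_lt with hs | hs
        · simp [← hs]
        · exfalso
          obtain ⟨k, hk⟩ := exists_nat_gt (max (max (1 / p.2) p.2) (max (1 / S p) 2))
          have k1 : 1 / p.2 < k := lt_of_le_of_lt ((le_max_left _ _).trans (le_max_left _ _)) hk
          have k2 : p.2 < k := lt_of_le_of_lt ((le_max_right _ _).trans (le_max_left _ _)) hk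
          have k3 : 1 / S p < k := lt_of_le_of_lt ((le_max_left _ _).trans (le_max_right _ _)) hk
          have k4 : 2 < (k : ℝ) := lt_of_le_of_lt ((le_max_right _ _).trans (le_max_right _ _)) hk
          have k0 : 0 < (k : ℝ) := by linarith
          have h5 := hz k (by exact_mod_cast k0)
          have h6 : 1 / (k : ℝ) < S p := (one_div_lt hs k0).1 k3
          have h7 : 1 / (k : ℝ) < k := by
            rw [div_lt_iff₀ k0]; nlinarith
          rw [coreWidth, if_pos ⟨h, ((one_div_lt hp k0).1 k1).le, k2.le⟩] at h5
          have h8 : 0 < min (S p) (k : ℝ) - 1 / k := sub_pos.2 (lt_min h6 h7)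
          rw [max_eq_left h8.le] at h5
          exact h8.ne' h5
      · simp [h]
    rw [integral_add iS ieS, hsign] at h1
    linarith

end Moments

/-! ### Distribution functions and the expectation of `Λ` -/

theorem IsProbDensity.cdfOf_sub {ψ : ℝ → ℝ} (h : IsProbDensity ψ) (a b : ℝ) :
    cdfOf ψ b - cdfOf ψ a = ∫ x in a..b, ψ x :=
  intervalIntegral.integral_Iic_sub_Iic h.integrable.integrableOn h.integrable.integrableOn

theorem IsProbDensity.cdfOf_mono {ψ : ℝ → ℝ} (h : IsProbDensity ψ) : Monotone (cdfOf ψ) := by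
  intro a b hab
  have := h.cdfOf_sub a b
  have h2 : 0 ≤ ∫ x in a..b, ψ x :=
    intervalIntegral.integral_nonneg hab fun x _ => h.nonneg x
  linarith

theorem IsProbDensity.cdfOf_nonneg {ψ : ℝ → ℝ} (h : IsProbDensity ψ) (v : ℝ) : 0 ≤ cdfOf ψ v :=
  integral_nonneg h.nonneg

theorem IsProbDensity.cdfOf_le_one {ψ : ℝ → ℝ} (h : IsProbDensity ψ) (v : ℝ) :
    cdfOf ψ v ≤ 1 := by
  rw [← h.integral_eq_one]
  exact setIntegral_le_integral h.integrable (Eventually.of_forall h.nonneg)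

theorem IsProbDensity.cdfOf_eq_one {ψ : ℝ → ℝ} (h : IsProbDensity ψ) {v : ℝ}
    (hv : ∀ x, v < x → ψ x = 0) : cdfOf ψ v = 1 := by
  rw [← h.integral_eq_one]
  exact setIntegral_eq_integral_of_forall_compl_eq_zero fun x hx => hv x (not_le.1 hx)

theorem cdfOf_eq_zero {ψ : ℝ → ℝ} {v : ℝ} (hv : ∀ x, x ≤ v → ψ x = 0) : cdfOf ψ v = 0 :=
  setIntegral_eq_zero_of_forall_eq_zero hv

theorem IsProbDensity.integrable_reflect {ψ : ℝ → ℝ} (h : IsProbDensity ψ) {e : ℝ}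
    (he : e = 1 ∨ e = -1) (v : ℝ) : Integrable (fun z => ψ (v - e * z)) := by
  rcases he with rfl | rfl
  · simpa using h.integrable.comp_sub_left v
  · simpa [add_comm] using h.integrable.comp_add_right v

theorem IsProbDensity.cdfOf_sub_eq_integral {ψ : ℝ → ℝ} (h : IsProbDensity ψ) {e : ℝ}
    (he : e = 1 ∨ e = -1) (v s : ℝ) :
    cdfOf ψ v - cdfOf ψ (v - e * s) = e * ∫ z in (0 : ℝ)..s, ψ (v - e * z) := by
  have he0 : e ≠ 0 := by rcases he with rfl | rfl <;> norm_num
  rw [h.cdfOf_sub, intervalIntegral.integral_comp_sub_mul ψ he0 v, smul_eq_mul, mul_zero, sub_zero,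
    ← mul_assoc, mul_inv_cancel₀ he0, one_mul]

theorem IsProbDensity.abs_cdfOf_sub_le {ψ : ℝ → ℝ} (h : IsProbDensity ψ) {K : ℝ}
    (hK : ∀ x, ψ x ≤ K) {e : ℝ} (he : e = 1 ∨ e = -1) (v : ℝ) {s : ℝ} (hs : 0 ≤ s) :
    |cdfOf ψ v - cdfOf ψ (v - e * s)| ≤ K * s := by
  have h1 : |e| = 1 := by rcases he with rfl | rfl <;> simp
  have h2 := intervalIntegral.norm_integral_le_of_norm_le_const (a := 0) (b := s) (C := K)
    (f := fun z => ψ (v - e * z)) (fun z _ => by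
      rw [Real.norm_of_nonneg (h.nonneg _)]; exact hK _)
  rw [h.cdfOf_sub_eq_integral he, abs_mul, h1, one_mul]
  simpa [abs_of_nonneg hs] using h2

theorem add_rpow_le_four_mul {t s η : ℝ} (ht : 0 ≤ t) (hs : 0 ≤ s) (hη : 0 ≤ η) (hη1 : η ≤ 1) :
    (t + s) ^ (1 + η) ≤ 4 * (t ^ (1 + η) + s ^ (1 + η)) := by
  have h1 : t + s ≤ 2 * max t s := by
    linarith [le_max_left t s, le_max_right t s]
  have hm : 0 ≤ max t s := ht.trans (le_max_left _ _)
  have h2 : (2 : ℝ) ^ (1 + η) ≤ 4 := by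
    calc (2 : ℝ) ^ (1 + η) ≤ 2 ^ (2 : ℝ) :=
          Real.rpow_le_rpow_of_exponent_le one_le_two (by linarith)
      _ = 4 := by norm_num
  have h3 : max t s ^ (1 + η) ≤ t ^ (1 + η) + s ^ (1 + η) := by
    have := Real.rpow_nonneg ht (1 + η)
    have := Real.rpow_nonneg hs (1 + η)
    rcases max_choice t s with h | h <;> rw [h] <;> linarith
  calc (t + s) ^ (1 + η) ≤ (2 * max t s) ^ (1 + η) :=
        Real.rpow_le_rpow (by positivity) h1 (by linarith)
    _ = 2 ^ (1 + η) * max t s ^ (1 + η) := Real.mul_rpow (by norm_num) hm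
    _ ≤ 4 * (t ^ (1 + η) + s ^ (1 + η)) :=
        mul_le_mul h2 h3 (Real.rpow_nonneg hm _) (by norm_num)

/-- A lower bound for `e ψ(v - et) ψ(v - ez)` up to order `1 + η` in `t + z`, integrated over
`0 < z < s`. -/
theorem IsProbDensity.integral_kernel_ge {ψ : ℝ → ℝ} (h : IsProbDensity ψ) {e : ℝ}
    (he : e = 1 ∨ e = -1) {v t s η C₀ C₁ C₂ C₃ : ℝ} (hη : 0 < η) (hη1 : η ≤ 1) (ht : 0 < t)
    (hs : 0 ≤ s) (hC₂ : 0 ≤ C₂)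
    (hker : ∀ z, 0 < z → e * C₀ + C₁ * (t + z) - C₂ * (t + z) ^ (1 + η) - C₃
      ≤ e * (ψ (v - e * t) * ψ (v - e * z))) :
    C₀ * (e * s) + C₁ * (t * s + s ^ 2 / 2) - 4 * C₂ * (t ^ (1 + η) * s + s ^ (2 + η)) - C₃ * s
      ≤ ψ (v - e * t) * (cdfOf ψ v - cdfOf ψ (v - e * s)) := by
  set W := (t + s) ^ (1 + η) with hW
  have h1 : ∫ z in (0 : ℝ)..s, (e * C₀ + C₁ * (t + z) - C₂ * W - C₃) ≤
      ∫ z in (0 : ℝ)..s, e * (ψ (v - e * t) * ψ (v - e * z)) := by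
    refine intervalIntegral.integral_mono_on_of_le_Ioo hs
      (Continuous.intervalIntegrable (by fun_prop) _ _) ?_ ?_
    · exact (((h.integrable_reflect he v).const_mul _).const_mul _).intervalIntegrable
    · intro z hz
      have h2 : (t + z) ^ (1 + η) ≤ W :=
        Real.rpow_le_rpow (by linarith [hz.1]) (by linarith [hz.2]) (by linarith)
      have h3 := mul_le_mul_of_nonneg_left h2 hC₂
      linarith [hker z hz.1]
  have h2 : ∫ z in (0 : ℝ)..s, (e * C₀ + C₁ * (t + z) - C₂ * W - C₃) =
      s * (e * C₀ + C₁ * t - C₂ * W - C₃) + C₁ * (s ^ 2 / 2) := by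
    have : (fun z : ℝ => e * C₀ + C₁ * (t + z) - C₂ * W - C₃) =
        fun z => (e * C₀ + C₁ * t - C₂ * W - C₃) + C₁ * z := by
      funext z; ring
    rw [this, intervalIntegral.integral_add (by simp)
      (Continuous.intervalIntegrable (by fun_prop) _ _), intervalIntegral.integral_const_mul,
      integral_id]
    simp only [intervalIntegral.integral_const, smul_eq_mul]
    ring
  have h3 : ∫ z in (0 : ℝ)..s, e * (ψ (v - e * t) * ψ (v - e * z)) =
      ψ (v - e * t) * (cdfOf ψ v - cdfOf ψ (v - e * s)) := by
    rw [h.cdfOf_sub_eq_integral he, intervalIntegral.integral_const_mul,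
      intervalIntegral.integral_const_mul]
    ring
  rw [h2, h3] at h1
  refine le_trans ?_ h1
  have h4 : s * W ≤ 4 * (t ^ (1 + η) * s + s ^ (2 + η)) := by
    have h5 := mul_le_mul_of_nonneg_left (add_rpow_le_four_mul ht.le hs hη.le hη1) hs
    have h6 : s * s ^ (1 + η) = s ^ (2 + η) := by
      rw [← Real.rpow_one_add' hs (by linarith)]
      congr 1
      ring
    rw [← h6]
    linarith
  have h7 := mul_le_mul_of_nonneg_left h4 hC₂
  linarith

section Expectation

variable {Ω : Type*} [MeasurableSpace Ω] {P : Measure Ω}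
  {F : Ω → ℝ → ℝ → ℝ} {η c : ℝ} {e : Ω → ℝ} {S : Ω × ℝ → ℝ} {ψ : ℝ → ℝ}

theorem IsModel.integrable_kernel (hM : IsModel P F η c e S) (hψ : IsProbDensity ψ) {K : ℝ}
    (hK : ∀ x, ψ x ≤ K) (v : ℝ) :
    Integrable (fun p => ψ (v - e p.1 * p.2) * (cdfOf ψ v - cdfOf ψ (v - e p.1 * S p)))
      (prodIoi P) := by
  have he := hM.meas_sign
  have hS := hM.meas
  have hK0 : 0 ≤ K := (hψ.nonneg 0).trans (hK 0)
  refine (hM.int_one.const_mul (K * K)).mono' ?_ (Eventually.of_forall fun p => ?_)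
  · refine Measurable.aestronglyMeasurable ?_
    refine Measurable.mul (hψ.meas.comp (by fun_prop)) (Measurable.sub measurable_const ?_)
    exact hψ.cdfOf_mono.measurable.comp (by fun_prop)
  · have h1 := hψ.abs_cdfOf_sub_le hK (hM.sign p.1) v (hM.nonneg p)
    rw [norm_mul, Real.norm_of_nonneg (hψ.nonneg _), Real.norm_eq_abs, mul_assoc]
    exact mul_le_mul (hK _) h1 (abs_nonneg _) hK0

theorem IsModel.lam_ae_eq (hM : IsModel P F η c e S) (v : ℝ) :
    (fun ω => Lam ψ (F ω) v) =ᵐ[P] fun ω => ∫ t in Ioi (0 : ℝ),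
      ψ (v - e ω * t) * (cdfOf ψ v - cdfOf ψ (v - e ω * S (ω, t))) := by
  filter_upwards [hM.ae_eq] with ω hω
  unfold Lam
  refine setIntegral_congr_fun measurableSet_Ioi fun t ht => ?_
  simp only [hω.1, hω.2 t ht]

theorem IsModel.integrable_lam (hM : IsModel P F η c e S) (hψ : IsProbDensity ψ) {K : ℝ}
    (hK : ∀ x, ψ x ≤ K) (v : ℝ) : Integrable (fun ω => Lam ψ (F ω) v) P :=
  (hM.integrable_kernel hψ hK v).integral_prod_left.congr (hM.lam_ae_eq v).symm

variable [IsProbabilityMeasure P]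

theorem IsModel.integral_lam (hM : IsModel P F η c e S) (hψ : IsProbDensity ψ) {K : ℝ}
    (hK : ∀ x, ψ x ≤ K) (v : ℝ) : ∫ ω, Lam ψ (F ω) v ∂P =
      ∫ p, ψ (v - e p.1 * p.2) * (cdfOf ψ v - cdfOf ψ (v - e p.1 * S p)) ∂(prodIoi P) := by
  rw [integral_congr_ae (hM.lam_ae_eq v)]
  exact (integral_prod _ (hM.integrable_kernel hψ hK v)).symm

/-- The expectation of `Λ` inherits a pointwise lower bound of its kernel; the zeroth order term
cancels because `E[ε Γ^{(0,1)}] = 0`. -/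
theorem IsModel.integral_lam_ge (hM : IsModel P F η c e S) (hψ : IsProbDensity ψ) {K : ℝ}
    (hK : ∀ x, ψ x ≤ K) (hη : 0 < η) (hη1 : η ≤ 1) {v C₀ C₁ C₂ C₃ : ℝ} (hC₂ : 0 ≤ C₂)
    (hker : ∀ e t z : ℝ, (e = 1 ∨ e = -1) → 0 < t → 0 < z →
      e * C₀ + C₁ * (t + z) - C₂ * (t + z) ^ (1 + η) - C₃
        ≤ e * (ψ (v - e * t) * ψ (v - e * z))) :
    C₁ * (2 / 9 * c) - 4 * C₂ * (∫ p, (p.2 ^ (1 + η) * S p + S p ^ (2 + η)) ∂(prodIoi P))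
      - C₃ * (∫ p, S p ∂(prodIoi P)) ≤ ∫ ω, Lam ψ (F ω) v ∂P := by
  rw [hM.integral_lam hψ hK]
  have ie : Integrable (fun p => e p.1 * S p) (prodIoi P) := by
    refine hM.int_one.mono' ((hM.meas_sign.comp measurable_fst).mul hM.meas).aestronglyMeasurable
      (Eventually.of_forall fun p => ?_)
    rw [norm_mul, Real.norm_of_nonneg (hM.nonneg p)]
    rcases hM.sign p.1 with h | h <;> simp [h]
  have i0 := ie.const_mul C₀
  have i1 := hM.int_two.const_mul C₁
  have i2 := hM.int_eta.const_mul (4 * C₂)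
  have i3 := hM.int_one.const_mul C₃
  have i01 : Integrable (fun p => C₀ * (e p.1 * S p) + C₁ * (p.2 * S p + S p ^ 2 / 2))
      (prodIoi P) := i0.add i1
  have i012 : Integrable (fun p => C₀ * (e p.1 * S p) + C₁ * (p.2 * S p + S p ^ 2 / 2)
      - 4 * C₂ * (p.2 ^ (1 + η) * S p + S p ^ (2 + η))) (prodIoi P) := i01.sub i2
  have hle : ∫ p, (C₀ * (e p.1 * S p) + C₁ * (p.2 * S p + S p ^ 2 / 2)
      - 4 * C₂ * (p.2 ^ (1 + η) * S p + S p ^ (2 + η)) - C₃ * S p) ∂(prodIoi P) ≤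
      ∫ p, ψ (v - e p.1 * p.2) * (cdfOf ψ v - cdfOf ψ (v - e p.1 * S p)) ∂(prodIoi P) := by
    refine integral_mono_ae (i012.sub i3) (hM.integrable_kernel hψ hK v) ?_
    filter_upwards [ae_snd_pos P] with p hp
    exact hψ.integral_kernel_ge (hM.sign p.1) hη hη1 hp (hM.nonneg p) hC₂
      fun z hz => hker _ _ _ (hM.sign p.1) hp hz
  rw [integral_sub i012 i3, integral_sub i01 i2, integral_add i0 i1,
    integral_const_mul, integral_const_mul, integral_const_mul, integral_const_mul,
    hM.integral_sign, hM.integral_two] at hle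
  linarith

end Expectation

/-! ### Two-sided parabolic profiles -/

open Classical in
/-- The parabola `A (1 - v²/τ²)` cut off at `σ` on the positive half line, glued at `0` to the
parabola `A (1 - v²/θ²)` cut off at `-ς` on the negative one. -/
noncomputable def profile (A τ σ θ ς v : ℝ) : ℝ :=
  if 0 ≤ v then (if v < σ then A * (1 - v ^ 2 / τ ^ 2) else 0)
  else (if -ς < v then A * (1 - v ^ 2 / θ ^ 2) else 0)

/-- The parameters of a profile of mass `1/2` on either side of the origin. -/
structure IsProfile (A τ σ θ ς : ℝ) : Prop where
  A_pos : 0 < A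
  σ_pos : 0 < σ
  σ_lt : σ < τ
  ς_pos : 0 < ς
  ς_lt : ς < θ
  mass_right : A * (σ - σ ^ 3 / (3 * τ ^ 2)) = 1 / 2
  mass_left : A * (ς - ς ^ 3 / (3 * θ ^ 2)) = 1 / 2

namespace IsProfile

variable {A τ σ θ ς : ℝ}

theorem τ_pos (h : IsProfile A τ σ θ ς) : 0 < τ := h.σ_pos.trans h.σ_lt

theorem θ_pos (h : IsProfile A τ σ θ ς) : 0 < θ := h.ς_pos.trans h.ς_lt

theorem eq_right {v : ℝ} (h0 : 0 ≤ v) (h1 : v < σ) :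
    profile A τ σ θ ς v = A * (1 - v ^ 2 / τ ^ 2) := by
  simp [profile, h0, h1]

theorem eq_left {v : ℝ} (h0 : v < 0) (h1 : -ς < v) :
    profile A τ σ θ ς v = A * (1 - v ^ 2 / θ ^ 2) := by
  simp [profile, h0.not_ge, h1]

theorem eq_zero_right (h : IsProfile A τ σ θ ς) {v : ℝ} (h1 : σ ≤ v) :
    profile A τ σ θ ς v = 0 := by
  simp [profile, h.σ_pos.le.trans h1, h1.not_gt]

theorem eq_zero_left (h : IsProfile A τ σ θ ς) {v : ℝ} (h1 : v ≤ -ς) :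
    profile A τ σ θ ς v = 0 := by
  have : v < 0 := by linarith [h.ς_pos]
  simp [profile, this.not_ge, h1.not_gt]

theorem nonneg (h : IsProfile A τ σ θ ς) (v : ℝ) : 0 ≤ profile A τ σ θ ς v := by
  have hA := h.A_pos
  unfold profile
  split_ifs with h1 h2 h2
  · refine mul_nonneg hA.le (sub_nonneg.2 ((div_le_one (pow_pos h.τ_pos 2)).2 ?_))
    exact pow_le_pow_left₀ h1 (h2.le.trans h.σ_lt.le) 2
  · exact le_rfl
  · refine mul_nonneg hA.le (sub_nonneg.2 ((div_le_one (pow_pos h.θ_pos 2)).2 ?_))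
    nlinarith [h.ς_lt, h.θ_pos]
  · exact le_rfl

theorem le (h : IsProfile A τ σ θ ς) (v : ℝ) : profile A τ σ θ ς v ≤ A := by
  have hA := h.A_pos
  have h3 : 0 ≤ v ^ 2 / τ ^ 2 := by positivity
  have h4 : 0 ≤ v ^ 2 / θ ^ 2 := by positivity
  unfold profile
  split_ifs with h1 h2 h2
  · nlinarith
  · exact hA.le
  · nlinarith
  · exact hA.le

theorem measurable_profile : Measurable (profile A τ σ θ ς) := by
  unfold profile
  refine Measurable.ite measurableSet_Ici (Measurable.ite measurableSet_Iio ?_ measurable_const)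
    (Measurable.ite measurableSet_Ioi ?_ measurable_const) <;> fun_prop

theorem support_subset (h : IsProfile A τ σ θ ς) :
    Function.support (profile A τ σ θ ς) ⊆ Ioc (-ς) σ := by
  intro v hv
  constructor
  · by_contra! h1
    exact hv (h.eq_zero_left h1)
  · by_contra! h1
    exact hv (h.eq_zero_right h1.le)

theorem integrable (h : IsProfile A τ σ θ ς) : Integrable (profile A τ σ θ ς) := by
  rw [← integrableOn_iff_integrable_of_support_subset h.support_subset]
  refine Measure.integrableOn_of_bounded (M := A) (by simp)
    measurable_profile.aestronglyMeasurable (Eventually.of_forall fun v => ?_)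
  rw [Real.norm_of_nonneg (h.nonneg v)]
  exact h.le v

theorem integral_parabola (A s a b : ℝ) :
    ∫ x in a..b, A * (1 - x ^ 2 / s ^ 2) =
      A * (b - b ^ 3 / (3 * s ^ 2)) - A * (a - a ^ 3 / (3 * s ^ 2)) := by
  simp only [intervalIntegral.integral_const_mul]
  rw [intervalIntegral.integral_sub (by simp) (Continuous.intervalIntegrable (by fun_prop) _ _)]
  simp only [intervalIntegral.integral_const, intervalIntegral.integral_div, integral_pow,
    smul_eq_mul]
  norm_num
  ring

theorem integral_right {b : ℝ} (hb : 0 ≤ b) (hb1 : b ≤ σ) :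
    ∫ x in (0 : ℝ)..b, profile A τ σ θ ς x = A * (b - b ^ 3 / (3 * τ ^ 2)) := by
  have : ∫ x in (0 : ℝ)..b, profile A τ σ θ ς x = ∫ x in (0 : ℝ)..b, A * (1 - x ^ 2 / τ ^ 2) := by
    refine intervalIntegral.integral_congr_Ioo_of_le hb fun x hx => ?_
    exact eq_right hx.1.le (hx.2.trans_le hb1)
  rw [this, integral_parabola]
  ring

theorem integral_left {a : ℝ} (ha : a ≤ 0) (ha1 : -ς ≤ a) :
    ∫ x in a..(0 : ℝ), profile A τ σ θ ς x = -(A * (a - a ^ 3 / (3 * θ ^ 2))) := by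
  have : ∫ x in a..(0 : ℝ), profile A τ σ θ ς x = ∫ x in a..(0 : ℝ), A * (1 - x ^ 2 / θ ^ 2) := by
    refine intervalIntegral.integral_congr_Ioo_of_le ha fun x hx => ?_
    exact eq_left hx.2 (ha1.trans_lt hx.1)
  rw [this, integral_parabola]
  ring

theorem isProbDensity (h : IsProfile A τ σ θ ς) : IsProbDensity (profile A τ σ θ ς) where
  meas := measurable_profile
  nonneg := h.nonneg
  integrable := h.integrable
  integral_eq_one := by
    rw [← intervalIntegral.integral_eq_integral_of_support_subset h.support_subset,
      ← intervalIntegral.integral_add_adjacent_intervals (b := 0)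
        h.integrable.intervalIntegrable h.integrable.intervalIntegrable,
      integral_right h.σ_pos.le le_rfl, integral_left (by linarith [h.ς_pos]) le_rfl,
      h.mass_right]
    have := h.mass_left
    linear_combination this

theorem cdf_eq_one (h : IsProfile A τ σ θ ς) {v : ℝ} (hv : σ ≤ v) :
    cdfOf (profile A τ σ θ ς) v = 1 :=
  h.isProbDensity.cdfOf_eq_one fun _ hx => h.eq_zero_right (hv.trans hx.le)

theorem cdf_eq_zero (h : IsProfile A τ σ θ ς) {v : ℝ} (hv : v ≤ -ς) :
    cdfOf (profile A τ σ θ ς) v = 0 :=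
  cdfOf_eq_zero fun _ hx => h.eq_zero_left (hx.trans hv)

theorem cdf_zero (h : IsProfile A τ σ θ ς) : cdfOf (profile A τ σ θ ς) 0 = 1 / 2 := by
  have h1 := h.isProbDensity.cdfOf_sub 0 σ
  rw [h.cdf_eq_one le_rfl, integral_right h.σ_pos.le le_rfl, h.mass_right] at h1
  linarith

theorem cdf_right (h : IsProfile A τ σ θ ς) {v : ℝ} (h0 : 0 ≤ v) (h1 : v ≤ σ) :
    cdfOf (profile A τ σ θ ς) v = 1 / 2 + A * (v - v ^ 3 / (3 * τ ^ 2)) := by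
  have h2 := h.isProbDensity.cdfOf_sub 0 v
  rw [h.cdf_zero, integral_right h0 h1] at h2
  linarith

theorem cdf_left (h : IsProfile A τ σ θ ς) {v : ℝ} (h0 : v ≤ 0) (h1 : -ς ≤ v) :
    cdfOf (profile A τ σ θ ς) v = 1 / 2 + A * (v - v ^ 3 / (3 * θ ^ 2)) := by
  have h2 := h.isProbDensity.cdfOf_sub v 0
  rw [h.cdf_zero, integral_left h0 h1] at h2
  linarith

/-- A pointwise lower bound of a profile on an interval bounds the increment of its distribution
function. -/
theorem cdf_sub_ge (h : IsProfile A τ σ θ ς) {a b m : ℝ} (hab : a ≤ b)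
    (hm : ∀ x, a < x → x < b → m ≤ profile A τ σ θ ς x) :
    m * (b - a) ≤ cdfOf (profile A τ σ θ ς) b - cdfOf (profile A τ σ θ ς) a := by
  rw [h.isProbDensity.cdfOf_sub]
  have := intervalIntegral.integral_mono_on_of_le_Ioo hab
    (f := fun _ => m) (g := profile A τ σ θ ς) (μ := volume) (by simp)
    h.integrable.intervalIntegrable (fun x hx => hm x hx.1 hx.2)
  simpa [mul_comm] using this

theorem cdf_sub_le (h : IsProfile A τ σ θ ς) {a b m : ℝ} (hab : a ≤ b)
    (hm : ∀ x, a < x → x < b → profile A τ σ θ ς x ≤ m) :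
    cdfOf (profile A τ σ θ ς) b - cdfOf (profile A τ σ θ ς) a ≤ m * (b - a) := by
  rw [h.isProbDensity.cdfOf_sub]
  have := intervalIntegral.integral_mono_on_of_le_Ioo hab
    (g := fun _ => m) (f := profile A τ σ θ ς) (μ := volume)
    h.integrable.intervalIntegrable (by simp) (fun x hx => hm x hx.1 hx.2)
  simpa [mul_comm] using this

end IsProfile

/-! ### Expansion of the kernel of `Λ` for a profile -/

theorem sq_le_rpow_one_add {w η : ℝ} (hw : 0 < w) (hη1 : η ≤ 1) (h : w ≤ 1) :
    w ^ 2 ≤ w ^ (1 + η) := by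
  rw [← Real.rpow_two]
  exact Real.rpow_le_rpow_of_exponent_ge hw h (by linarith)

theorem le_rpow_one_add {w η : ℝ} (hη : 0 ≤ η) (h : 1 ≤ w) : w ≤ w ^ (1 + η) := by
  simpa using Real.rpow_le_rpow_of_exponent_le h (by linarith : 1 ≤ 1 + η)

/-- Moving outwards from a point of the right half: each factor is at most the positive part of the
tangent line. With `r = (X + Z)/U`, the error term `R` stands for `r^{1+η}`, which dominates the
smaller of `r` and `r²`. In the lemmas below `W` plays the same part for `X + Z` itself. -/
theorem mul_le_of_le_tangent {y U X Z a b R : ℝ} (hy0 : 0 ≤ y) (hy1 : y ≤ 1) (hU : 0 < U)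
    (hX : 0 < X) (hZ : 0 < Z) (ha0 : 0 ≤ a) (hb0 : 0 ≤ b) (ha : a ≤ max (U - 2 * y * X) 0)
    (hb : b ≤ max (U - 2 * y * Z) 0)
    (hR1 : X + Z ≤ U → (X + Z) ^ 2 ≤ U ^ 2 * R) (hR2 : U ≤ X + Z → U * (X + Z) ≤ U ^ 2 * R) :
    a * b ≤ U ^ 2 - 2 * y * U * (X + Z) + 4 * (U ^ 2 * R) := by
  have hw : 0 < X + Z := by linarith
  have hyX : y * X ≤ X := by nlinarith
  have hyZ : y * Z ≤ Z := by nlinarith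
  have hyX0 : 0 ≤ y * X := by positivity
  have hyZ0 : 0 ≤ y * Z := by positivity
  have hR0 : 0 ≤ U ^ 2 * R := by
    rcases le_total (X + Z) U with h | h
    · exact (sq_nonneg _).trans (hR1 h)
    · exact (by positivity : 0 ≤ U * (X + Z)).trans (hR2 h)
  -- if one factor vanishes, the linear expression must be compensated by the error
  have hzero : a * b ≤ 0 → a * b ≤ U ^ 2 - 2 * y * U * (X + Z) + 4 * (U ^ 2 * R) := by
    intro h0
    have h2 : y * (X + Z) ≤ X + Z := by nlinarith
    rcases le_total (X + Z) U with h | h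
    · have := hR1 h
      nlinarith [sq_nonneg (U - (X + Z))]
    · have := hR2 h
      nlinarith
  rcases le_total (U - 2 * y * X) 0 with h1 | h1
  · rw [max_eq_right h1] at ha
    exact hzero (mul_nonpos_of_nonpos_of_nonneg ha hb0)
  rcases le_total (U - 2 * y * Z) 0 with h2 | h2
  · rw [max_eq_right h2] at hb
    exact hzero (mul_nonpos_of_nonneg_of_nonpos ha0 hb)
  rw [max_eq_left h1] at ha
  rw [max_eq_left h2] at hb
  have h3 : a * b ≤ (U - 2 * y * X) * (U - 2 * y * Z) := mul_le_mul ha hb hb0 h1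
  have h4 : (2 * y * X) * (2 * y * Z) ≤ 4 * (U ^ 2 * R) := by
    rcases le_total (X + Z) U with h | h
    · have := hR1 h
      have h5 : (y * X) * (y * Z) ≤ X * Z := mul_le_mul hyX hyZ hyZ0 hX.le
      nlinarith [sq_nonneg (X - Z)]
    · have := hR2 h
      have h5 : (2 * y * X) * (2 * y * Z) ≤ U * U :=
        mul_le_mul (by linarith) (by linarith) (by linarith) hU.le
      nlinarith
  nlinarith

/-- Moving inwards from `y ≥ 1/2`, where `1 - y²` may be small and the error must be
proportional to it. -/
theorem le_mul_of_half_le {y U X Z a b W : ℝ} (hy1 : y ≤ 1) (hy : 1 / 2 ≤ y)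
    (hU : U = 1 - y ^ 2) (hX : 0 < X) (hZ : 0 < Z) (ha0 : 0 ≤ a) (hb0 : 0 ≤ b)
    (ha : X ≤ y → U + 2 * y * X - X ^ 2 ≤ a) (hb : Z ≤ y → U + 2 * y * Z - Z ^ 2 ≤ b)
    (hW1 : X + Z ≤ 1 → (X + Z) ^ 2 ≤ W) (hW2 : 1 ≤ X + Z → X + Z ≤ W) :
    U ^ 2 + 2 * y * U * (X + Z) - 30 * (U * W) ≤ a * b := by
  have hU0 : 0 ≤ U := by rw [hU]; nlinarith
  have hU1 : U ≤ 1 := by rw [hU]; nlinarith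
  have hlarge : 1 / 2 ≤ X + Z → U ^ 2 + 2 * y * U * (X + Z) - 30 * (U * W) ≤ 0 := by
    intro h
    have h1 : U + 2 * y * (X + Z) ≤ 30 * W := by
      have h2 : y * (X + Z) ≤ X + Z := by nlinarith
      rcases le_total (X + Z) 1 with h3 | h3
      · have := hW1 h3
        nlinarith
      · have := hW2 h3
        nlinarith
    nlinarith
  by_cases hXy : X ≤ y
  · by_cases hZy : Z ≤ y
    · have h1 : 0 ≤ U + 2 * y * X - X ^ 2 := by nlinarith
      have h2 : 0 ≤ U + 2 * y * Z - Z ^ 2 := by nlinarith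
      have h3 := mul_le_mul (ha hXy) (hb hZy) h2 ha0
      have h4 : U * (X ^ 2 + Z ^ 2) ≤ U * (30 * W) := by
        refine mul_le_mul_of_nonneg_left ?_ hU0
        have hXZ : 0 < X * Z := by positivity
        rcases le_total (X + Z) 1 with h | h
        · have := hW1 h
          nlinarith
        · have := hW2 h
          nlinarith
      have h5 : 0 ≤ (2 * y * X - X ^ 2) * (2 * y * Z - Z ^ 2) :=
        mul_nonneg (by nlinarith) (by nlinarith)
      nlinarith
    · push Not at hZy
      exact (hlarge (by linarith)).trans (mul_nonneg ha0 hb0)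
  · push Not at hXy
    exact (hlarge (by linarith)).trans (mul_nonneg ha0 hb0)

/-- Moving inwards from `y < 1/2`, possibly across the kink at the origin. -/
theorem le_mul_of_lt_half {y U X Z a b W : ℝ} (hy0 : 0 ≤ y) (hy : y < 1 / 2)
    (hU : U = 1 - y ^ 2) (hX : 0 < X) (hZ : 0 < Z) (ha0 : 0 ≤ a) (hb0 : 0 ≤ b)
    (ha : X ≤ 1 / 4 → U + 2 * y * X - 4 * X ^ 2 ≤ a)
    (hb : Z ≤ 1 / 4 → U + 2 * y * Z - 4 * Z ^ 2 ≤ b)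
    (hW1 : X + Z ≤ 1 → (X + Z) ^ 2 ≤ W) (hW2 : 1 ≤ X + Z → X + Z ≤ W) :
    U ^ 2 + 2 * y * U * (X + Z) - 30 * (U * W) ≤ a * b := by
  have hU0 : 3 / 4 ≤ U := by rw [hU]; nlinarith
  have hU1 : U ≤ 1 := by rw [hU]; nlinarith
  have hyw : y * (X + Z) ≤ 1 / 2 * (X + Z) := by nlinarith
  have hyw0 : 0 ≤ y * (X + Z) := by positivity
  rcases le_or_gt (X + Z) (1 / 4) with h | h
  · have hW := hW1 (by linarith)
    have h1 : 0 ≤ U + 2 * y * X - 4 * X ^ 2 := by nlinarith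
    have h2 : 0 ≤ U + 2 * y * Z - 4 * Z ^ 2 := by nlinarith
    have h3 := mul_le_mul (ha (by linarith)) (hb (by linarith)) h2 ha0
    have hp : ∀ x, 0 < x → x ≤ 1 / 4 → |2 * y * x - 4 * x ^ 2| ≤ x := by
      intro x hx hx1
      rw [abs_le]
      constructor <;> nlinarith
    have h4 : -(X * Z) ≤ (2 * y * X - 4 * X ^ 2) * (2 * y * Z - 4 * Z ^ 2) := by
      have h5 := mul_le_mul (hp X hX (by linarith)) (hp Z hZ (by linarith)) (abs_nonneg _) hX.le
      rw [← abs_mul] at h5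
      exact (neg_le_neg h5).trans (neg_abs_le _)
    have h6 : U * W ≥ 3 / 4 * W := by nlinarith [sq_nonneg (X + Z)]
    have h7 : U * (4 * X ^ 2 + 4 * Z ^ 2) ≤ 4 * X ^ 2 + 4 * Z ^ 2 := by nlinarith
    have hXZ : 0 < X * Z := by positivity
    nlinarith
  · have h1 : X + Z ≤ 4 * W := by
      rcases le_total (X + Z) 1 with h3 | h3
      · have := hW1 h3
        nlinarith
      · have := hW2 h3
        nlinarith
    have h2 : U ^ 2 + 2 * y * U * (X + Z) - 30 * (U * W) ≤ 0 := by
      have : U + 2 * y * (X + Z) - 30 * W ≤ 0 := by nlinarith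
      nlinarith
    exact h2.trans (mul_nonneg ha0 hb0)

/-- Moving outwards on the left side, possibly across the jump at the edge, which lies within
`1 - x ≤ X + p` of the point. -/
theorem le_mul_left_outwards {x p U X Z a b W : ℝ} (hx0 : 0 ≤ x) (hx1 : x ≤ 1) (hp0 : 0 ≤ p)
    (hp1 : p ≤ 1) (hU : U = 1 - x ^ 2) (hX : 0 < X) (hZ : 0 < Z) (ha0 : 0 ≤ a) (hb0 : 0 ≤ b)
    (ha : x + X < 1 - p → U - 2 * x * X - X ^ 2 ≤ a)
    (hb : x + Z < 1 - p → U - 2 * x * Z - Z ^ 2 ≤ b)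
    (hW1 : X + Z ≤ 1 → (X + Z) ^ 2 ≤ W) (hW2 : 1 ≤ X + Z → X + Z ≤ W) :
    U ^ 2 - 2 * x * U * (X + Z) - 9 * W - 9 * p ^ 2 ≤ a * b := by
  have hU0 : 0 ≤ U := by rw [hU]; nlinarith
  have hU1 : U ≤ 1 := by rw [hU]; nlinarith
  have hXZ : 0 < X * Z := by positivity
  have hjump : ∀ D E : ℝ, 0 < D → 0 < E → 1 - p ≤ x + D → (D + E ≤ 1 → (D + E) ^ 2 ≤ W) →
      (1 ≤ D + E → D + E ≤ W) → U ^ 2 - 2 * x * U * (D + E) - 9 * W - 9 * p ^ 2 ≤ 0 := by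
    intro D E hD hE hDx hW1 hW2
    have hxU : 0 ≤ x * U := by positivity
    rcases le_total 1 (D + E) with h | h
    · have := hW2 h
      nlinarith [mul_nonneg hxU (by linarith : 0 ≤ D + E)]
    · have hW := hW1 h
      have hD1 : D ≤ 1 := by linarith
      have h1 : U ≤ 2 * (D + p) := by rw [hU]; nlinarith
      have h2 : U - 2 * x * D ≤ D ^ 2 + 3 * p := by
        have : U - 2 * x * D ≤ D * (1 - x) + p * (1 + x) := by rw [hU]; nlinarith
        nlinarith
      have h3 : U * (U - 2 * x * D) ≤ 2 * (D + p) * (D ^ 2 + 3 * p) :=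
        (mul_le_mul_of_nonneg_left h2 hU0).trans
          (mul_le_mul_of_nonneg_right h1 (by positivity))
      have h4 : 2 * (D + p) * (D ^ 2 + 3 * p) ≤ 7 * D ^ 2 + 9 * p ^ 2 := by
        nlinarith [sq_nonneg (D - p), mul_nonneg (sq_nonneg D) (sub_nonneg.2 hD1),
          mul_nonneg (sq_nonneg D) (sub_nonneg.2 hp1)]
      have h5 : D ^ 2 ≤ W := by nlinarith
      nlinarith [mul_nonneg hxU hE.le, sq_nonneg D]
  by_cases h1 : x + X < 1 - p
  · by_cases h2 : x + Z < 1 - p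
    · have e1 : U - 2 * x * X - X ^ 2 = 1 - (x + X) ^ 2 := by rw [hU]; ring
      have e2 : U - 2 * x * Z - Z ^ 2 = 1 - (x + Z) ^ 2 := by rw [hU]; ring
      have h3 : 0 ≤ U - 2 * x * Z - Z ^ 2 := by rw [e2]; nlinarith
      have h4 := mul_le_mul (ha h1) (hb h2) h3 ha0
      have h5 : 0 ≤ (2 * x * X + X ^ 2) * (2 * x * Z + Z ^ 2) := by positivity
      have h6 : X ^ 2 + Z ^ 2 ≤ 9 * W := by
        rcases le_total (X + Z) 1 with h | h
        · have := hW1 h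
          nlinarith
        · have := hW2 h
          nlinarith
      have h7 : U * (X ^ 2 + Z ^ 2) ≤ X ^ 2 + Z ^ 2 := by nlinarith
      nlinarith [sq_nonneg p]
    · push Not at h2
      have := hjump Z X hZ hX h2 (by rwa [add_comm]) (by rwa [add_comm])
      rw [add_comm Z X] at this
      exact this.trans (mul_nonneg ha0 hb0)
  · push Not at h1
    exact (hjump X Z hX hZ h1 hW1 hW2).trans (mul_nonneg ha0 hb0)

/-- Moving inwards on the left side. -/
theorem mul_le_left_inwards {x U X Z a b W : ℝ} (hx0 : 0 ≤ x) (hx1 : x ≤ 1)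
    (hU0 : 0 ≤ U) (hX : 0 < X) (hZ : 0 < Z) (hb0 : 0 ≤ b)
    (ha1 : a ≤ 1) (hb1 : b ≤ 1) (ha : a ≤ U + 2 * x * X) (hb : b ≤ U + 2 * x * Z)
    (hW1 : X + Z ≤ 1 → (X + Z) ^ 2 ≤ W) (hW2 : 1 ≤ X + Z → X + Z ≤ W) :
    a * b ≤ U ^ 2 + 2 * x * U * (X + Z) + 9 * W := by
  have hx2 : x ^ 2 ≤ 1 := by nlinarith
  have hXZ : 0 < X * Z := by positivity
  rcases le_total (X + Z) 1 with h | h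
  · have hW := hW1 h
    have h1 : a * b ≤ (U + 2 * x * X) * (U + 2 * x * Z) := mul_le_mul ha hb hb0 (by positivity)
    have h2 : x ^ 2 * (X * Z) ≤ X * Z := by nlinarith
    nlinarith [sq_nonneg (X - Z)]
  · have hW := hW2 h
    have h1 : a * b ≤ 1 := by nlinarith
    have h2 : 0 ≤ x * U * (X + Z) := by positivity
    nlinarith

/-- Moving inwards from beyond the left edge. -/
theorem mul_le_left_outside {p X Z a b W : ℝ} (hX : 0 < X) (hZ : 0 < Z) (hp0 : 0 ≤ p)
    (hb0 : 0 ≤ b) (ha1 : a ≤ 1) (hb1 : b ≤ 1)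
    (ha : a ≤ 2 * p + 2 * X) (hb : b ≤ 2 * p + 2 * Z)
    (hW1 : X + Z ≤ 1 → (X + Z) ^ 2 ≤ W) (hW2 : 1 ≤ X + Z → X + Z ≤ W) :
    a * b ≤ 9 * W + 9 * p ^ 2 := by
  have hXZ : 0 < X * Z := by positivity
  rcases le_total (X + Z) 1 with h | h
  · have hW := hW1 h
    have h1 : a * b ≤ (2 * p + 2 * X) * (2 * p + 2 * Z) := mul_le_mul ha hb hb0 (by positivity)
    nlinarith [sq_nonneg (X - Z), sq_nonneg (p - (X + Z))]
  · have hW := hW2 h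
    nlinarith [sq_nonneg p]

theorem kink_bound {y X Q : ℝ} (hy : 0 ≤ y) (hX : 0 ≤ X - y) (hQ : Q ≤ 4 * (X - y) ^ 2) :
    1 - y ^ 2 + 2 * y * X - 4 * X ^ 2 ≤ 1 - Q := by
  nlinarith [mul_nonneg hy hX, mul_nonneg hy hy]

namespace IsProfile

variable {A τ σ θ ς : ℝ}

theorem div_nonneg (h : IsProfile A τ σ θ ς) (v : ℝ) : 0 ≤ profile A τ σ θ ς v / A :=
  _root_.div_nonneg (h.nonneg v) h.A_pos.le

theorem div_le_one (h : IsProfile A τ σ θ ς) (v : ℝ) : profile A τ σ θ ς v / A ≤ 1 :=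
  (_root_.div_le_one h.A_pos).2 (h.le v)

theorem div_right (h : IsProfile A τ σ θ ς) {v : ℝ} (h0 : 0 ≤ v) (h1 : v < σ) :
    profile A τ σ θ ς v / A = 1 - (v / τ) ^ 2 := by
  rw [eq_right h0 h1, mul_div_cancel_left₀ _ h.A_pos.ne', div_pow]

theorem div_left (h : IsProfile A τ σ θ ς) {v : ℝ} (h0 : v < 0) (h1 : -ς < v) :
    profile A τ σ θ ς v / A = 1 - (v / θ) ^ 2 := by
  rw [eq_left h0 h1, mul_div_cancel_left₀ _ h.A_pos.ne', div_pow]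

theorem mul_eq (h : IsProfile A τ σ θ ς) (v w : ℝ) :
    profile A τ σ θ ς v * profile A τ σ θ ς w =
      A ^ 2 * (profile A τ σ θ ς v / A * (profile A τ σ θ ς w / A)) := by
  have := h.A_pos
  field_simp

/-- The expansion of the kernel at a point of the right half of the profile. The error is measured
at the scale `τ U`, so that it is of smaller order than the drift even where `U` is small. -/
theorem kernel_right (h : IsProfile A τ σ θ ς) (hθ : τ ≤ 2 * θ) (hς : τ < 4 * ς) {η : ℝ}
    (hη : 0 < η) (hη1 : η ≤ 1) {v U : ℝ} (hv0 : 0 ≤ v) (hvσ : v < σ)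
    (hU : U = 1 - (v / τ) ^ 2) (e t z : ℝ) (he : e = 1 ∨ e = -1) (ht : 0 < t) (hz : 0 < z) :
    e * (A ^ 2 * U ^ 2) + A ^ 2 * (2 * (v / τ) * U / τ) * (t + z)
        - A ^ 2 * (30 * U ^ 2 / (τ * U) ^ (1 + η)) * (t + z) ^ (1 + η) - 0
      ≤ e * (profile A τ σ θ ς (v - e * t) * profile A τ σ θ ς (v - e * z)) := by
  have hτ := h.τ_pos
  have hA := h.A_pos
  have hσ := h.σ_lt
  have hθ0 := h.θ_pos
  set y := v / τ with hy
  have hy0 : 0 ≤ y := by positivity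
  have hy1 : y < 1 := (div_lt_one hτ).2 (hvσ.trans hσ)
  have hU0 : 0 < U := by rw [hU]; nlinarith
  have hU1 : U ≤ 1 := by rw [hU]; nlinarith
  have hX : 0 < t / τ := by positivity
  have hZ : 0 < z / τ := by positivity
  set R := ((t + z) / (τ * U)) ^ (1 + η) with hR
  have hr0 : 0 < (t + z) / (τ * U) := by positivity
  have hrw : t / τ + z / τ = U * ((t + z) / (τ * U)) := by field_simp
  have e1 : A ^ 2 * (30 * U ^ 2 / (τ * U) ^ (1 + η)) * (t + z) ^ (1 + η)
      = A ^ 2 * (30 * (U ^ 2 * R)) := by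
    rw [hR, Real.div_rpow (by positivity) (by positivity)]
    ring
  have e2 : A ^ 2 * (2 * y * U / τ) * (t + z) = A ^ 2 * (2 * y * U * (t / τ + z / τ)) := by
    ring
  rw [e1, e2, h.mul_eq]
  rcases he with rfl | rfl
  · set W := (t / τ + z / τ) ^ (1 + η) with hW
    have hwpos : 0 < t / τ + z / τ := by positivity
    have hW1 : t / τ + z / τ ≤ 1 → (t / τ + z / τ) ^ 2 ≤ W := sq_le_rpow_one_add hwpos hη1
    have hW2 : 1 ≤ t / τ + z / τ → t / τ + z / τ ≤ W := le_rpow_one_add hη.le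
    have hWR : U * W ≤ U ^ 2 * R := by
      have h1 : W = U ^ (1 + η) * R := by
        rw [hW, hrw, Real.mul_rpow hU0.le hr0.le]
      have h2 : U ^ (1 + η) ≤ U := by
        simpa using Real.rpow_le_rpow_of_exponent_ge hU0 hU1 (by linarith : (1 : ℝ) ≤ 1 + η)
      have h3 : 0 ≤ R := Real.rpow_nonneg hr0.le _
      rw [h1]
      calc U * (U ^ (1 + η) * R) ≤ U * (U * R) := by gcongr
        _ = U ^ 2 * R := by ring
    have key : U ^ 2 + 2 * y * U * (t / τ + z / τ) - 30 * (U * W) ≤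
        profile A τ σ θ ς (v - 1 * t) / A * (profile A τ σ θ ς (v - 1 * z) / A) := by
      rcases le_or_gt (1 / 2) y with hyh | hyh
      · have hval : ∀ s : ℝ, 0 < s → s / τ ≤ y →
            U + 2 * y * (s / τ) - (s / τ) ^ 2 ≤ profile A τ σ θ ς (v - 1 * s) / A := by
          intro s hs hsy
          have h1 : s ≤ v := (div_le_div_iff_of_pos_right hτ).1 hsy
          rw [h.div_right (by linarith) (by linarith), hU]
          apply le_of_eq
          rw [hy]
          ring
        exact le_mul_of_half_le hy1.le hyh hU hX hZ (h.div_nonneg _) (h.div_nonneg _)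
          (hval t ht) (hval z hz) hW1 hW2
      · have hval : ∀ s : ℝ, 0 < s → s / τ ≤ 1 / 4 →
            U + 2 * y * (s / τ) - 4 * (s / τ) ^ 2 ≤ profile A τ σ θ ς (v - 1 * s) / A := by
          intro s hs hs4
          have hs5 : s ≤ τ / 4 := by
            rw [div_le_iff₀ hτ] at hs4; linarith
          rcases le_or_gt s v with hsv | hsv
          · rw [h.div_right (by linarith) (by linarith), hU]
            have : 1 - ((v - 1 * s) / τ) ^ 2 = 1 - y ^ 2 + 2 * y * (s / τ) - (s / τ) ^ 2 := by
              rw [hy]; ring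
            rw [this]
            linarith [sq_nonneg (s / τ)]
          · rw [h.div_left (by linarith) (by linarith), hU]
            have hq : 0 ≤ s / τ - y := by
              rw [hy, ← sub_div]; exact _root_.div_nonneg (by linarith) hτ.le
            have h3 : (v - 1 * s) / θ = -((s / τ - y) * (τ / θ)) := by
              rw [hy]; field_simp; ring
            have h4 : τ / θ ≤ 2 := (div_le_iff₀ hθ0).2 hθ
            have h5 : 0 ≤ τ / θ := by positivity
            have h6 : (s / τ - y) * (τ / θ) ≤ (s / τ - y) * 2 := by gcongr
            have h7 : ((v - 1 * s) / θ) ^ 2 ≤ 4 * (s / τ - y) ^ 2 := by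
              rw [h3, neg_sq]
              calc ((s / τ - y) * (τ / θ)) ^ 2 ≤ ((s / τ - y) * 2) ^ 2 :=
                    pow_le_pow_left₀ (mul_nonneg hq h5) h6 2
                _ = 4 * (s / τ - y) ^ 2 := by ring
            exact kink_bound hy0 hq h7
        exact le_mul_of_lt_half hy0 hyh hU hX hZ (h.div_nonneg _) (h.div_nonneg _)
          (hval t ht) (hval z hz) hW1 hW2
    linarith [mul_le_mul_of_nonneg_left key (sq_nonneg A),
      mul_le_mul_of_nonneg_left hWR (sq_nonneg A)]
  · have hval : ∀ s : ℝ, 0 < s →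
        profile A τ σ θ ς (v - -1 * s) / A ≤ max (U - 2 * y * (s / τ)) 0 := by
      intro s hs
      rcases lt_or_ge (v + s) σ with h1 | h1
      · rw [h.div_right (by linarith) (by linarith)]
        refine le_trans ?_ (le_max_left _ _)
        have : 1 - ((v - -1 * s) / τ) ^ 2 = U - 2 * y * (s / τ) - (s / τ) ^ 2 := by
          rw [hU, hy]; ring
        rw [this]
        linarith [sq_nonneg (s / τ)]
      · rw [h.eq_zero_right (by linarith), zero_div]
        exact le_max_right _ _
    have hR1 : t / τ + z / τ ≤ U → (t / τ + z / τ) ^ 2 ≤ U ^ 2 * R := by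
      intro hle
      rw [hrw] at hle ⊢
      have : (t + z) / (τ * U) ≤ 1 := by
        by_contra! hlt
        nlinarith
      rw [mul_pow]
      exact mul_le_mul_of_nonneg_left (sq_le_rpow_one_add hr0 hη1 this) (sq_nonneg _)
    have hR2 : U ≤ t / τ + z / τ → U * (t / τ + z / τ) ≤ U ^ 2 * R := by
      intro hle
      rw [hrw] at hle ⊢
      have : 1 ≤ (t + z) / (τ * U) := by
        by_contra! hlt
        nlinarith
      rw [← mul_assoc, ← pow_two]
      exact mul_le_mul_of_nonneg_left (le_rpow_one_add hη.le this) (sq_nonneg _)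
    have key := mul_le_of_le_tangent hy0 hy1.le hU0 hX hZ (h.div_nonneg _) (h.div_nonneg _)
      (hval t ht) (hval z hz) hR1 hR2
    have hR0 : 0 ≤ U ^ 2 * R := mul_nonneg (sq_nonneg _) (Real.rpow_nonneg hr0.le _)
    linarith [mul_le_mul_of_nonneg_left key (sq_nonneg A), mul_nonneg (sq_nonneg A) hR0]

/-- The expansion of the kernel at a point of the left half of the profile. The jump at the left
edge contributes the error of order `(1 - ς/θ)²`. -/
theorem kernel_left (h : IsProfile A τ σ θ ς) {η : ℝ} (hη : 0 < η) (hη1 : η ≤ 1) {v x U : ℝ}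
    (hv0 : v < 0) (hvς : -ς < v) (hx : x = -v / θ) (hU : U = 1 - x ^ 2) (e t z : ℝ)
    (he : e = 1 ∨ e = -1) (ht : 0 < t) (hz : 0 < z) :
    e * (A ^ 2 * U ^ 2) + A ^ 2 * (-(2 * x * U / θ)) * (t + z)
        - A ^ 2 * (9 / θ ^ (1 + η)) * (t + z) ^ (1 + η) - A ^ 2 * (9 * (1 - ς / θ) ^ 2)
      ≤ e * (profile A τ σ θ ς (v - e * t) * profile A τ σ θ ς (v - e * z)) := by
  have hA := h.A_pos
  have hθ := h.θ_pos
  have hς := h.ς_lt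
  have hx0 : 0 ≤ x := by rw [hx]; exact _root_.div_nonneg (by linarith) hθ.le
  have hx1 : x ≤ 1 := by rw [hx, _root_.div_le_one hθ]; linarith
  have hU0 : 0 ≤ U := by rw [hU]; nlinarith
  have hX : 0 < t / θ := by positivity
  have hZ : 0 < z / θ := by positivity
  have hv : v = -(x * θ) := by rw [hx]; field_simp
  set p := 1 - ς / θ with hp
  have hp0 : 0 ≤ p := sub_nonneg.2 ((_root_.div_le_one hθ).2 hς.le)
  have hp1 : p ≤ 1 := by
    have : 0 < ς / θ := div_pos h.ς_pos hθ
    linarith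
  set W := (t / θ + z / θ) ^ (1 + η) with hW
  have hwpos : 0 < t / θ + z / θ := by positivity
  have hW1 : t / θ + z / θ ≤ 1 → (t / θ + z / θ) ^ 2 ≤ W := sq_le_rpow_one_add hwpos hη1
  have hW2 : 1 ≤ t / θ + z / θ → t / θ + z / θ ≤ W := le_rpow_one_add hη.le
  have e1 : A ^ 2 * (9 / θ ^ (1 + η)) * (t + z) ^ (1 + η) = A ^ 2 * (9 * W) := by
    rw [hW, ← add_div, Real.div_rpow (by positivity) (by positivity)]
    ring
  have e2 : A ^ 2 * (-(2 * x * U / θ)) * (t + z) = A ^ 2 * (-(2 * x * U * (t / θ + z / θ))) := by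
    ring
  rw [e1, e2, h.mul_eq]
  rcases he with rfl | rfl
  · have hval : ∀ s : ℝ, 0 < s → x + s / θ < 1 - p →
        U - 2 * x * (s / θ) - (s / θ) ^ 2 ≤ profile A τ σ θ ς (v - 1 * s) / A := by
      intro s hs hlt
      have h1 : x * θ + s < ς := by
        have h2 : 1 - p = ς / θ := by rw [hp]; ring
        rw [h2, lt_div_iff₀ hθ] at hlt
        have h3 : (x + s / θ) * θ = x * θ + s := by field_simp
        linarith
      rw [h.div_left (by linarith) (by linarith)]
      apply le_of_eq
      rw [hU, hv]
      field_simp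
      ring
    have key := le_mul_left_outwards hx0 hx1 hp0 hp1 hU hX hZ (h.div_nonneg (v - 1 * t))
      (h.div_nonneg (v - 1 * z)) (hval t ht) (hval z hz) hW1 hW2
    linarith [mul_le_mul_of_nonneg_left key (sq_nonneg A)]
  · have hval : ∀ s : ℝ, 0 < s →
        profile A τ σ θ ς (v - -1 * s) / A ≤ U + 2 * x * (s / θ) := by
      intro s hs
      rcases lt_or_ge (v + s) 0 with h1 | h1
      · rw [h.div_left (by linarith) (by linarith)]
        have : 1 - ((v - -1 * s) / θ) ^ 2 = U + 2 * x * (s / θ) - (s / θ) ^ 2 := by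
          rw [hU, hv]; field_simp; ring
        rw [this]
        linarith [sq_nonneg (s / θ)]
      · refine (h.div_le_one _).trans ?_
        have h2 : x ≤ s / θ := by
          rw [le_div_iff₀ hθ]; linarith
        rw [hU]
        nlinarith
    have key := mul_le_left_inwards hx0 hx1 hU0 hX hZ (h.div_nonneg (v - -1 * z))
      (h.div_le_one (v - -1 * t)) (h.div_le_one _) (hval t ht) (hval z hz) hW1 hW2
    linarith [mul_le_mul_of_nonneg_left key (sq_nonneg A), mul_nonneg (sq_nonneg A) (sq_nonneg p)]

/-- Beyond the left edge there is no drift, and the errors are those of `kernel_left`. -/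
theorem kernel_outside (h : IsProfile A τ σ θ ς) {η : ℝ} (hη : 0 < η) (hη1 : η ≤ 1) {v : ℝ}
    (hvς : v ≤ -ς) (e t z : ℝ) (he : e = 1 ∨ e = -1) (ht : 0 < t) (hz : 0 < z) :
    e * 0 + 0 * (t + z)
        - A ^ 2 * (9 / θ ^ (1 + η)) * (t + z) ^ (1 + η) - A ^ 2 * (9 * (1 - ς / θ) ^ 2)
      ≤ e * (profile A τ σ θ ς (v - e * t) * profile A τ σ θ ς (v - e * z)) := by
  have hA := h.A_pos
  have hθ := h.θ_pos
  have hς := h.ς_lt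
  have hX : 0 < t / θ := by positivity
  have hZ : 0 < z / θ := by positivity
  set p := 1 - ς / θ with hp
  have hp0 : 0 ≤ p := sub_nonneg.2 ((_root_.div_le_one hθ).2 hς.le)
  set W := (t / θ + z / θ) ^ (1 + η) with hW
  have hwpos : 0 < t / θ + z / θ := by positivity
  have hW0 : 0 ≤ W := Real.rpow_nonneg hwpos.le _
  have hW1 : t / θ + z / θ ≤ 1 → (t / θ + z / θ) ^ 2 ≤ W := sq_le_rpow_one_add hwpos hη1
  have hW2 : 1 ≤ t / θ + z / θ → t / θ + z / θ ≤ W := le_rpow_one_add hη.le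
  have e1 : A ^ 2 * (9 / θ ^ (1 + η)) * (t + z) ^ (1 + η) = A ^ 2 * (9 * W) := by
    rw [hW, ← add_div, Real.div_rpow (by positivity) (by positivity)]
    ring
  rw [e1, h.mul_eq]
  have hA2 : 0 < A ^ 2 := by positivity
  rcases he with rfl | rfl
  · have := mul_nonneg (h.div_nonneg (v - 1 * t)) (h.div_nonneg (v - 1 * z))
    have := mul_nonneg hA2.le this
    have := mul_nonneg hA2.le hW0
    have := mul_nonneg hA2.le (sq_nonneg p)
    linarith
  · have hval : ∀ s : ℝ, 0 < s →
        profile A τ σ θ ς (v - -1 * s) / A ≤ 2 * p + 2 * (s / θ) := by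
      intro s hs
      have hpς : ς / θ = 1 - p := by rw [hp]; ring
      have hs0 : 0 < s / θ := by positivity
      rcases le_or_gt (v + s) (-ς) with h1 | h1
      · rw [h.eq_zero_left (by linarith), zero_div]
        positivity
      rcases lt_or_ge (v + s) 0 with h2 | h2
      · rw [h.div_left (by linarith) (by linarith)]
        have h3 : (v - -1 * s) / θ ≤ -(1 - p) + s / θ := by
          rw [← hpς, ← neg_div, ← add_div]
          exact div_le_div_of_nonneg_right (by linarith) hθ.le
        have h4 : (v - -1 * s) / θ < 0 := div_neg_of_neg_of_pos (by linarith) hθ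
        have h5 : -1 ≤ (v - -1 * s) / θ := by
          rw [le_div_iff₀ hθ]; linarith
        nlinarith
      · refine (h.div_le_one _).trans ?_
        have h3 : 1 - p ≤ s / θ := by
          rw [← hpς]
          exact div_le_div_of_nonneg_right (by linarith) hθ.le
        linarith
    have key := mul_le_left_outside hX hZ hp0 (h.div_nonneg (v - -1 * z))
      (h.div_le_one (v - -1 * t)) (h.div_le_one _) (hval t ht) (hval z hz) hW1 hW2
    linarith [mul_le_mul_of_nonneg_left key hA2.le]

/-- At and just beyond the right edge only the positive sign contributes to `Λ`, and by a definite
amount. -/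
theorem kernel_edge {Ω : Type*} (h : IsProfile A τ σ θ ς) {e : Ω → ℝ} {S : Ω × ℝ → ℝ}
    (he : ∀ ω, e ω = 1 ∨ e ω = -1) (hS : ∀ p, 0 ≤ S p) {k : ℕ} {v : ℝ} (hv : σ ≤ v)
    (hvk : v < σ + 1 / k) (hkσ : (k : ℝ) ≤ σ) {p : Ω × ℝ} (hp : 0 < p.2) :
    A ^ 2 * (1 - σ / τ) ^ 2 * coreWidth e S k p ≤
      profile A τ σ θ ς (v - e p.1 * p.2) *
        (cdfOf (profile A τ σ θ ς) v - cdfOf (profile A τ σ θ ς) (v - e p.1 * S p)) := by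
  have hτ := h.τ_pos
  have hA := h.A_pos
  have hσ0 := h.σ_pos
  have hσ := h.σ_lt
  have hmono := h.isProbDensity.cdfOf_mono
  set q := 1 - σ / τ with hq
  have hq0 : 0 ≤ q := sub_nonneg.2 ((_root_.div_le_one hτ).2 hσ.le)
  have hlow : ∀ x, 0 ≤ x → x < σ → A * q ≤ profile A τ σ θ ς x := by
    intro x h0 h1
    rw [eq_right h0 h1, ← div_pow]
    refine mul_le_mul_of_nonneg_left ?_ hA.le
    have h2 : x / τ ≤ σ / τ := div_le_div_of_nonneg_right h1.le hτ.le
    have h3 : 0 ≤ x / τ := by positivity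
    have h4 : σ / τ ≤ 1 := (_root_.div_le_one hτ).2 hσ.le
    rw [hq]
    nlinarith
  rcases he p.1 with h1 | h1
  · rw [h1, one_mul, one_mul]
    have hΔ : 0 ≤ cdfOf (profile A τ σ θ ς) v - cdfOf (profile A τ σ θ ς) (v - S p) :=
      sub_nonneg.2 (hmono (by linarith [hS p]))
    unfold coreWidth
    split_ifs with hc
    · obtain ⟨-, hc1, hc2⟩ := hc
      rcases le_or_gt (min (S p) (k : ℝ)) (1 / k) with hm | hm
      · rw [max_eq_right (by linarith), mul_zero]
        exact mul_nonneg (h.nonneg _) hΔ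
      rw [max_eq_left (by linarith)]
      have hk0 : 0 < 1 / (k : ℝ) := by
        rcases (Nat.cast_nonneg k : (0 : ℝ) ≤ k).eq_or_lt with h0 | h0
        · rw [← h0] at hc2; linarith
        · positivity
      have h2 : A * q ≤ profile A τ σ θ ς (v - p.2) :=
        hlow _ (by linarith) (by linarith)
      have h3 : A * q * (min (S p) (k : ℝ) - 1 / k) ≤
          cdfOf (profile A τ σ θ ς) v - cdfOf (profile A τ σ θ ς) (v - S p) := by
        have h4 := h.cdf_sub_ge (a := v - min (S p) (k : ℝ)) (b := v - 1 / k) (m := A * q)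
          (by linarith) (fun x hx1 hx2 => hlow x
            (by linarith [min_le_right (S p) (k : ℝ)]) (by linarith))
        have h5 := hmono (show v - 1 / (k : ℝ) ≤ v by linarith)
        have h6 := hmono (show v - S p ≤ v - min (S p) (k : ℝ) by
          linarith [min_le_left (S p) (k : ℝ)])
        have h7 : v - 1 / (k : ℝ) - (v - min (S p) (k : ℝ)) = min (S p) (k : ℝ) - 1 / k := by ring
        rw [h7] at h4
        linarith
      calc A ^ 2 * q ^ 2 * (min (S p) (k : ℝ) - 1 / k)
          = A * q * (A * q * (min (S p) (k : ℝ) - 1 / k)) := by ring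
        _ ≤ _ := mul_le_mul h2 h3 (mul_nonneg (by positivity) (by linarith)) (h.nonneg _)
    · rw [mul_zero]
      exact mul_nonneg (h.nonneg _) hΔ
  · have h2 : coreWidth e S k p = 0 := by
      unfold coreWidth
      rw [if_neg]
      rintro ⟨h3, -⟩
      rw [h1] at h3
      norm_num at h3
    rw [h2, mul_zero, h1, h.eq_zero_right (by linarith), zero_mul]

end IsProfile

/-! ### Increments of the distribution functions -/

/-- The mass `s - s³/3` of the unit parabola `1 - x²` on `[0, s]`, for `s = 1 - t^{r-1}`. -/
noncomputable def parMass (r t : ℝ) : ℝ := (1 - t ^ (r - 1)) - (1 - t ^ (r - 1)) ^ 3 / 3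

theorem rpow_sub_one_pos_lt_one {r t : ℝ} (hr : r < 1) (ht : 1 < t) :
    0 < t ^ (r - 1) ∧ t ^ (r - 1) < 1 :=
  ⟨Real.rpow_pos_of_pos (by linarith) _, Real.rpow_lt_one_of_one_lt_of_neg ht (by linarith)⟩

theorem parMass_pos {r t : ℝ} (hr : r < 1) (ht : 1 < t) : 0 < parMass r t := by
  obtain ⟨h0, h1⟩ := rpow_sub_one_pos_lt_one hr ht
  unfold parMass
  generalize t ^ (r - 1) = p at *
  have h2 : (1 - p) ^ 2 < 1 := by nlinarith
  nlinarith

theorem parMass_le {r t : ℝ} (hr : r < 1) (ht : 1 < t) : parMass r t ≤ 2 / 3 := by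
  obtain ⟨h0, h1⟩ := rpow_sub_one_pos_lt_one hr ht
  unfold parMass
  generalize t ^ (r - 1) = p at *
  nlinarith [mul_nonneg h0.le h0.le]

theorem parMass_mono {r t u : ℝ} (hr : r < 1) (ht : 1 < t) (htu : t ≤ u) :
    parMass r t ≤ parMass r u := by
  obtain ⟨h0, h1⟩ := rpow_sub_one_pos_lt_one hr ht
  obtain ⟨h2, h3⟩ := rpow_sub_one_pos_lt_one hr (ht.trans_le htu)
  have h4 : u ^ (r - 1) ≤ t ^ (r - 1) :=
    Real.rpow_le_rpow_of_nonpos (by linarith) htu (by linarith)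
  unfold parMass
  generalize t ^ (r - 1) = p at *
  generalize u ^ (r - 1) = q at *
  have h5 : (1 - q) ^ 2 + (1 - q) * (1 - p) + (1 - p) ^ 2 ≤ 3 := by nlinarith
  nlinarith [mul_nonneg (sub_nonneg.2 h4) (sub_nonneg.2 h5)]

/-- The mass varies slower than `t` by the factor `t^{2(r-1)}`, since the parabola vanishes
at `1`. -/
theorem parMass_sub_le {r t u : ℝ} (hr0 : 0 ≤ r) (hr : r < 1) (ht : 1 < t) (htu : t ≤ u) :
    t * (parMass r u - parMass r t) ≤ 2 * (t ^ (r - 1)) ^ 2 * (u - t) := by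
  have ht0 : 0 < t := by linarith
  have hu0 : 0 < u := by linarith
  obtain ⟨h0, h1⟩ := rpow_sub_one_pos_lt_one hr ht
  obtain ⟨h2, h3⟩ := rpow_sub_one_pos_lt_one hr (ht.trans_le htu)
  have h4 : u ^ (r - 1) ≤ t ^ (r - 1) :=
    Real.rpow_le_rpow_of_nonpos (by linarith) htu (by linarith)
  have h5 : t ^ (r - 1) * (t / u) ≤ u ^ (r - 1) := by
    have h6 : u ^ (r - 1) = t ^ (r - 1) * (t / u) ^ (1 - r) := by
      rw [Real.div_rpow ht0.le hu0.le, ← mul_div_assoc, ← Real.rpow_add ht0, eq_div_iff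
        (Real.rpow_pos_of_pos hu0 _).ne', ← Real.rpow_add hu0]
      simp
    rw [h6]
    have h7 : t / u ≤ (t / u) ^ (1 - r) := by
      simpa using Real.rpow_le_rpow_of_exponent_ge (by positivity : 0 < t / u)
        ((div_le_one hu0).2 htu) (by linarith : 1 - r ≤ 1)
    gcongr
  have h8 : t * (t ^ (r - 1) - u ^ (r - 1)) ≤ t ^ (r - 1) * (u - t) := by
    have h9 : t * (1 - t / u) ≤ u - t := by
      rw [show 1 - t / u = (u - t) / u by field_simp, mul_div_assoc', div_le_iff₀ hu0]
      nlinarith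
    have h10 := mul_le_mul_of_nonneg_left h9 h0.le
    nlinarith
  unfold parMass
  generalize t ^ (r - 1) = p at *
  generalize u ^ (r - 1) = q at *
  have h11 : ((1 - q) - (1 - q) ^ 3 / 3) - ((1 - p) - (1 - p) ^ 3 / 3) ≤ 2 * p * (p - q) := by
    have h12 : 0 ≤ p - q := by linarith
    have h13 : (p + q) - (p ^ 2 + p * q + q ^ 2) / 3 ≤ 2 * p := by nlinarith
    nlinarith [mul_le_mul_of_nonneg_left h13 h12]
  nlinarith

theorem tendsto_parMass {r : ℝ} (hr : r < 1) : Tendsto (parMass r) atTop (𝓝 (2 / 3)) := by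
  have h : Tendsto (fun t : ℝ => t ^ (r - 1)) atTop (𝓝 0) := by
    simpa using tendsto_rpow_neg_atTop (by linarith : 0 < 1 - r)
  have h1 : Tendsto (fun t : ℝ => 1 - t ^ (r - 1)) atTop (𝓝 (1 - 0)) := tendsto_const_nhds.sub h
  have h2 := h1.sub ((h1.pow 3).div_const 3)
  have e : (1 - 0 : ℝ) - (1 - 0) ^ 3 / 3 = 2 / 3 := by norm_num
  rw [e] at h2
  exact h2

theorem one_sub_le_one_sub_sq {y s : ℝ} (hy0 : 0 ≤ y) (hy1 : y ≤ 1) (hys : y ≤ s) :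
    1 - s ≤ 1 - y ^ 2 := by
  nlinarith

namespace IsProfile

variable {A τ σ θ ς A' τ' σ' θ' ς' : ℝ}

theorem cdf_right_eq (h : IsProfile A τ σ θ ς) {g v : ℝ} (hg : A * τ * g = 1 / 2) (hg0 : 0 < g)
    (h0 : 0 ≤ v) (h1 : v ≤ σ) :
    cdfOf (profile A τ σ θ ς) v = 1 / 2 + 1 / (2 * g) * (v / τ - (v / τ) ^ 3 / 3) := by
  have hτ := h.τ_pos
  rw [h.cdf_right h0 h1]
  have : 1 / (2 * g) = A * τ := by
    rw [div_eq_iff (by positivity)]; linarith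
  rw [this]
  field_simp

theorem cdf_left_eq (h : IsProfile A τ σ θ ς) {g v : ℝ} (hg : A * θ * g = 1 / 2) (hg0 : 0 < g)
    (h0 : v ≤ 0) (h1 : -ς ≤ v) :
    cdfOf (profile A τ σ θ ς) v = 1 / 2 - 1 / (2 * g) * (-v / θ - (-v / θ) ^ 3 / 3) := by
  have hθ := h.θ_pos
  rw [h.cdf_left h0 h1]
  have : 1 / (2 * g) = A * θ := by
    rw [div_eq_iff (by positivity)]; linarith
  rw [this]
  field_simp
  ring

/-- The loss at a fixed point of the right half when the profile is rescaled: the leading term is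
`y (1 - y²) β / (2 g' τ)`, and the change of the mass `g` is of lower order. -/
theorem rescale_right_le {g g' p y y' U b : ℝ} (hg : 1 / 2 ≤ g) (hgg : g ≤ g')
    (hgd : g' - g ≤ 2 * p ^ 2 * b) (hp : 0 < p) (hpU : p ≤ U) (hU : U = 1 - y ^ 2) (hy0 : 0 ≤ y)
    (hy1 : y ≤ 1) (hy' : 0 ≤ y') (hyy : y' ≤ y) (hyb : y - y' ≤ y * b) (hb : 0 ≤ b) :
    1 / (2 * g) * (y - y ^ 3 / 3) - 1 / (2 * g') * (y' - y' ^ 3 / 3) ≤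
      U * b * (1 / (2 * g') * y * (1 + 2 * b / p) + 4 * p) := by
  have hg0 : 0 < g := by linarith
  have hg'0 : 0 < g' := by linarith
  have hU0 : 0 < U := hp.trans_le hpU
  have h1 : 1 / (2 * g) - 1 / (2 * g') ≤ 4 * p ^ 2 * b := by
    have e : 1 / (2 * g) - 1 / (2 * g') = (g' - g) / (2 * g * g') := by field_simp
    rw [e, div_le_iff₀ (by positivity)]
    have h2 : 1 / 2 ≤ 2 * g * g' := by nlinarith
    have h3 : 0 ≤ 2 * p ^ 2 * b := by positivity
    nlinarith
  have h2 : y - y ^ 3 / 3 ≤ 1 := by nlinarith [mul_nonneg hy0 (sq_nonneg y)]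
  have h20 : 0 ≤ y - y ^ 3 / 3 := by
    have : y ^ 2 ≤ 1 := by nlinarith
    nlinarith
  have h3 : (y - y ^ 3 / 3) * (1 / (2 * g) - 1 / (2 * g')) ≤ 4 * p * (U * b) := by
    have h30 : 0 ≤ 4 * p ^ 2 * b := by positivity
    have h31 : (y - y ^ 3 / 3) * (1 / (2 * g) - 1 / (2 * g')) ≤ 1 * (4 * p ^ 2 * b) := by
      refine (mul_le_mul_of_nonneg_left h1 h20).trans ?_
      exact mul_le_mul_of_nonneg_right h2 h30
    have h32 : p * (p * b) ≤ U * (p * b) := mul_le_mul_of_nonneg_right hpU (by positivity)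
    nlinarith
  have h4 : (y - y ^ 3 / 3) - (y' - y' ^ 3 / 3) ≤ U * b * (y * (1 + 2 * b / p)) := by
    have h41 : (y - y ^ 3 / 3) - (y' - y' ^ 3 / 3) ≤ (y - y') * (1 - y' ^ 2) := by
      have : 0 ≤ (y - y') * (y ^ 2 + y * y' - 2 * y' ^ 2) := by
        apply mul_nonneg (by linarith)
        nlinarith
      nlinarith
    have h42 : 1 - y' ^ 2 ≤ U * (1 + 2 * b / p) := by
      have h43 : 2 * b ≤ U * (2 * b / p) := by
        rw [mul_div_assoc', le_div_iff₀ hp]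
        nlinarith
      have h44 : y * b ≤ b := by nlinarith
      nlinarith
    have h45 : 0 ≤ U * (1 + 2 * b / p) := by positivity
    calc _ ≤ (y - y') * (1 - y' ^ 2) := h41
      _ ≤ (y - y') * (U * (1 + 2 * b / p)) := mul_le_mul_of_nonneg_left h42 (by linarith)
      _ ≤ y * b * (U * (1 + 2 * b / p)) := mul_le_mul_of_nonneg_right hyb h45
      _ = _ := by ring
  have h5 := mul_le_mul_of_nonneg_left h4 (by positivity : 0 ≤ 1 / (2 * g'))
  calc _ = 1 / (2 * g') * ((y - y ^ 3 / 3) - (y' - y' ^ 3 / 3))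
        + (y - y ^ 3 / 3) * (1 / (2 * g) - 1 / (2 * g')) := by ring
    _ ≤ 1 / (2 * g') * (U * b * (y * (1 + 2 * b / p))) + 4 * p * (U * b) := add_le_add h5 h3
    _ = _ := by ring

/-- The increment at a point of the right half: the gain from the shift `δ β` minus the loss from
rescaling. -/
theorem increment_right (h : IsProfile A τ σ θ ς) (h' : IsProfile A' τ' σ' θ' ς')
    {g g' p β δ v U : ℝ} (hg : A * τ * g = 1 / 2) (hg' : A' * τ' * g' = 1 / 2) (hgh : 1 / 2 ≤ g)
    (hgg : g ≤ g') (hgd : g' - g ≤ 2 * p ^ 2 * (β / τ)) (hp : p = 1 - σ / τ) (hτ' : τ' = τ + β)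
    (hβ : 0 < β) (hδ0 : 0 < δ) (hδ1 : δ < 1) (hv0 : 0 ≤ v) (hvσ : v < σ)
    (hvσ' : v + δ * β < σ') (hU : U = 1 - (v / τ) ^ 2) :
    U * (β / τ) * (δ * (A' * τ * (τ / τ') ^ 2)
      - (v / τ) * (1 / (2 * g') * (1 + 2 * (β / τ) / p)) - 4 * p) ≤
      cdfOf (profile A' τ' σ' θ' ς') (v + δ * β) - cdfOf (profile A τ σ θ ς) v := by
  have hτ0 := h.τ_pos
  have hτ'0 := h'.τ_pos
  have hA' := h'.A_pos
  have hσ := h.σ_lt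
  have hδβ : 0 < δ * β := by positivity
  have hδβ1 : δ * β ≤ β := by nlinarith
  have hp0 : 0 < p := by rw [hp]; exact sub_pos.2 ((_root_.div_lt_one hτ0).2 hσ)
  have hb : 0 ≤ β / τ := by positivity
  have hy0 : 0 ≤ v / τ := by positivity
  have hys : v / τ < σ / τ := div_lt_div_of_pos_right hvσ hτ0
  have hy1 : v / τ ≤ 1 := (_root_.div_le_one hτ0).2 (by linarith)
  have hpU : p ≤ U := by rw [hU, hp]; exact one_sub_le_one_sub_sq hy0 hy1 hys.le
  have h1 : A' * (U * (τ / τ') ^ 2) * (v + δ * β - v) ≤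
      cdfOf (profile A' τ' σ' θ' ς') (v + δ * β) - cdfOf (profile A' τ' σ' θ' ς') v := by
    refine h'.cdf_sub_ge (by linarith) fun x hx1 hx2 => ?_
    rw [eq_right (by linarith) (by linarith)]
    refine mul_le_mul_of_nonneg_left ?_ hA'.le
    have e1 : U * (τ / τ') ^ 2 = (τ ^ 2 - v ^ 2) / τ' ^ 2 := by
      rw [hU]; field_simp
    have e2 : 1 - x ^ 2 / τ' ^ 2 = (τ' ^ 2 - x ^ 2) / τ' ^ 2 := by field_simp
    rw [e1, e2]
    refine div_le_div_of_nonneg_right ?_ (by positivity)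
    have hx3 : x < v + β := by linarith
    have hx4 : x ^ 2 ≤ (v + β) ^ 2 := pow_le_pow_left₀ (by linarith) hx3.le 2
    rw [hτ']
    nlinarith
  have h2 : 1 / (2 * g) * (v / τ - (v / τ) ^ 3 / 3) - 1 / (2 * g') * (v / τ' - (v / τ') ^ 3 / 3) ≤
      U * (β / τ) * (1 / (2 * g') * (v / τ) * (1 + 2 * (β / τ) / p) + 4 * p) := by
    have hττ : τ ≤ τ' := by linarith
    refine rescale_right_le hgh hgg hgd hp0 hpU hU hy0 hy1 (by positivity) (by gcongr) ?_ hb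
    have e : v / τ - v / τ' = v / τ * (β / τ') := by
      rw [hτ']; field_simp; ring
    rw [e]
    gcongr
  have h3 := h.cdf_right_eq hg (by linarith) hv0 hvσ.le
  have h4 := h'.cdf_right_eq hg' (by linarith) hv0 (by linarith)
  have e : A' * (U * (τ / τ') ^ 2) * (v + δ * β - v) =
      U * (β / τ) * (δ * (A' * τ * (τ / τ') ^ 2)) := by
    field_simp; ring
  rw [e] at h1
  rw [h3]
  rw [h4] at h1
  linarith

/-- The gain at a fixed point of the left half when the profile is rescaled. -/
theorem rescale_left_ge {g g' x U r : ℝ} (hg0 : 0 < g) (hgg : g ≤ g') (hg'1 : g' ≤ 2 / 3)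
    (hx0 : 0 ≤ x) (hx1 : x ≤ 1) (hU0 : 0 ≤ U) (hU : U = 1 - x ^ 2) (hr0 : 0 ≤ r) (hr1 : r ≤ 1) :
    3 / 4 * (x * (1 - r) * U) ≤
      1 / (2 * g) * (x - x ^ 3 / 3) - 1 / (2 * g') * (x * r - (x * r) ^ 3 / 3) := by
  have hG0 : 0 ≤ x - x ^ 3 / 3 := by
    have : x ^ 2 ≤ 1 := by nlinarith
    nlinarith
  have h6 : 1 / (2 * g') ≤ 1 / (2 * g) := one_div_le_one_div_of_le (by linarith) (by linarith)
  have h7 : 3 / 4 ≤ 1 / (2 * g') := by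
    rw [le_div_iff₀ (by linarith)]; linarith
  have h8 : x * (1 - r) * U ≤
      (x - x ^ 3 / 3) - (x * (r) - (x * (r)) ^ 3 / 3) := by
    have e : (x - x ^ 3 / 3) - (x * r - (x * r) ^ 3 / 3) - x * (1 - r) * U =
        x ^ 3 * (1 - r) * (2 - r - r ^ 2) / 3 := by rw [hU]; ring
    have h9 : 0 ≤ x ^ 3 * (1 - r) * (2 - r - r ^ 2) :=
      mul_nonneg (mul_nonneg (by positivity) (by linarith)) (by nlinarith)
    linarith
  have h10 : 0 ≤ x * (1 - r) * U :=
    mul_nonneg (mul_nonneg hx0 (by linarith)) hU0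
  calc _ ≤ 1 / (2 * g') * (x * (1 - r) * U) := mul_le_mul_of_nonneg_right h7 h10
    _ ≤ 1 / (2 * g') * ((x - x ^ 3 / 3) - (x * (r) - (x * (r)) ^ 3 / 3)) :=
        mul_le_mul_of_nonneg_left h8 (by linarith)
    _ = 1 / (2 * g') * (x - x ^ 3 / 3)
        - 1 / (2 * g') * (x * (r) - (x * (r)) ^ 3 / 3) := by ring
    _ ≤ _ := sub_le_sub_right (mul_le_mul_of_nonneg_right h6 hG0) _

/-- The increment at a point of the left half, where the shift and the rescaling both raise the
distribution function. -/
theorem increment_left (h : IsProfile A τ σ θ ς) (h' : IsProfile A' τ' σ' θ' ς')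
    {g g' β δ v x U : ℝ} (hg : A * θ * g = 1 / 2) (hg' : A' * θ' * g' = 1 / 2) (hg0 : 0 < g)
    (hgg : g ≤ g') (hg'1 : g' ≤ 2 / 3) (hττ : τ ≤ τ') (hθθ : θ ≤ θ') (hςς : ς ≤ ς')
    (hβ : 0 < β) (hβσ : β < σ') (hδ0 : 0 < δ) (hδ1 : δ < 1) (hv0 : v < 0) (hvς : -ς < v)
    (hx : x = -v / θ) (hU : U = 1 - x ^ 2) (hβτ : β ≤ τ) :
    U * (β / τ) * (δ * (A' * τ * (1 - (β / τ) ^ 2))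
      + x * (3 / 4 * ((θ' - θ) / β) * (τ / θ'))) ≤
      cdfOf (profile A' τ' σ' θ' ς') (v + δ * β) - cdfOf (profile A τ σ θ ς) v := by
  have hτ0 := h.τ_pos
  have hθ0 := h.θ_pos
  have hθ'0 := h'.θ_pos
  have hA' := h'.A_pos
  have hς := h.ς_lt
  have hδβ : 0 < δ * β := by positivity
  have hδβ1 : δ * β ≤ β := by nlinarith
  have hx0 : 0 ≤ x := by rw [hx]; exact _root_.div_nonneg (by linarith) hθ0.le
  have hx1 : x ≤ 1 := by rw [hx, _root_.div_le_one hθ0]; linarith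
  have hU0 : 0 ≤ U := by rw [hU]; exact sub_nonneg.2 (pow_le_one₀ hx0 hx1)
  have hU1 : U ≤ 1 := by rw [hU]; linarith [sq_nonneg x]
  have hb0 : 0 ≤ β / τ := by positivity
  have hb1 : β / τ ≤ 1 := (_root_.div_le_one hτ0).2 hβτ
  have h1 : A' * (U * (1 - (β / τ) ^ 2)) * (v + δ * β - v) ≤
      cdfOf (profile A' τ' σ' θ' ς') (v + δ * β) - cdfOf (profile A' τ' σ' θ' ς') v := by
    refine h'.cdf_sub_ge (by linarith) fun w hw1 hw2 => ?_
    rcases lt_or_ge w 0 with hw | hw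
    · rw [eq_left hw (by linarith)]
      refine mul_le_mul_of_nonneg_left ?_ hA'.le
      have h2 : w ^ 2 / θ' ^ 2 ≤ x ^ 2 := by
        rw [← div_pow, ← neg_sq, ← neg_div, hx]
        refine pow_le_pow_left₀ (_root_.div_nonneg (by linarith) hθ'0.le) ?_ 2
        exact div_le_div₀ (by linarith) (by linarith) hθ0 hθθ
      have h3 : U * (1 - (β / τ) ^ 2) ≤ U := by nlinarith
      linarith
    · rw [eq_right hw (by linarith)]
      refine mul_le_mul_of_nonneg_left ?_ hA'.le
      have h2 : w ^ 2 / τ' ^ 2 ≤ (β / τ) ^ 2 := by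
        rw [← div_pow]
        refine pow_le_pow_left₀ (_root_.div_nonneg hw (by linarith)) ?_ 2
        exact div_le_div₀ hβ.le (by linarith) hτ0 hττ
      have h3 : 0 ≤ 1 - (β / τ) ^ 2 := by nlinarith
      have h4 : U * (1 - (β / τ) ^ 2) ≤ 1 * (1 - (β / τ) ^ 2) :=
        mul_le_mul_of_nonneg_right hU1 h3
      linarith
  have hx' : -v / θ' = x * (θ / θ') := by rw [hx]; field_simp
  have hr1 : θ / θ' ≤ 1 := (_root_.div_le_one hθ'0).2 hθθ
  have hr0 : 0 ≤ θ / θ' := by positivity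
  have h3 := h.cdf_left_eq hg hg0 hv0.le hvς.le
  have h4 := h'.cdf_left_eq hg' (by linarith) hv0.le (by linarith)
  rw [← hx] at h3
  rw [hx'] at h4
  have h5 : 3 / 4 * (x * (1 - θ / θ') * U) ≤
      1 / (2 * g) * (x - x ^ 3 / 3) - 1 / (2 * g') * (x * (θ / θ') - (x * (θ / θ')) ^ 3 / 3) :=
    rescale_left_ge hg0 hgg hg'1 hx0 hx1 hU0 hU hr0 hr1
  have e1 : A' * (U * (1 - (β / τ) ^ 2)) * (v + δ * β - v) =
      U * (β / τ) * (δ * (A' * τ * (1 - (β / τ) ^ 2))) := by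
    field_simp; ring
  have e2 : 3 / 4 * (x * (1 - θ / θ') * U) =
      U * (β / τ) * (x * (3 / 4 * ((θ' - θ) / β) * (τ / θ'))) := by
    field_simp
  rw [e1, h4] at h1
  rw [e2] at h5
  rw [h3]
  linarith

/-- Beyond the right edge of the first profile the increment is minus the mass that the second one
has to the right of `v + δ β`. -/
theorem increment_edge (h : IsProfile A τ σ θ ς) (h' : IsProfile A' τ' σ' θ' ς')
    {p β δ v : ℝ} (hp : p = 1 - σ / τ) (hτ' : τ' = τ + β) (hβ : 0 < β) (hσσ : σ' - σ ≤ β)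
    (hδ0 : 0 < δ) (hvσ : σ ≤ v) (hvσ' : v + δ * β < σ') :
    -(A' * (2 * (p + β / τ)) * β) ≤
      cdfOf (profile A' τ' σ' θ' ς') (v + δ * β) - cdfOf (profile A τ σ θ ς) v := by
  have hτ0 := h.τ_pos
  have hτ'0 := h'.τ_pos
  have hA' := h'.A_pos
  have hσ := h.σ_lt
  have hσ0 := h.σ_pos
  have hδβ : 0 < δ * β := by positivity
  have hp0 : 0 < p := by rw [hp]; exact sub_pos.2 ((div_lt_one hτ0).2 hσ)
  rw [h.cdf_eq_one hvσ, ← h'.cdf_eq_one le_rfl]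
  have h1 := h'.cdf_sub_le (a := v + δ * β) (b := σ') (m := A' * (2 * (p + β / τ))) hvσ'.le ?_
  · have h2 : A' * (2 * (p + β / τ)) * (σ' - (v + δ * β)) ≤ A' * (2 * (p + β / τ)) * β :=
      mul_le_mul_of_nonneg_left (by linarith) (by positivity)
    linarith
  · intro x hx1 hx2
    rw [eq_right (by linarith) hx2, ← div_pow]
    refine mul_le_mul_of_nonneg_left ?_ hA'.le
    have h3 : σ / τ' ≤ x / τ' := div_le_div_of_nonneg_right (by linarith) hτ'0.le
    have h4 : 0 ≤ σ / τ' := by positivity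
    have h5 : 1 - σ / τ' ≤ p + β / τ := by
      have e : 1 - σ / τ' = (p * τ + β) / τ' := by
        rw [hp, hτ']; field_simp; ring
      have e' : p + β / τ = (p * τ + β) / τ := by field_simp
      rw [e, e']
      exact div_le_div_of_nonneg_left (by positivity) hτ0 (by linarith)
    nlinarith [sq_nonneg (1 - x / τ')]

end IsProfile

/-! ### The densities `ψ_n` as profiles -/

theorem sub_rpow_eq {r t : ℝ} (ht : 0 < t) : t - t ^ r = t * (1 - t ^ (r - 1)) := by
  rw [Real.rpow_sub_one ht.ne']
  field_simp

theorem cubic_eq {r t : ℝ} (ht : 0 < t) :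
    t ^ 2 * (t - t ^ r) - (t - t ^ r) ^ 3 / 3 = t ^ 3 * parMass r t := by
  rw [sub_rpow_eq ht]
  unfold parMass
  ring

theorem cubic_div_eq {r t : ℝ} (ht : 0 < t) :
    (t - t ^ r) - (t - t ^ r) ^ 3 / (3 * t ^ 2) = t * parMass r t := by
  rw [sub_rpow_eq ht]
  unfold parMass
  field_simp

theorem one_sub_cutoff_div {r t : ℝ} (ht : 0 < t) : 1 - (t - t ^ r) / t = t ^ (r - 1) := by
  rw [sub_rpow_eq ht, mul_div_cancel_left₀ _ ht.ne']
  ring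

/-- The value of `ψ_n` at the origin. -/
noncomputable def amp (c ϱ : ℝ) (n : ℕ) : ℝ := aCoef c ϱ n * tau c n ^ 2

section Profile

variable {c ϱ ϱ' : ℝ} {n : ℕ}

theorem amp_mul_right (hϱ1 : ϱ < 1) (hτ : 1 < tau c n) :
    amp c ϱ n * tau c n * parMass ϱ (tau c n) = 1 / 2 := by
  have h0 : 0 < tau c n := by linarith
  have hg := parMass_pos hϱ1 hτ
  unfold amp aCoef sigma
  rw [cubic_eq h0]
  field_simp

theorem tauTilde_spec (hϱ1 : ϱ < 1) (hϱ'1 : ϱ' < 1) (hτ : 1 < tau c n) :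
    IsTauTilde c ϱ ϱ' n (tauTilde c ϱ ϱ' n) := by
  have h := (existsUnique_isTauTilde hϱ1 hϱ'1 hτ).exists
  unfold tauTilde
  rw [dif_pos h]
  exact h.choose_spec

/-- The relation defining `τ̃_n` says that both halves of `ψ_n` have the same mass. -/
theorem tauTilde_mul_parMass (hϱ1 : ϱ < 1) (hϱ'1 : ϱ' < 1) (hτ : 1 < tau c n) :
    tauTilde c ϱ ϱ' n * parMass ϱ' (tauTilde c ϱ ϱ' n) = tau c n * parMass ϱ (tau c n) := by
  obtain ⟨h1, h2⟩ := tauTilde_spec hϱ1 hϱ'1 hτ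
  set θ := tauTilde c ϱ ϱ' n with hθ
  have hθ0 : 0 < θ := by linarith
  have hτ0 : 0 < tau c n := by linarith
  have hg := parMass_pos hϱ1 hτ
  have hγ := parMass_pos hϱ'1 h1
  unfold sigma at h2
  rw [cubic_eq hθ0, cubic_eq hτ0, div_eq_div_iff (by positivity) (by positivity)] at h2
  have h3 : θ ^ 2 * tau c n ^ 2 * (θ * parMass ϱ' θ) =
      θ ^ 2 * tau c n ^ 2 * (tau c n * parMass ϱ (tau c n)) := by linarith
  exact mul_left_cancel₀ (by positivity) h3

theorem one_lt_tauTilde (hϱ1 : ϱ < 1) (hϱ'1 : ϱ' < 1) (hτ : 1 < tau c n) :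
    1 < tauTilde c ϱ ϱ' n := (tauTilde_spec hϱ1 hϱ'1 hτ).1

theorem amp_mul_left (hϱ1 : ϱ < 1) (hϱ'1 : ϱ' < 1) (hτ : 1 < tau c n) :
    amp c ϱ n * tauTilde c ϱ ϱ' n * parMass ϱ' (tauTilde c ϱ ϱ' n) = 1 / 2 := by
  rw [mul_assoc, tauTilde_mul_parMass hϱ1 hϱ'1 hτ, ← mul_assoc, amp_mul_right hϱ1 hτ]

theorem cutoff_mem {r t : ℝ} (hr : r < 1) (ht : 1 < t) : 0 < t - t ^ r ∧ t - t ^ r < t := by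
  have h0 : 0 < t := by linarith
  obtain ⟨h1, h2⟩ := rpow_sub_one_pos_lt_one hr ht
  refine ⟨?_, by linarith [Real.rpow_pos_of_pos h0 r]⟩
  rw [sub_rpow_eq h0]
  exact mul_pos h0 (by linarith)

theorem isProfile_psi (hϱ1 : ϱ < 1) (hϱ'1 : ϱ' < 1) (hτ : 1 < tau c n) :
    IsProfile (amp c ϱ n) (tau c n) (sigma c ϱ n) (tauTilde c ϱ ϱ' n) (sigmaTilde c ϱ ϱ' n) := by
  have hθ := one_lt_tauTilde hϱ1 hϱ'1 hτ
  have h1 := amp_mul_right hϱ1 hτ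
  have hg := parMass_pos hϱ1 hτ
  have hτ0 : 0 < tau c n := by linarith
  refine ⟨?_, (cutoff_mem hϱ1 hτ).1, (cutoff_mem hϱ1 hτ).2, (cutoff_mem hϱ'1 hθ).1,
    (cutoff_mem hϱ'1 hθ).2, ?_, ?_⟩
  · by_contra! h
    have : amp c ϱ n * tau c n * parMass ϱ (tau c n) ≤ 0 := by
      rw [mul_assoc]
      exact mul_nonpos_of_nonpos_of_nonneg h (by positivity)
    linarith
  · unfold sigma
    rw [cubic_div_eq hτ0, ← mul_assoc, h1]
  · unfold sigmaTilde
    rw [cubic_div_eq (by linarith), ← mul_assoc, amp_mul_left hϱ1 hϱ'1 hτ]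

theorem psi_eq_profile (hϱ1 : ϱ < 1) (hϱ'1 : ϱ' < 1) (hτ : 1 < tau c n) :
    psi c ϱ ϱ' n = profile (amp c ϱ n) (tau c n) (sigma c ϱ n) (tauTilde c ϱ ϱ' n)
      (sigmaTilde c ϱ ϱ' n) := by
  have hθ := one_lt_tauTilde hϱ1 hϱ'1 hτ
  have hθ0 : 0 < tauTilde c ϱ ϱ' n := by linarith
  have hτ0 : 0 < tau c n := by linarith
  funext v
  unfold psi profile phi phiTilde amp aTilde
  split_ifs with h0 h1 h2 h3 h4 h5 h6
  · field_simp
  · exact absurd (by rwa [abs_of_nonneg h0] at h1) h2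
  · exact absurd (by rwa [abs_of_nonneg h0]) h1
  · rfl
  · field_simp
  · rw [abs_of_neg (not_le.1 h0)] at h4
    exact absurd (by linarith) h5
  · rw [abs_of_neg (not_le.1 h0)] at h4
    exact absurd (by linarith) h4
  · rfl

theorem tau_lt_tau_succ (hc : 0 < c) : tau c n < tau c (n + 1) := by
  unfold tau
  refine Real.rpow_lt_rpow (by positivity) ?_ (by norm_num)
  push_cast
  nlinarith

theorem mul_parMass_lt {r t u : ℝ} (hr : r < 1) (ht : 1 < t) (htu : t < u) :
    t * parMass r t < u * parMass r u :=
  mul_lt_mul htu (parMass_mono hr ht htu.le) (parMass_pos hr ht) (by linarith)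

theorem tauTilde_le_succ (hc : 0 < c) (hϱ1 : ϱ < 1) (hϱ'1 : ϱ' < 1) (hτ : 1 < tau c n) :
    tauTilde c ϱ ϱ' n ≤ tauTilde c ϱ ϱ' (n + 1) := by
  have hlt := tau_lt_tau_succ (n := n) hc
  have hτ' := hτ.trans hlt
  by_contra! h
  have h1 := mul_parMass_lt hϱ'1 (one_lt_tauTilde hϱ1 hϱ'1 hτ') h
  rw [tauTilde_mul_parMass hϱ1 hϱ'1 hτ, tauTilde_mul_parMass hϱ1 hϱ'1 hτ'] at h1
  exact absurd (mul_parMass_lt hϱ1 hτ hlt) h1.not_gt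

theorem cutoff_mono {r t u : ℝ} (hr : r < 1) (ht : 1 < t) (htu : t ≤ u) :
    t - t ^ r ≤ u - u ^ r := by
  have h4 : u ^ (r - 1) ≤ t ^ (r - 1) :=
    Real.rpow_le_rpow_of_nonpos (by linarith) htu (by linarith)
  have := (rpow_sub_one_pos_lt_one hr ht).2
  rw [sub_rpow_eq (by linarith : 0 < t), sub_rpow_eq (by linarith : 0 < u)]
  exact mul_le_mul htu (by linarith) (by linarith) (by linarith)

theorem sigma_succ_sub_le (hc : 0 < c) (hϱ0 : 0 < ϱ) (hτ : 1 < tau c n) :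
    sigma c ϱ (n + 1) - sigma c ϱ n ≤ beta c n := by
  have h := Real.rpow_le_rpow (by linarith : 0 ≤ tau c n) (tau_lt_tau_succ (n := n) hc).le hϱ0.le
  unfold sigma beta
  linarith

/-- The increments of `τ̃_n` are asymptotically at least those of `τ_n`. -/
theorem beta_mul_le (hc : 0 < c) (hϱ1 : ϱ < 1) (hϱ'0 : 0 ≤ ϱ') (hϱ'1 : ϱ' < 1)
    (hτ : 1 < tau c n) :
    beta c n * parMass ϱ (tau c n) ≤ (2 / 3 + 2 * (tauTilde c ϱ ϱ' n ^ (ϱ' - 1)) ^ 2) *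
      (tauTilde c ϱ ϱ' (n + 1) - tauTilde c ϱ ϱ' n) := by
  have hlt := tau_lt_tau_succ (n := n) hc
  have hτ' := hτ.trans hlt
  have h1 := tauTilde_mul_parMass (ϱ' := ϱ') hϱ1 hϱ'1 hτ
  have h2 := tauTilde_mul_parMass (ϱ' := ϱ') hϱ1 hϱ'1 hτ'
  have h3 := tauTilde_le_succ hc hϱ1 hϱ'1 hτ (ϱ' := ϱ')
  have h4 := parMass_sub_le hϱ'0 hϱ'1 (one_lt_tauTilde hϱ1 hϱ'1 hτ) h3
  have h5 := parMass_le hϱ'1 (one_lt_tauTilde hϱ1 hϱ'1 hτ')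
  have h6 := parMass_mono hϱ1 hτ hlt.le
  have h7 := mul_le_mul_of_nonneg_left h6 (by linarith : 0 ≤ tau c (n + 1))
  have h8 := mul_le_mul_of_nonneg_left h5 (sub_nonneg.2 h3)
  unfold beta
  linarith

end Profile

/-! ### Asymptotics of the sequences -/

section Asymptotics

variable {c ϱ ϱ' : ℝ}

theorem tau_cube (hc : 0 < c) (n : ℕ) : tau c n ^ 3 = c * n := by
  unfold tau
  rw [← Real.rpow_natCast, ← Real.rpow_mul (by positivity)]
  norm_num

theorem tendsto_tau (hc : 0 < c) : Tendsto (tau c) atTop atTop :=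
  (tendsto_rpow_atTop (by norm_num)).comp
    (tendsto_natCast_atTop_atTop.const_mul_atTop hc)

theorem beta_pos (hc : 0 < c) (n : ℕ) : 0 < beta c n := sub_pos.2 (tau_lt_tau_succ hc)

theorem beta_mul_sq_le (hc : 0 < c) (n : ℕ) : beta c n * tau c n ^ 2 ≤ c / 3 := by
  have h1 := tau_cube hc n
  have h2 := tau_cube hc (n + 1)
  have h3 := tau_lt_tau_succ (n := n) hc
  have h4 : 0 ≤ tau c n := Real.rpow_nonneg (by positivity) _
  push_cast at h2
  have h5 : c = (tau c (n + 1) - tau c n) *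
      (tau c (n + 1) ^ 2 + tau c (n + 1) * tau c n + tau c n ^ 2) := by
    linear_combination h1 - h2
  have h6 : 3 * tau c n ^ 2 ≤
      tau c (n + 1) ^ 2 + tau c (n + 1) * tau c n + tau c n ^ 2 := by nlinarith
  have h7 := mul_le_mul_of_nonneg_left h6 (sub_nonneg.2 h3.le)
  unfold beta
  linarith

theorem tendsto_beta (hc : 0 < c) : Tendsto (beta c) atTop (𝓝 0) := by
  have h1 : Tendsto (fun n => c / 3 * (tau c n ^ 2)⁻¹) atTop (𝓝 (c / 3 * 0)) :=
    (((tendsto_pow_atTop two_ne_zero).comp (tendsto_tau hc)).inv_tendsto_atTop).const_mul _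
  rw [mul_zero] at h1
  refine squeeze_zero' (Eventually.of_forall fun n => (beta_pos hc n).le) ?_ h1
  filter_upwards [(tendsto_tau hc).eventually_gt_atTop 0] with n hn
  rw [← div_eq_mul_inv, le_div_iff₀ (by positivity)]
  exact beta_mul_sq_le hc n

theorem tendsto_beta_div_tau (hc : 0 < c) : Tendsto (fun n => beta c n / tau c n) atTop (𝓝 0) :=
  (tendsto_beta hc).div_atTop (tendsto_tau hc)

theorem tendsto_tau_div_succ (hc : 0 < c) :
    Tendsto (fun n => tau c n / tau c (n + 1)) atTop (𝓝 1) := by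
  have h1 : Tendsto (fun n => (1 + beta c n / tau c n)⁻¹) atTop (𝓝 (1 + 0)⁻¹) :=
    (tendsto_const_nhds.add (tendsto_beta_div_tau hc)).inv₀ (by norm_num)
  rw [add_zero, inv_one] at h1
  refine h1.congr' ?_
  filter_upwards [(tendsto_tau hc).eventually_gt_atTop 0] with n hn
  have h2 : 0 < tau c (n + 1) := hn.trans (tau_lt_tau_succ hc)
  have h3 : 1 + beta c n / tau c n = tau c (n + 1) / tau c n := by
    unfold beta; field_simp; ring
  rw [h3, inv_div]

theorem tendsto_beta_mul_sq (hc : 0 < c) :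
    Tendsto (fun n => beta c n * tau c n ^ 2) atTop (𝓝 (c / 3)) := by
  have hb := tendsto_beta_div_tau hc
  have h1 : Tendsto (fun n => c / (3 + 3 * (beta c n / tau c n) + (beta c n / tau c n) ^ 2)) atTop
      (𝓝 (c / (3 + 3 * 0 + 0 ^ 2))) :=
    Tendsto.div tendsto_const_nhds
      ((tendsto_const_nhds.add (hb.const_mul 3)).add (hb.pow 2)) (by norm_num)
  have e : c / (3 + 3 * 0 + 0 ^ 2) = c / 3 := by norm_num
  rw [e] at h1
  refine h1.congr' ?_
  filter_upwards [(tendsto_tau hc).eventually_gt_atTop 0] with n hn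
  have hβ := beta_pos hc n
  have h2 := tau_cube hc n
  have h3 := tau_cube hc (n + 1)
  push_cast at h3
  have h4 : tau c (n + 1) = tau c n + beta c n := by unfold beta; ring
  rw [h4] at h3
  rw [div_eq_iff (by positivity)]
  field_simp
  linear_combination h2 - h3

theorem tendsto_rpow_sub_one (hϱ1 : ϱ < 1) {u : ℕ → ℝ} (hu : Tendsto u atTop atTop) :
    Tendsto (fun n => u n ^ (ϱ - 1)) atTop (𝓝 0) := by
  have h := (tendsto_rpow_neg_atTop (by linarith : 0 < 1 - ϱ)).comp hu
  simpa [Function.comp_def] using h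

theorem amp_mul_tau (hϱ1 : ϱ < 1) {n : ℕ} (hτ : 1 < tau c n) :
    amp c ϱ n * tau c n = 1 / (2 * parMass ϱ (tau c n)) := by
  have h1 := amp_mul_right hϱ1 hτ
  have h2 := parMass_pos hϱ1 hτ
  rw [eq_div_iff (by positivity)]
  linarith

theorem tendsto_inv_two_parMass (hϱ1 : ϱ < 1) (hc : 0 < c) :
    Tendsto (fun n => 1 / (2 * parMass ϱ (tau c n))) atTop (𝓝 (3 / 4)) := by
  have h1 : Tendsto (fun n => 1 / (2 * parMass ϱ (tau c n))) atTop (𝓝 (1 / (2 * (2 / 3)))) :=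
    tendsto_const_nhds.div (((tendsto_parMass hϱ1).comp (tendsto_tau hc)).const_mul 2) (by norm_num)
  norm_num at h1 ⊢
  exact h1

theorem tendsto_amp_mul_tau (hϱ1 : ϱ < 1) (hc : 0 < c) :
    Tendsto (fun n => amp c ϱ n * tau c n) atTop (𝓝 (3 / 4)) := by
  refine (tendsto_inv_two_parMass hϱ1 hc).congr' ?_
  filter_upwards [(tendsto_tau hc).eventually_gt_atTop 1] with n hn
  rw [amp_mul_tau hϱ1 hn]

theorem tendsto_amp_succ_mul_tau (hϱ1 : ϱ < 1) (hc : 0 < c) :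
    Tendsto (fun n => amp c ϱ (n + 1) * tau c n) atTop (𝓝 (3 / 4)) := by
  have h := ((tendsto_amp_mul_tau hϱ1 hc).comp (tendsto_add_atTop_nat 1)).mul
    (tendsto_tau_div_succ hc)
  rw [mul_one] at h
  refine h.congr' ?_
  filter_upwards [(tendsto_tau hc).eventually_gt_atTop 0] with n hn
  have h2 : 0 < tau c (n + 1) := hn.trans (tau_lt_tau_succ hc)
  simp only [Function.comp_apply]
  field_simp

theorem tendsto_tauTilde (hϱ1 : ϱ < 1) (hϱ'1 : ϱ' < 1) (hc : 0 < c) :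
    Tendsto (tauTilde c ϱ ϱ') atTop atTop := by
  have h1 := (tendsto_tau hc).const_mul_atTop (by norm_num : (0 : ℝ) < 3 / 4)
  refine tendsto_atTop_mono' _ ?_ h1
  filter_upwards [(tendsto_tau hc).eventually_gt_atTop 1,
    ((tendsto_parMass hϱ1).comp (tendsto_tau hc)).eventually
      (lt_mem_nhds (by norm_num : (1 : ℝ) / 2 < 2 / 3))] with n hn hg
  have h2 := tauTilde_mul_parMass hϱ1 hϱ'1 hn (ϱ' := ϱ')
  have h3 := one_lt_tauTilde hϱ1 hϱ'1 hn
  have h4 := parMass_le hϱ'1 h3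
  simp only [Function.comp_apply] at hg
  nlinarith

theorem tendsto_tau_div_tauTilde (hϱ1 : ϱ < 1) (hϱ'1 : ϱ' < 1) (hc : 0 < c) :
    Tendsto (fun n => tau c n / tauTilde c ϱ ϱ' n) atTop (𝓝 1) := by
  have h := ((tendsto_parMass hϱ'1).comp (tendsto_tauTilde hϱ1 hϱ'1 hc)).div
    ((tendsto_parMass hϱ1).comp (tendsto_tau hc)) (by norm_num)
  rw [div_self (by norm_num)] at h
  refine h.congr' ?_
  filter_upwards [(tendsto_tau hc).eventually_gt_atTop 1] with n hn
  have h2 := tauTilde_mul_parMass hϱ1 hϱ'1 hn (ϱ' := ϱ')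
  have h3 := one_lt_tauTilde hϱ1 hϱ'1 hn
  have h4 := parMass_pos hϱ1 hn
  simp only [Function.comp_apply, Pi.div_apply]
  rw [div_eq_div_iff h4.ne' (by linarith)]
  linarith

theorem tendsto_tau_div_tauTilde_succ (hϱ1 : ϱ < 1) (hϱ'1 : ϱ' < 1) (hc : 0 < c) :
    Tendsto (fun n => tau c n / tauTilde c ϱ ϱ' (n + 1)) atTop (𝓝 1) := by
  have h := (tendsto_tau_div_succ hc).mul
    ((tendsto_tau_div_tauTilde hϱ1 hϱ'1 hc).comp (tendsto_add_atTop_nat 1))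
  rw [mul_one] at h
  refine h.congr' ?_
  filter_upwards [(tendsto_tau hc).eventually_gt_atTop 0] with n hn
  have h2 : 0 < tau c (n + 1) := hn.trans (tau_lt_tau_succ hc)
  simp only [Function.comp_apply]
  field_simp

/-- The drift coefficient: this is where the constant in `τ_n` is tuned. -/
theorem tendsto_drift (hϱ1 : ϱ < 1) (hc : 0 < c) :
    Tendsto (fun n => amp c ϱ n ^ 2 / beta c n * (4 / 9 * c)) atTop (𝓝 (3 / 4)) := by
  have h := (((tendsto_amp_mul_tau hϱ1 hc).pow 2).div (tendsto_beta_mul_sq hc)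
    (by positivity)).mul_const (4 / 9 * c)
  have e : (3 / 4 : ℝ) ^ 2 / (c / 3) * (4 / 9 * c) = 3 / 4 := by field_simp; norm_num
  rw [e] at h
  refine h.congr' ?_
  filter_upwards [(tendsto_tau hc).eventually_gt_atTop 0] with n hn
  have := beta_pos hc n
  simp only [Pi.div_apply]
  field_simp

theorem tendsto_sigma (hϱ1 : ϱ < 1) (hc : 0 < c) : Tendsto (sigma c ϱ) atTop atTop := by
  have h1 := (tendsto_tau hc).const_mul_atTop (by norm_num : (0 : ℝ) < 1 / 2)
  refine tendsto_atTop_mono' _ ?_ h1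
  filter_upwards [(tendsto_tau hc).eventually_gt_atTop 1,
    (tendsto_rpow_sub_one hϱ1 (tendsto_tau hc)).eventually
      (gt_mem_nhds (by norm_num : (0 : ℝ) < 1 / 2))] with n hn hp
  unfold sigma
  rw [sub_rpow_eq (by linarith)]
  nlinarith

/-- Powers of `τ̃_n` of order below `-(1 + 3κ)` are negligible, after multiplication with
`ψ_n(0)²`, against the increments of `q_n`. -/
theorem tendsto_negligible (hϱ1 : ϱ < 1) (hϱ'1 : ϱ' < 1) (hc : 0 < c) {κ s : ℝ}
    (hs : 1 + 3 * κ < s) :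
    Tendsto (fun n : ℕ => amp c ϱ n ^ 2 * tauTilde c ϱ ϱ' n ^ (-s) * (n : ℝ) ^ (κ + 1)) atTop
      (𝓝 0) := by
  have h1 : Tendsto (fun n => tau c n ^ (-(s - 1 - 3 * κ))) atTop (𝓝 0) :=
    (tendsto_rpow_neg_atTop (by linarith)).comp (tendsto_tau hc)
  have h2 : Tendsto (fun n => (tau c n / tauTilde c ϱ ϱ' n) ^ s) atTop (𝓝 (1 ^ s)) :=
    (tendsto_tau_div_tauTilde hϱ1 hϱ'1 hc).rpow_const (Or.inl one_ne_zero)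
  have h3 := ((((tendsto_amp_mul_tau hϱ1 hc).pow 2).mul h2).mul h1).mul_const (c ^ (-(κ + 1)))
  rw [mul_zero, zero_mul] at h3
  refine h3.congr' ?_
  filter_upwards [(tendsto_tau hc).eventually_gt_atTop 1, eventually_gt_atTop 0] with n hn hn0
  have hτ : 0 < tau c n := by linarith
  have hθ : 0 < tauTilde c ϱ ϱ' n := by linarith [one_lt_tauTilde hϱ1 hϱ'1 hn (ϱ' := ϱ')]
  have e1 : (n : ℝ) ^ (κ + 1) = tau c n ^ (3 * (κ + 1)) * c ^ (-(κ + 1)) := by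
    have h4 : (n : ℝ) = tau c n ^ 3 * c⁻¹ := by rw [tau_cube hc]; field_simp
    rw [h4, Real.mul_rpow (by positivity) (by positivity), ← Real.rpow_natCast,
      ← Real.rpow_mul hτ.le, Real.inv_rpow hc.le, Real.rpow_neg hc.le]
    norm_num
  rw [e1, Real.div_rpow hτ.le hθ.le, Real.rpow_neg hθ.le]
  have e2 : tau c n ^ 2 * tau c n ^ s * tau c n ^ (-(s - 1 - 3 * κ)) =
      tau c n ^ (3 * (κ + 1)) := by
    rw [← Real.rpow_two, ← Real.rpow_add hτ, ← Real.rpow_add hτ]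
    congr 1
    ring
  rw [← e2]
  field_simp

theorem tendsto_qSeq {δ₁ κ : ℝ} (hκ : 0 < κ) : Tendsto (qSeq δ₁ κ) atTop (𝓝 δ₁) := by
  have h1 : Tendsto (fun n : ℕ => (n : ℝ) ^ (-κ)) atTop (𝓝 0) :=
    (tendsto_rpow_neg_atTop hκ).comp tendsto_natCast_atTop_atTop
  have h2 : Tendsto (fun n : ℕ => δ₁ * (1 - (n : ℝ) ^ (-κ))) atTop (𝓝 (δ₁ * (1 - 0))) :=
    (tendsto_const_nhds.sub h1).const_mul δ₁
  rw [sub_zero, mul_one] at h2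
  exact h2

theorem tendsto_weight {δ₁ κ : ℝ} (hκ : 0 < κ) (hδ₁ : δ₁ < 1) :
    Tendsto (fun n => (1 - qSeq δ₁ κ (n + 1)) / (1 - qSeq δ₁ κ n) ^ 2) atTop
      (𝓝 (1 / (1 - δ₁))) := by
  have h0 : 1 - δ₁ ≠ 0 := by linarith
  have h1 : Tendsto (fun n => 1 - qSeq δ₁ κ n) atTop (𝓝 (1 - δ₁)) :=
    tendsto_const_nhds.sub (tendsto_qSeq hκ)
  have h2 := (h1.comp (tendsto_add_atTop_nat 1)).div (h1.pow 2) (pow_ne_zero 2 h0)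
  have e : (1 - δ₁) / (1 - δ₁) ^ 2 = 1 / (1 - δ₁) := by field_simp
  rw [e] at h2
  exact h2

theorem qSeq_succ_sub_ge {δ₁ κ : ℝ} (hκ : 0 < κ) (hκ1 : κ ≤ 1) (hδ₁ : 0 < δ₁) {n : ℕ}
    (hn : 0 < n) :
    δ₁ * κ / 2 * ((n : ℝ) ^ (κ + 1))⁻¹ ≤ qSeq δ₁ κ (n + 1) - qSeq δ₁ κ n := by
  have hn0 : (1 : ℝ) ≤ n := by exact_mod_cast hn
  have hnp : (0 : ℝ) < n := by linarith
  unfold qSeq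
  push_cast
  have h1 : ((n : ℝ) + 1) ^ (-κ) ≤ (n : ℝ) ^ (-κ) * (1 - κ / (n + 1)) := by
    have h2 : ((n : ℝ) / (n + 1)) ^ κ ≤ 1 - κ / (n + 1) := by
      have h3 := rpow_one_add_le_one_add_mul_self (s := -(1 / ((n : ℝ) + 1)))
        (by rw [neg_le_neg_iff, div_le_one (by positivity)]; linarith) hκ.le hκ1
      have e1 : 1 + -(1 / ((n : ℝ) + 1)) = n / (n + 1) := by field_simp; ring
      rw [e1] at h3
      refine h3.trans (le_of_eq ?_)
      ring
    have e2 : ((n : ℝ) + 1) ^ (-κ) = (n : ℝ) ^ (-κ) * ((n : ℝ) / (n + 1)) ^ κ := by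
      rw [Real.div_rpow hnp.le (by positivity), Real.rpow_neg (by positivity),
        Real.rpow_neg hnp.le]
      have : (0 : ℝ) < (n : ℝ) ^ κ := by positivity
      field_simp
    rw [e2]
    gcongr
  have h4 : κ / 2 * ((n : ℝ) ^ (κ + 1))⁻¹ ≤ (n : ℝ) ^ (-κ) * (κ / (n + 1)) := by
    rw [Real.rpow_add_one hnp.ne', Real.rpow_neg hnp.le, mul_inv]
    have h5 : (n : ℝ)⁻¹ / 2 ≤ 1 / (n + 1) := by
      rw [← one_div, div_div, one_div_le_one_div (by positivity) (by positivity)]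
      linarith
    have h6 : 0 ≤ κ * ((n : ℝ) ^ κ)⁻¹ := by positivity
    have h7 := mul_le_mul_of_nonneg_left h5 h6
    calc _ = κ * ((n : ℝ) ^ κ)⁻¹ * ((n : ℝ)⁻¹ / 2) := by ring
      _ ≤ _ := h7
      _ = _ := by ring
  have h8 : κ / 2 * ((n : ℝ) ^ (κ + 1))⁻¹ ≤ (n : ℝ) ^ (-κ) - ((n : ℝ) + 1) ^ (-κ) := by linarith
  have h9 := mul_le_mul_of_nonneg_left h8 hδ₁.le
  linarith

end Asymptotics

/-! ### The Lambda condition in the four ranges of `v` -/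

section Ranges

variable {Ω : Type*} [MeasurableSpace Ω] {P : Measure Ω} [IsProbabilityMeasure P]
  {F : Ω → ℝ → ℝ → ℝ} {η c : ℝ} {e : Ω → ℝ} {S : Ω × ℝ → ℝ} {ϱ ϱ' κ δ δ₁ : ℝ}

/-- A function that is affine in `y ∈ [0, 1]` is nonnegative if it is so at both ends. -/
theorem affine_nonneg {a b y : ℝ} (hy0 : 0 ≤ y) (hy1 : y ≤ 1) (h0 : 0 ≤ a) (h1 : 0 ≤ a + b) :
    0 ≤ a + y * b := by
  nlinarith [mul_nonneg hy0 h1, mul_nonneg (sub_nonneg.2 hy1) h0]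

theorem moment_nonneg (P : Measure Ω) [IsProbabilityMeasure P] (hS : ∀ p, 0 ≤ S p) :
    0 ≤ ∫ p, (p.2 ^ (1 + η) * S p + S p ^ (2 + η)) ∂(prodIoi P) := by
  refine integral_nonneg_of_ae ?_
  filter_upwards [ae_snd_pos P] with p hp
  exact add_nonneg (mul_nonneg (Real.rpow_nonneg hp.le _) (hS p)) (Real.rpow_nonneg (hS p) _)

/-- On the right half, the drift and the increment cancel to leading order; what is left is the
gain `δ - δ₁ y` produced by the shift `δ β_n` and by the weight `1 / (1 - δ₁)`. -/
theorem eventually_nonneg_right (hM : IsModel P F η c e S) (hη : 0 < η) (hη1 : η ≤ 1)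
    (hϱ0 : 0 < ϱ) (hϱ1 : ϱ < 1) (hϱ'1 : ϱ' < 1) (hκ : 0 < κ) (hδ0 : 0 < δ) (hδ1 : δ < 1)
    (hδ₁0 : 0 < δ₁) (hδ₁ : δ₁ < δ) :
    ∀ᶠ n in atTop, ∀ v, 0 ≤ v → v < sigma c ϱ n → v + δ * beta c n < sigma c ϱ (n + 1) →
      0 ≤ (∫ ω, Lam (psi c ϱ ϱ' n) (F ω) v ∂P)
        + (1 - qSeq δ₁ κ (n + 1)) / (1 - qSeq δ₁ κ n) ^ 2
            * (cdfOf (psi c ϱ ϱ' (n + 1)) (v + δ * beta c n) - cdfOf (psi c ϱ ϱ' n) v) := by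
  have hc := hM.pos
  set M := ∫ p, (p.2 ^ (1 + η) * S p + S p ^ (2 + η)) ∂(prodIoi P) with hMdef
  have hM0 : 0 ≤ M := moment_nonneg P hM.nonneg
  have hδ₁1 : 0 < 1 - δ₁ := by linarith
  set a : ℕ → ℝ := fun n => amp c ϱ n ^ 2 / beta c n * (4 / 9 * c) with ha
  set b : ℕ → ℝ := fun n => 270 * M / c * (a n * (tau c n ^ ϱ) ^ (-η)) with hb
  set w : ℕ → ℝ := fun n => (1 - qSeq δ₁ κ (n + 1)) / (1 - qSeq δ₁ κ n) ^ 2 with hw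
  set d : ℕ → ℝ := fun n => amp c ϱ (n + 1) * tau c n * (tau c n / tau c (n + 1)) ^ 2 with hd
  set f : ℕ → ℝ := fun n => 1 / (2 * parMass ϱ (tau c (n + 1))) *
    (1 + 2 * (beta c n / tau c n) / tau c n ^ (ϱ - 1)) with hf
  have hpt : Tendsto (fun n => tau c n ^ ϱ) atTop atTop :=
    (tendsto_rpow_atTop hϱ0).comp (tendsto_tau hc)
  have la : Tendsto a atTop (𝓝 (3 / 4)) := tendsto_drift hϱ1 hc
  have lb : Tendsto b atTop (𝓝 0) := by
    have h1 : Tendsto (fun n => (tau c n ^ ϱ) ^ (-η)) atTop (𝓝 0) :=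
      (tendsto_rpow_neg_atTop hη).comp hpt
    have h2 := (la.mul h1).const_mul (270 * M / c)
    rw [mul_zero, mul_zero] at h2
    exact h2
  have lw : Tendsto w atTop (𝓝 (1 / (1 - δ₁))) := tendsto_weight hκ (by linarith)
  have ld : Tendsto d atTop (𝓝 (3 / 4)) := by
    have := (tendsto_amp_succ_mul_tau hϱ1 hc).mul ((tendsto_tau_div_succ hc).pow 2)
    simpa using this
  have lf : Tendsto f atTop (𝓝 (3 / 4)) := by
    have h1 := (tendsto_inv_two_parMass hϱ1 hc).comp (tendsto_add_atTop_nat 1)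
    have h2 : Tendsto (fun n => beta c n / tau c n ^ ϱ) atTop (𝓝 0) :=
      (tendsto_beta hc).div_atTop hpt
    have h3 : Tendsto (fun n => 1 + 2 * (beta c n / tau c n ^ ϱ)) atTop (𝓝 (1 + 2 * 0)) :=
      tendsto_const_nhds.add (h2.const_mul 2)
    have h4 := h1.mul h3
    norm_num at h4
    refine h4.congr' ?_
    filter_upwards [(tendsto_tau hc).eventually_gt_atTop 0] with n hn
    have h5 : (0 : ℝ) < tau c n ^ ϱ := by positivity
    simp only [hf]
    rw [Real.rpow_sub_one hn.ne']
    field_simp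
  have lp := tendsto_rpow_sub_one hϱ1 (tendsto_tau hc)
  -- the two ends `y = 0` and `y = 1` of the affine lower bound
  have l0 : Tendsto (fun n => w n * (δ * d n - 4 * tau c n ^ (ϱ - 1)) - b n) atTop
      (𝓝 (1 / (1 - δ₁) * (δ * (3 / 4) - 4 * 0) - 0)) :=
    (lw.mul ((ld.const_mul δ).sub (lp.const_mul 4))).sub lb
  have l1 : Tendsto (fun n => w n * (δ * d n - 4 * tau c n ^ (ϱ - 1)) - b n + (a n - w n * f n))
      atTop (𝓝 (1 / (1 - δ₁) * (δ * (3 / 4) - 4 * 0) - 0 + (3 / 4 - 1 / (1 - δ₁) * (3 / 4)))) :=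
    l0.add (la.sub (lw.mul lf))
  have p0 : 0 < 1 / (1 - δ₁) * (δ * (3 / 4) - 4 * 0) - 0 := by
    have : 0 < 1 / (1 - δ₁) * δ := by positivity
    linarith
  have p1 : 0 < 1 / (1 - δ₁) * (δ * (3 / 4) - 4 * 0) - 0 + (3 / 4 - 1 / (1 - δ₁) * (3 / 4)) := by
    have e : 1 / (1 - δ₁) * (δ * (3 / 4) - 4 * 0) - 0 + (3 / 4 - 1 / (1 - δ₁) * (3 / 4)) =
        3 / 4 * ((δ - δ₁) / (1 - δ₁)) := by field_simp; ring
    rw [e]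
    have : 0 < (δ - δ₁) / (1 - δ₁) := div_pos (by linarith) hδ₁1
    linarith
  have lr := tendsto_tau_div_tauTilde hϱ1 hϱ'1 hc
  have lς : ∀ᶠ n in atTop, tauTilde c ϱ ϱ' n / 2 < sigmaTilde c ϱ ϱ' n := by
    filter_upwards [(tendsto_tauTilde hϱ1 hϱ'1 hc).eventually_gt_atTop 1,
      (tendsto_rpow_sub_one hϱ'1 (tendsto_tauTilde hϱ1 hϱ'1 hc)).eventually
      (gt_mem_nhds (by norm_num : (0 : ℝ) < 1 / 2))] with n hn hp
    unfold sigmaTilde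
    rw [sub_rpow_eq (by linarith)]
    nlinarith
  filter_upwards [(tendsto_tau hc).eventually_gt_atTop 1, l0.eventually (lt_mem_nhds p0),
    l1.eventually (lt_mem_nhds p1), lς,
    lr.eventually (gt_mem_nhds (by norm_num : (1 : ℝ) < 2)),
    ((tendsto_parMass hϱ1).comp (tendsto_tau hc)).eventually
      (lt_mem_nhds (by norm_num : (1 : ℝ) / 2 < 2 / 3)),
    lw.eventually (lt_mem_nhds (by positivity : 0 < 1 / (1 - δ₁)))]
    with n hτ h0 h1 hς hr hg hw0 v hv0 hvσ hvσ'
  have hlt := tau_lt_tau_succ (n := n) hc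
  have hτ' := hτ.trans hlt
  have hτ0 : 0 < tau c n := by linarith
  have hθ1 := one_lt_tauTilde hϱ1 hϱ'1 hτ (ϱ' := ϱ')
  have hβ := beta_pos hc n
  have hpr := isProfile_psi hϱ1 hϱ'1 hτ (ϱ' := ϱ')
  have hpr' := isProfile_psi hϱ1 hϱ'1 hτ' (ϱ' := ϱ')
  rw [div_lt_iff₀ (by linarith)] at hr
  rw [psi_eq_profile hϱ1 hϱ'1 hτ, psi_eq_profile hϱ1 hϱ'1 hτ']
  set U := 1 - (v / tau c n) ^ 2 with hU
  have hy0 : 0 ≤ v / tau c n := by positivity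
  have hys : v / tau c n < sigma c ϱ n / tau c n := div_lt_div_of_pos_right hvσ hτ0
  have hy1 : v / tau c n ≤ 1 := (div_le_one hτ0).2 (by linarith [hpr.σ_lt])
  have hp : tau c n ^ (ϱ - 1) = 1 - sigma c ϱ n / tau c n := (one_sub_cutoff_div hτ0).symm
  have hp0 := (rpow_sub_one_pos_lt_one hϱ1 hτ).1
  have hpU : tau c n ^ (ϱ - 1) ≤ U := by
    rw [hU, hp]
    exact one_sub_le_one_sub_sq hy0 hy1 hys.le
  have hU0 : 0 < U := hp0.trans_le hpU
  have hΛ := hM.integral_lam_ge hpr.isProbDensity hpr.le hη hη1 (by positivity)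
    (hpr.kernel_right (by linarith) (by linarith) hη hη1 hv0 hvσ hU)
  have hB := hpr.increment_right hpr' (amp_mul_right hϱ1 hτ) (amp_mul_right hϱ1 hτ') hg.le
    (parMass_mono hϱ1 hτ hlt.le) (by
      rw [mul_div_assoc', le_div_iff₀ hτ0, mul_comm]
      exact parMass_sub_le hϱ0.le hϱ1 hτ hlt.le) hp (by unfold beta; ring) hβ hδ0 hδ1 hv0 hvσ
    hvσ' hU
  have hscale : 0 < U * (beta c n / tau c n) := by positivity
  have herr : 4 * (amp c ϱ n ^ 2 * (30 * U ^ 2 / (tau c n * U) ^ (1 + η))) * M ≤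
      U * (beta c n / tau c n) * b n := by
    have h2 : (tau c n * U) ^ (-η) ≤ (tau c n ^ ϱ) ^ (-η) := by
      refine Real.rpow_le_rpow_of_nonpos (by positivity) ?_ (by linarith)
      have : tau c n ^ ϱ = tau c n * tau c n ^ (ϱ - 1) := by
        rw [Real.rpow_sub_one hτ0.ne']; field_simp
      rw [this]
      gcongr
    have h3 : U ^ 2 / (tau c n * U) ^ (1 + η) = U / tau c n * (tau c n * U) ^ (-η) := by
      rw [add_comm, Real.rpow_add_one (by positivity), Real.rpow_neg (by positivity)]
      have : 0 < (tau c n * U) ^ η := by positivity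
      field_simp
    have h4 : U * (beta c n / tau c n) * b n =
        120 * M * amp c ϱ n ^ 2 * (U / tau c n) * (tau c n ^ ϱ) ^ (-η) := by
      simp only [hb, ha]
      field_simp
      ring
    rw [h4, mul_div_assoc, h3]
    have h5 : 0 ≤ 120 * M * amp c ϱ n ^ 2 * (U / tau c n) := by positivity
    have h6 := mul_le_mul_of_nonneg_left h2 h5
    linarith
  have hdrift : amp c ϱ n ^ 2 * (2 * (v / tau c n) * U / tau c n) * (2 / 9 * c) =
      U * (beta c n / tau c n) * (v / tau c n * a n) := by
    simp only [ha]
    field_simp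
    ring
  have hBw := mul_le_mul_of_nonneg_left hB hw0.le
  have haff := mul_nonneg hscale.le (affine_nonneg hy0 hy1 h0.le h1.le)
  rw [hdrift, ← hMdef] at hΛ
  have hfin : U * (beta c n / tau c n) * (v / tau c n * a n) - U * (beta c n / tau c n) * b n
      + w n * (U * (beta c n / tau c n) * (δ * d n - v / tau c n * f n
        - 4 * tau c n ^ (ϱ - 1))) =
      U * (beta c n / tau c n) * (w n * (δ * d n - 4 * tau c n ^ (ϱ - 1)) - b n
        + v / tau c n * (a n - w n * f n)) := by ring
  have hΛ' : U * (beta c n / tau c n) * (v / tau c n * a n) - U * (beta c n / tau c n) * b n ≤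
      ∫ ω, Lam (profile (amp c ϱ n) (tau c n) (sigma c ϱ n) (tauTilde c ϱ ϱ' n)
        (sigmaTilde c ϱ ϱ' n)) (F ω) v ∂P := by
    linarith
  refine le_trans ?_ (add_le_add hΛ' hBw)
  exact hfin ▸ haff

/-- Beyond the right edge of `ψ_n` the positive part of the drift, of order `τ^{2ϱ-4}`, outweighs
the missing mass, of order `τ^{ϱ-4}`. -/
theorem eventually_nonneg_edge (hM : IsModel P F η c e S)
    (hϱ0 : 0 < ϱ) (hϱ1 : ϱ < 1) (hϱ'1 : ϱ' < 1) (hκ : 0 < κ) (hδ0 : 0 < δ)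
    (hδ₁ : δ₁ < 1) :
    ∀ᶠ n in atTop, ∀ v, sigma c ϱ n ≤ v → v + δ * beta c n < sigma c ϱ (n + 1) →
      0 ≤ (∫ ω, Lam (psi c ϱ ϱ' n) (F ω) v ∂P)
        + (1 - qSeq δ₁ κ (n + 1)) / (1 - qSeq δ₁ κ n) ^ 2
            * (cdfOf (psi c ϱ ϱ' (n + 1)) (v + δ * beta c n) - cdfOf (psi c ϱ ϱ' n) v) := by
  have hc := hM.pos
  obtain ⟨k, hk, hm⟩ := hM.core_pos
  set m := ∫ p, coreWidth e S k p ∂(prodIoi P) with hmdef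
  have hδ₁1 : 0 < 1 - δ₁ := by linarith
  have hk0 : (0 : ℝ) < k := by exact_mod_cast hk
  set w : ℕ → ℝ := fun n => (1 - qSeq δ₁ κ (n + 1)) / (1 - qSeq δ₁ κ n) ^ 2 with hw
  have hpt : Tendsto (fun n => tau c n ^ ϱ) atTop atTop :=
    (tendsto_rpow_atTop hϱ0).comp (tendsto_tau hc)
  have lw : Tendsto w atTop (𝓝 (1 / (1 - δ₁))) := tendsto_weight hκ hδ₁
  have linv : Tendsto (fun n => (tau c n ^ ϱ)⁻¹) atTop (𝓝 0) := hpt.inv_tendsto_atTop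
  -- the difference of the two terms, divided by `(τ^{ϱ-2})²`
  have l : Tendsto (fun n => (amp c ϱ n * tau c n) ^ 2 * m - w n * (amp c ϱ (n + 1) * tau c n * 2 *
      (beta c n * tau c n ^ 2) * ((tau c n ^ ϱ)⁻¹ + beta c n * ((tau c n ^ ϱ)⁻¹) ^ 2))) atTop
      (𝓝 ((3 / 4) ^ 2 * m - 1 / (1 - δ₁) * (3 / 4 * 2 * (c / 3) * (0 + 0 * 0 ^ 2)))) :=
    (((tendsto_amp_mul_tau hϱ1 hc).pow 2).mul_const m).sub (lw.mul
      ((((tendsto_amp_succ_mul_tau hϱ1 hc).mul_const 2).mul (tendsto_beta_mul_sq hc)).mul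
        (linv.add ((tendsto_beta hc).mul (linv.pow 2)))))
  have lpos : 0 < (3 / 4 : ℝ) ^ 2 * m - 1 / (1 - δ₁) * (3 / 4 * 2 * (c / 3) * (0 + 0 * 0 ^ 2)) := by
    norm_num
    exact hm
  filter_upwards [(tendsto_tau hc).eventually_gt_atTop 1, l.eventually (lt_mem_nhds lpos),
    (tendsto_sigma hϱ1 hc).eventually_ge_atTop (k : ℝ),
    (tendsto_beta hc).eventually (gt_mem_nhds (by positivity : (0 : ℝ) < 1 / k)),
    lw.eventually (lt_mem_nhds (by positivity : 0 < 1 / (1 - δ₁)))]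
    with n hτ hl hkσ hβk hw0 v hvσ hvσ'
  have hlt := tau_lt_tau_succ (n := n) hc
  have hτ' := hτ.trans hlt
  have hτ0 : 0 < tau c n := by linarith
  have hβ := beta_pos hc n
  have hpr := isProfile_psi hϱ1 hϱ'1 hτ (ϱ' := ϱ')
  have hpr' := isProfile_psi hϱ1 hϱ'1 hτ' (ϱ' := ϱ')
  have hσσ := sigma_succ_sub_le hc hϱ0 hτ
  have hδβ : 0 < δ * beta c n := by positivity
  rw [psi_eq_profile hϱ1 hϱ'1 hτ, psi_eq_profile hϱ1 hϱ'1 hτ']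
  have hp : tau c n ^ (ϱ - 1) = 1 - sigma c ϱ n / tau c n := (one_sub_cutoff_div hτ0).symm
  have hp0 := (rpow_sub_one_pos_lt_one hϱ1 hτ).1
  have hB := hpr.increment_edge hpr' hp (by unfold beta; ring) hβ hσσ hδ0 hvσ hvσ'
  have hΛ : amp c ϱ n ^ 2 * (tau c n ^ (ϱ - 1)) ^ 2 * m ≤
      ∫ ω, Lam (profile (amp c ϱ n) (tau c n) (sigma c ϱ n) (tauTilde c ϱ ϱ' n)
        (sigmaTilde c ϱ ϱ' n)) (F ω) v ∂P := by
    rw [hM.integral_lam hpr.isProbDensity hpr.le, hmdef, ← integral_const_mul, hp]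
    refine integral_mono_ae ?_ (hM.integrable_kernel hpr.isProbDensity hpr.le v) ?_
    · refine Integrable.const_mul (hM.int_one.mono'
        (measurable_coreWidth hM.meas_sign hM.meas k).aestronglyMeasurable
        (Eventually.of_forall fun p => ?_)) _
      rw [Real.norm_of_nonneg (coreWidth_nonneg e S k p)]
      exact coreWidth_le hM.nonneg k p
    · filter_upwards [ae_snd_pos P] with p hp
      exact hpr.kernel_edge hM.sign hM.nonneg hvσ (by linarith) hkσ hp
  have hBw := mul_le_mul_of_nonneg_left hB hw0.le
  refine le_trans ?_ (add_le_add hΛ hBw)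
  have hR : 0 < tau c n ^ ϱ := by positivity
  have e1 : amp c ϱ n ^ 2 * (tau c n ^ (ϱ - 1)) ^ 2 * m + w n * -(amp c ϱ (n + 1) *
      (2 * (tau c n ^ (ϱ - 1) + beta c n / tau c n)) * beta c n) =
      (tau c n ^ ϱ) ^ 2 / tau c n ^ 4 *
      ((amp c ϱ n * tau c n) ^ 2 * m - w n * (amp c ϱ (n + 1) * tau c n * 2 *
      (beta c n * tau c n ^ 2) * ((tau c n ^ ϱ)⁻¹ + beta c n * ((tau c n ^ ϱ)⁻¹) ^ 2))) := by
    rw [Real.rpow_sub_one hτ0.ne']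
    generalize tau c n ^ ϱ = R at *
    field_simp
    ring
  rw [e1]
  positivity

end Ranges

theorem qSeq_mem {δ₁ κ : ℝ} (hκ : 0 < κ) (hδ₁0 : 0 < δ₁) (hδ₁ : δ₁ < 1) {n : ℕ} (hn : 2 ≤ n) :
    0 < qSeq δ₁ κ n ∧ qSeq δ₁ κ n < 1 := by
  have hn1 : (1 : ℝ) < n := by exact_mod_cast hn
  have h1 : (n : ℝ) ^ (-κ) < 1 := Real.rpow_lt_one_of_one_lt_of_neg hn1 (by linarith)
  have h2 : 0 < (n : ℝ) ^ (-κ) := Real.rpow_pos_of_pos (by linarith) _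
  unfold qSeq
  constructor
  · exact mul_pos hδ₁0 (by linarith)
  · nlinarith

theorem qSeq_mono {δ₁ κ : ℝ} (hκ : 0 < κ) (hκ1 : κ ≤ 1) (hδ₁ : 0 < δ₁) {n : ℕ} (hn : 0 < n) :
    0 ≤ qSeq δ₁ κ (n + 1) - qSeq δ₁ κ n :=
  le_trans (by positivity) (qSeq_succ_sub_ge hκ hκ1 hδ₁ hn)

theorem qSeq_term_ge {A τ σ θ ς δ₁ κ : ℝ} (h : IsProfile A τ σ θ ς) (hκ : 0 < κ) (hκ1 : κ ≤ 1)
    (hδ₁0 : 0 < δ₁) (hδ₁ : δ₁ < 1) {n : ℕ} (hn : 2 ≤ n) {v : ℝ} (hv0 : v < 0) :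
    (qSeq δ₁ κ (n + 1) - qSeq δ₁ κ n) * (1 / 2) ≤
      (qSeq δ₁ κ (n + 1) - qSeq δ₁ κ n) / (1 - qSeq δ₁ κ n) ^ 2
        * (1 - cdfOf (profile A τ σ θ ς) v) := by
  obtain ⟨hq0, hq1⟩ := qSeq_mem hκ hδ₁0 hδ₁ hn
  have h2 := qSeq_mono hκ hκ1 hδ₁0 (by omega : 0 < n)
  have h3 := h.isProbDensity.cdfOf_mono hv0.le
  rw [h.cdf_zero] at h3
  have h4 : qSeq δ₁ κ (n + 1) - qSeq δ₁ κ n ≤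
      (qSeq δ₁ κ (n + 1) - qSeq δ₁ κ n) / (1 - qSeq δ₁ κ n) ^ 2 := by
    rw [le_div_iff₀ (pow_pos (by linarith) 2)]
    have h5 : (1 - qSeq δ₁ κ n) ^ 2 ≤ 1 := by nlinarith
    nlinarith
  exact mul_le_mul h4 (by linarith) (by norm_num) (h2.trans h4)

/-- The increments of `q_n` absorb the errors of the expansion on the left half, the jump at the
left edge included. -/
theorem eventually_error_le {η c ϱ ϱ' κ δ₁ : ℝ} (hc : 0 < c) (hϱ1 : ϱ < 1) (hϱ'1 : ϱ' < 1)
    (hκ : 0 < κ) (hκ1 : κ ≤ 1) (hκη : 3 * κ < η) (hκϱ : ϱ' < (1 - 3 * κ) / 2)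
    (hδ₁0 : 0 < δ₁) (K₁ K₂ : ℝ) :
    ∀ᶠ n in atTop, K₁ * (amp c ϱ n ^ 2 / tauTilde c ϱ ϱ' n ^ (1 + η))
        + K₂ * (amp c ϱ n ^ 2 * (tauTilde c ϱ ϱ' n ^ (ϱ' - 1)) ^ 2) ≤
      (qSeq δ₁ κ (n + 1) - qSeq δ₁ κ n) * (1 / 2) := by
  have l1 := tendsto_negligible hϱ1 hϱ'1 hc (by linarith : 1 + 3 * κ < 1 + η)
  have l2 := tendsto_negligible hϱ1 hϱ'1 hc (by linarith : 1 + 3 * κ < 2 - 2 * ϱ')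
  have l := (l1.const_mul K₁).add (l2.const_mul K₂)
  simp only [mul_zero, add_zero] at l
  filter_upwards [l.eventually (gt_mem_nhds (by positivity : 0 < δ₁ * κ / 4)),
    (tendsto_tau hc).eventually_gt_atTop 1, eventually_gt_atTop 0] with n hl hτ hn
  have hθ : 0 < tauTilde c ϱ ϱ' n := by linarith [one_lt_tauTilde hϱ1 hϱ'1 hτ (ϱ' := ϱ')]
  have hq := qSeq_succ_sub_ge hκ hκ1 hδ₁0 hn
  have hn0 : (0 : ℝ) < n := by exact_mod_cast hn
  have hpow : (0 : ℝ) < (n : ℝ) ^ (κ + 1) := by positivity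
  have e1 : (tauTilde c ϱ ϱ' n ^ (ϱ' - 1)) ^ 2 = tauTilde c ϱ ϱ' n ^ (-(2 - 2 * ϱ')) := by
    rw [← Real.rpow_natCast, ← Real.rpow_mul hθ.le]
    congr 1
    push_cast
    ring
  have e2 : amp c ϱ n ^ 2 / tauTilde c ϱ ϱ' n ^ (1 + η) =
      amp c ϱ n ^ 2 * tauTilde c ϱ ϱ' n ^ (-(1 + η)) := by
    rw [Real.rpow_neg hθ.le, div_eq_mul_inv]
  rw [e1, e2]
  have h1 : (K₁ * (amp c ϱ n ^ 2 * tauTilde c ϱ ϱ' n ^ (-(1 + η)))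
      + K₂ * (amp c ϱ n ^ 2 * tauTilde c ϱ ϱ' n ^ (-(2 - 2 * ϱ')))) * (n : ℝ) ^ (κ + 1) ≤
      δ₁ * κ / 4 := by linarith
  rw [← le_div_iff₀ hpow, div_eq_mul_inv] at h1
  linarith

section Left

variable {Ω : Type*} [MeasurableSpace Ω] {P : Measure Ω} [IsProbabilityMeasure P]
  {F : Ω → ℝ → ℝ → ℝ} {η c : ℝ} {e : Ω → ℝ} {S : Ω × ℝ → ℝ} {ϱ ϱ' κ δ δ₁ : ℝ}

/-- On the left half and beyond, the errors of the expansion are absorbed by the increments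
of `q_n`. -/
theorem eventually_nonneg_left (hM : IsModel P F η c e S) (hη : 0 < η) (hη1 : η ≤ 1)
    (hϱ1 : ϱ < 1) (hϱ'0 : 0 < ϱ') (hϱ'1 : ϱ' < 1) (hκ : 0 < κ) (hκ1 : κ ≤ 1)
    (hκη : 3 * κ < η) (hκϱ : ϱ' < (1 - 3 * κ) / 2)
    (hδ0 : 0 < δ) (hδ1 : δ < 1) (hδ₁0 : 0 < δ₁) (hδ₁ : δ₁ < 1) :
    ∀ᶠ n in atTop, ∀ v, v < 0 →
      0 ≤ (∫ ω, Lam (psi c ϱ ϱ' n) (F ω) v ∂P)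
        + (1 - qSeq δ₁ κ (n + 1)) / (1 - qSeq δ₁ κ n) ^ 2
            * (cdfOf (psi c ϱ ϱ' (n + 1)) (v + δ * beta c n) - cdfOf (psi c ϱ ϱ' n) v)
        + (qSeq δ₁ κ (n + 1) - qSeq δ₁ κ n) / (1 - qSeq δ₁ κ n) ^ 2
            * (1 - cdfOf (psi c ϱ ϱ' n) v) := by
  have hc := hM.pos
  set M := ∫ p, (p.2 ^ (1 + η) * S p + S p ^ (2 + η)) ∂(prodIoi P) with hMdef
  set M₁ := ∫ p, S p ∂(prodIoi P) with hM₁def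
  have hδ₁1 : 0 < 1 - δ₁ := by linarith
  set a : ℕ → ℝ := fun n => amp c ϱ n ^ 2 / beta c n * (4 / 9 * c) with ha
  set w : ℕ → ℝ := fun n => (1 - qSeq δ₁ κ (n + 1)) / (1 - qSeq δ₁ κ n) ^ 2 with hw
  set d : ℕ → ℝ := fun n => amp c ϱ (n + 1) * tau c n * (1 - (beta c n / tau c n) ^ 2) with hd
  set f : ℕ → ℝ := fun n => 3 / 4 * (parMass ϱ (tau c n) /
    (2 / 3 + 2 * (tauTilde c ϱ ϱ' n ^ (ϱ' - 1)) ^ 2)) * (tau c n / tauTilde c ϱ ϱ' (n + 1)) with hf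
  have la : Tendsto a atTop (𝓝 (3 / 4)) := tendsto_drift hϱ1 hc
  have lw : Tendsto w atTop (𝓝 (1 / (1 - δ₁))) := tendsto_weight hκ hδ₁
  have lr := tendsto_tau_div_tauTilde hϱ1 hϱ'1 hc
  have ld : Tendsto d atTop (𝓝 (3 / 4 * (1 - 0 ^ 2))) :=
    (tendsto_amp_succ_mul_tau hϱ1 hc).mul (tendsto_const_nhds.sub ((tendsto_beta_div_tau hc).pow 2))
  have lf : Tendsto f atTop (𝓝 (3 / 4 * ((2 / 3) / (2 / 3 + 2 * 0 ^ 2)) * 1)) := by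
    refine Tendsto.mul (Tendsto.const_mul _ (Tendsto.div ((tendsto_parMass hϱ1).comp
      (tendsto_tau hc)) (tendsto_const_nhds.add (((tendsto_rpow_sub_one hϱ'1
      (tendsto_tauTilde hϱ1 hϱ'1 hc)).pow 2).const_mul 2)) (by norm_num)))
      (tendsto_tau_div_tauTilde_succ hϱ1 hϱ'1 hc)
  have l0 := lw.mul (ld.const_mul δ)
  have l1 := l0.add ((lw.mul lf).sub (la.mul lr))
  have p0 : 0 < 1 / (1 - δ₁) * (δ * (3 / 4 * (1 - 0 ^ 2))) := by
    norm_num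
    positivity
  have p1 : 0 < 1 / (1 - δ₁) * (δ * (3 / 4 * (1 - 0 ^ 2))) +
      (1 / (1 - δ₁) * (3 / 4 * ((2 / 3) / (2 / 3 + 2 * 0 ^ 2)) * 1) - 3 / 4 * 1) := by
    have e : 1 / (1 - δ₁) * (δ * (3 / 4 * (1 - 0 ^ 2))) +
      (1 / (1 - δ₁) * (3 / 4 * ((2 / 3) / (2 / 3 + 2 * 0 ^ 2)) * 1) - 3 / 4 * 1) =
        3 / 4 * ((δ + δ₁) / (1 - δ₁)) := by
      norm_num
      field_simp
      ring
    rw [e]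
    positivity
  filter_upwards [(tendsto_tau hc).eventually_gt_atTop 1, l0.eventually (lt_mem_nhds p0),
    l1.eventually (lt_mem_nhds p1),
    eventually_error_le hc hϱ1 hϱ'1 hκ hκ1 hκη hκϱ hδ₁0 (36 * M) (9 * M₁),
    (tendsto_beta hc).eventually (gt_mem_nhds zero_lt_one),
    ((tendsto_sigma hϱ1 hc).comp (tendsto_add_atTop_nat 1)).eventually_gt_atTop 1,
    lw.eventually (lt_mem_nhds (by positivity : 0 < 1 / (1 - δ₁))), eventually_ge_atTop 2]
    with n hτ h0 h1 herr hβ1 hσ1 hw0 hn v hv0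
  have hlt := tau_lt_tau_succ (n := n) hc
  have hτ' := hτ.trans hlt
  have hτ0 : 0 < tau c n := by linarith
  have hθ1 := one_lt_tauTilde hϱ1 hϱ'1 hτ (ϱ' := ϱ')
  have hθ0 : 0 < tauTilde c ϱ ϱ' n := by linarith
  have hθ'1 := one_lt_tauTilde hϱ1 hϱ'1 hτ' (ϱ' := ϱ')
  have hβ := beta_pos hc n
  have hpr := isProfile_psi hϱ1 hϱ'1 hτ (ϱ' := ϱ')
  have hpr' := isProfile_psi hϱ1 hϱ'1 hτ' (ϱ' := ϱ')
  rw [psi_eq_profile hϱ1 hϱ'1 hτ, psi_eq_profile hϱ1 hϱ'1 hτ']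
  simp only [Function.comp_apply] at hσ1
  have hp : 1 - sigmaTilde c ϱ ϱ' n / tauTilde c ϱ ϱ' n = tauTilde c ϱ ϱ' n ^ (ϱ' - 1) :=
    one_sub_cutoff_div hθ0
  have hQ := qSeq_term_ge hpr hκ hκ1 hδ₁0 hδ₁ hn hv0
  have eerr : 4 * (amp c ϱ n ^ 2 * (9 / tauTilde c ϱ ϱ' n ^ (1 + η))) * M +
      amp c ϱ n ^ 2 * (9 * (tauTilde c ϱ ϱ' n ^ (ϱ' - 1)) ^ 2) * M₁ =
      36 * M * (amp c ϱ n ^ 2 / tauTilde c ϱ ϱ' n ^ (1 + η))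
        + 9 * M₁ * (amp c ϱ n ^ 2 * (tauTilde c ϱ ϱ' n ^ (ϱ' - 1)) ^ 2) := by ring
  rcases le_or_gt v (-sigmaTilde c ϱ ϱ' n) with hvς | hvς
  · have hΛ := hM.integral_lam_ge hpr.isProbDensity hpr.le hη hη1
      (mul_nonneg (sq_nonneg _) (by positivity)) (hpr.kernel_outside hη hη1 hvς)
    rw [← hMdef, ← hM₁def, hp] at hΛ
    have hB : 0 ≤ w n * (cdfOf (profile (amp c ϱ (n + 1)) (tau c (n + 1)) (sigma c ϱ (n + 1))
        (tauTilde c ϱ ϱ' (n + 1)) (sigmaTilde c ϱ ϱ' (n + 1))) (v + δ * beta c n) -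
        cdfOf (profile (amp c ϱ n) (tau c n) (sigma c ϱ n) (tauTilde c ϱ ϱ' n)
          (sigmaTilde c ϱ ϱ' n)) v) := by
      rw [hpr.cdf_eq_zero hvς, sub_zero]
      exact mul_nonneg hw0.le (hpr'.isProbDensity.cdfOf_nonneg _)
    linarith
  · set x := -v / tauTilde c ϱ ϱ' n with hx
    set U := 1 - x ^ 2 with hU
    have hx0 : 0 ≤ x := by rw [hx]; exact div_nonneg (by linarith) hθ0.le
    have hx1 : x ≤ 1 := by rw [hx, div_le_one hθ0]; linarith [hpr.ς_lt]
    have hU0 : 0 ≤ U := sub_nonneg.2 (pow_le_one₀ hx0 hx1)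
    have hΛ := hM.integral_lam_ge hpr.isProbDensity hpr.le hη hη1
      (mul_nonneg (sq_nonneg _) (by positivity)) (hpr.kernel_left hη hη1 hv0 hvς hx hU)
    rw [← hMdef, ← hM₁def, hp] at hΛ
    have hθθ := tauTilde_le_succ hc hϱ1 hϱ'1 hτ (ϱ' := ϱ')
    have hB := hpr.increment_left hpr' (amp_mul_left hϱ1 hϱ'1 hτ) (amp_mul_left hϱ1 hϱ'1 hτ')
      (parMass_pos hϱ'1 hθ1) (parMass_mono hϱ'1 hθ1 hθθ) (parMass_le hϱ'1 hθ'1) hlt.le hθθ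
      (cutoff_mono hϱ'1 hθ1 hθθ) hβ (by linarith) hδ0 hδ1 hv0 hvς hx hU (by linarith)
    have hscale : 0 ≤ U * (beta c n / tau c n) := by positivity
    have hfle : f n ≤ 3 / 4 * ((tauTilde c ϱ ϱ' (n + 1) - tauTilde c ϱ ϱ' n) / beta c n) *
        (tau c n / tauTilde c ϱ ϱ' (n + 1)) := by
      have h2 : parMass ϱ (tau c n) / (2 / 3 + 2 * (tauTilde c ϱ ϱ' n ^ (ϱ' - 1)) ^ 2) ≤
          (tauTilde c ϱ ϱ' (n + 1) - tauTilde c ϱ ϱ' n) / beta c n := by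
        rw [div_le_div_iff₀ (by positivity) hβ]
        linarith [beta_mul_le hc hϱ1 hϱ'0.le hϱ'1 hτ]
      have h3 : 0 < tauTilde c ϱ ϱ' (n + 1) := by linarith
      simp only [hf]
      gcongr
    have hB' : U * (beta c n / tau c n) * (δ * d n + x * f n) ≤
        cdfOf (profile (amp c ϱ (n + 1)) (tau c (n + 1)) (sigma c ϱ (n + 1))
          (tauTilde c ϱ ϱ' (n + 1)) (sigmaTilde c ϱ ϱ' (n + 1))) (v + δ * beta c n) -
        cdfOf (profile (amp c ϱ n) (tau c n) (sigma c ϱ n) (tauTilde c ϱ ϱ' n)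
          (sigmaTilde c ϱ ϱ' n)) v := by
      refine le_trans (mul_le_mul_of_nonneg_left ?_ hscale) hB
      have := mul_le_mul_of_nonneg_left hfle hx0
      linarith
    have hBw := mul_le_mul_of_nonneg_left hB' hw0.le
    have hdrift : amp c ϱ n ^ 2 * (-(2 * x * U / tauTilde c ϱ ϱ' n)) * (2 / 9 * c) =
        -(U * (beta c n / tau c n) * (x * (a n * (tau c n / tauTilde c ϱ ϱ' n)))) := by
      simp only [ha]
      clear_value U x
      field_simp
      ring
    rw [hdrift] at hΛ
    have haff := mul_nonneg hscale (affine_nonneg hx0 hx1 h0.le h1.le)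
    have hfin : -(U * (beta c n / tau c n) * (x * (a n * (tau c n / tauTilde c ϱ ϱ' n)))) +
        w n * (U * (beta c n / tau c n) * (δ * d n + x * f n)) =
        U * (beta c n / tau c n) * (w n * (δ * d n) +
          x * (w n * f n - a n * (tau c n / tauTilde c ϱ ϱ' n))) := by ring
    rw [← hfin] at haff
    change 0 ≤ _ + w n * _ + _
    linarith

end Left

/-- The requirements of the Lambda condition hold for all large `n`. -/
theorem exists_lambdaConditionAt {Ω : Type*} [MeasurableSpace Ω] {P : Measure Ω}
    [IsProbabilityMeasure P] {F : Ω → ℝ → ℝ → ℝ} {η c : ℝ} {e : Ω → ℝ} {S : Ω × ℝ → ℝ}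
    {ϱ ϱ' κ δ δ₁ : ℝ} (hM : IsModel P F η c e S) (hη : 0 < η) (hη1 : η ≤ 1)
    (hϱ0 : 0 < ϱ) (hϱ1 : ϱ < 1) (hϱ'0 : 0 < ϱ') (hκ : 0 < κ)
    (hκη : 3 * κ < η) (hκϱ : ϱ' < (1 - 3 * κ) / 2)
    (hδ0 : 0 < δ) (hδ1 : δ < 1) (hδ₁0 : 0 < δ₁) (hδ₁ : δ₁ < δ) :
    ∃ n₀ : ℕ, 1 ≤ n₀ ∧
      LambdaConditionAt P F (psi c ϱ ϱ') (sigma c ϱ) (beta c) δ (qSeq δ₁ κ) n₀ := by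
  have hϱ'1 : ϱ' < 1 := by linarith
  have hκ1 : κ ≤ 1 := by linarith
  have hδ₁1 : δ₁ < 1 := by linarith
  have hc := hM.pos
  obtain ⟨n₀, hn₀⟩ := eventually_atTop.1 ((((tendsto_tau hc).eventually_gt_atTop 1).and
    (eventually_ge_atTop 2)).and
    ((eventually_nonneg_left hM hη hη1 hϱ1 hϱ'0 hϱ'1 hκ hκ1 hκη hκϱ hδ0 hδ1 hδ₁0 hδ₁1).and
    ((eventually_nonneg_right hM hη hη1 hϱ0 hϱ1 hϱ'1 hκ hδ0 hδ1 hδ₁0 hδ₁).and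
    (eventually_nonneg_edge hM hϱ0 hϱ1 hϱ'1 hκ hδ0 hδ₁1))))
  refine ⟨max n₀ 1, le_max_right _ _, fun n hn => ?_⟩
  obtain ⟨⟨hτ, hn2⟩, hleft, hright, hedge⟩ := hn₀ n ((le_max_left _ _).trans hn)
  have hpr := isProfile_psi hϱ1 hϱ'1 hτ (ϱ' := ϱ')
  have hψ := psi_eq_profile hϱ1 hϱ'1 hτ (ϱ' := ϱ')
  obtain ⟨hq0, hq1⟩ := qSeq_mem hκ hδ₁0 hδ₁1 hn2
  refine ⟨hpr.σ_pos.le, (beta_pos hc n).le, ?_, ?_, hq0, hq1, fun v hv => ⟨?_, ?_⟩⟩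
  · rw [hψ]; exact hpr.isProbDensity
  · rw [hψ]; exact hpr.support_subset.trans fun x hx => hx.2
  · rw [hψ]; exact hM.integrable_lam hpr.isProbDensity hpr.le v
  rcases lt_or_ge v 0 with hv0 | hv0
  · exact hleft v hv0
  have hQ : 0 ≤ (qSeq δ₁ κ (n + 1) - qSeq δ₁ κ n) / (1 - qSeq δ₁ κ n) ^ 2
      * (1 - cdfOf (psi c ϱ ϱ' n) v) := by
    have h2 := qSeq_mono hκ hκ1 hδ₁0 (by omega : 0 < n)
    rw [hψ]
    exact mul_nonneg (div_nonneg h2 (sq_nonneg _))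
      (sub_nonneg.2 (hpr.isProbDensity.cdfOf_le_one v))
  refine add_nonneg ?_ hQ
  rcases lt_or_ge v (sigma c ϱ n) with hvσ | hvσ
  · exact hright v hv0 hvσ (by linarith)
  · exact hedge v hvσ (by linarith)

end HomSys

theorem theorem2p6 {Ω : Type*} [MeasurableSpace Ω] (P : Measure Ω) [IsProbabilityMeasure P]
    (F : Ω → ℝ → ℝ → ℝ)
    (hF_meas : ∀ x y : ℝ, 0 < x → 0 < y → Measurable (fun ω => F ω x y))
    (hF_H : ∀ᵐ ω ∂P, HomSys.IsH (F ω))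
    (hF_nontrivial : 0 < P {ω | ¬ HomSys.IsTrivial (F ω)})
    (hF_Gam : ∫ ω, (HomSys.Gam 0 1 (F ω)).toReal * HomSys.eps (F ω) ∂P = 0)
    (hF_eps : ∫ ω, HomSys.eps (F ω) ∂P = 0)
    (η : ℝ) (hη : 0 < η)
    (hF_mom₁ : ∫⁻ ω, HomSys.Gam (1 + η) 1 (F ω) ∂P < ∞)
    (hF_mom₂ : ∫⁻ ω, HomSys.Gam 0 (2 + η) (F ω) ∂P < ∞)
    (ϱ : ℝ) (hϱ : 1 / (1 + min η 1) < ϱ) (hϱ1 : ϱ < 1)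
    (κ : ℝ) (hκ : 0 < κ) (hκ1 : κ < min (2 - 2 * ϱ) (min η 1) / 3)
    (ϱ' : ℝ) (hϱ' : 0 < ϱ') (hϱ'1 : ϱ' < (1 - 3 * κ) / 2) :
    HomSys.LambdaCondition P F
        (HomSys.psi (HomSys.cStar P F) ϱ ϱ')
        (HomSys.sigma (HomSys.cStar P F) ϱ)
        (HomSys.beta (HomSys.cStar P F)) ∧
      ∀ δ : ℝ, 0 < δ → δ < 1 → ∀ δ₁ : ℝ, 0 < δ₁ → δ₁ < δ / 9 →
        ∃ n₀ : ℕ, 1 ≤ n₀ ∧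
          HomSys.LambdaConditionAt P F
            (HomSys.psi (HomSys.cStar P F) ϱ ϱ')
            (HomSys.sigma (HomSys.cStar P F) ϱ)
            (HomSys.beta (HomSys.cStar P F))
            δ (HomSys.qSeq δ₁ κ) n₀ := by

  have hm : 0 < min η 1 := lt_min hη one_pos
  have hϱ0 : 0 < ϱ := lt_trans (by positivity) hϱ
  have hκη : 3 * κ < min η 1 := by
    have := min_le_right (2 - 2 * ϱ) (min η 1)
    linarith
  obtain ⟨e, S, hM⟩ := HomSys.exists_isModel P F hF_meas hF_H hF_nontrivial hF_Gam hη hF_mom₁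
    hF_mom₂ hm (min_le_left η 1)
  have key : ∀ δ : ℝ, 0 < δ → δ < 1 → ∀ δ₁ : ℝ, 0 < δ₁ → δ₁ < δ / 9 →
      ∃ n₀ : ℕ, 1 ≤ n₀ ∧ HomSys.LambdaConditionAt P F (HomSys.psi (HomSys.cStar P F) ϱ ϱ')
        (HomSys.sigma (HomSys.cStar P F) ϱ) (HomSys.beta (HomSys.cStar P F))
        δ (HomSys.qSeq δ₁ κ) n₀ := by
    intro δ hδ0 hδ1 δ₁ hδ₁0 hδ₁
    exact HomSys.exists_lambdaConditionAt hM hm (min_le_right η 1) hϱ0 hϱ1 hϱ' hκ hκη hϱ'1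
      hδ0 hδ1 hδ₁0 (by linarith)
  refine ⟨fun δ hδ0 hδ1 => ?_, key⟩
  obtain ⟨n₀, h1, h2⟩ := key δ hδ0 hδ1 (δ / 18) (by linarith) (by linarith)
  exact ⟨n₀, _, h1, h2⟩
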